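/- Let $N\ge 0$ be an integer and let the indices $i,j,k,l$ run through $\pm1,\dots,\pm N$. Put $\bar\imath=0$ if $i>0$ and $\bar\imath=1$ if $i<0$. **The Yangian.** $\mathrm{Y}(\mathfrak q_N)$ is the associative unital $\mathbb Z_2$-graded algebra over $\mathbb C$ with generators $T_{ij}^{(s)}$, $s=1,2,\dots$, of $\mathbb Z_2$-degree $\bar\imath+\bar\jmath$. Its defining relations are written in terms of the series $T_{ij}(u)=\delta_{ij}+T_{ij}^{(1)}u^{-1}+T_{ij}^{(2)}u^{-2}+\cdots$ and are $$(u^2-v^2)\,[T_{ij}(u),T_{kl}(v)]\,(-1)^{\bar\imath\bar k+\bar\imath\bar l+\bar k\bar l}=(u+v)\bigl(T_{kj}(u)T_{il}(v)-T_{kj}(v)T_{il}(u)\bigr)-(u-v)\bigl(T_{-k,j}(u)T_{-i,l}(v)-T_{k,-j}(v)T_{i,-l}(u)\bigr)(-1)^{\bar k+\bar l}$$ and $T_{ij}(-u)=T_{-i,-j}(u)$, where the square brackets denote the supercommutator. Equip $\mathrm{Y}(\mathfrak q_N)$ with the ascending $\mathbb Z$-filtration for which $T_{ij}^{(s)}$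 has degree $s-1$. Let $\mathrm{gr}\,\mathrm{Y}(\mathfrak q_N)$ be the corresponding $\mathbb Z$-graded algebra, with the $\mathbb Z_2$-gradation inherited from $\mathrm{Y}(\mathfrak q_N)$. Let $G_{ij}^{(s)}$ be the class of $T_{ij}^{(s)}$ in the component of degree $s-1$ of $\mathrm{gr}\,\mathrm{Y}(\mathfrak q_N)$. **The Lie superalgebra.** Let $E_{ij}$ be the standard matrix units of $\mathfrak{gl}_{N|N}$ over $\mathbb C$, of $\mathbb Z_2$-degree $\bar\imath+\bar\jmath$, and let $\eta$ be the automorphism $E_{ij}\mapsto E_{-i,-j}$ of $\mathfrak{gl}_{N|N}$. Let $$\mathfrak g=\{X(u)\in\mathfrak{gl}_{N|N}[u]\;:\;\eta(X(u))=X(-u)\},$$ with pointwise supercommutator, and let $\mathrm U(\mathfrak g)$ be its universal enveloping algebra with the natural $\mathbb Z_2$-gradation. For $s\ge0$ put $F_{ij}^{(s)}=E_{ij}u^s+E_{-i,-j}(-u)^s\in\mathfrak g$. **Theorem.** The algebras $\mathrm U(\mathfrak g)$ and $\mathrm{gr}\,\mathrm Y(\mathfrak q_N)$ are $\mathbb Z_2$-graded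 by the gradations described above, and there is an isomorphism of $\mathbb Z_2$-graded associative unital algebras $\mathrm U(\mathfrak g)\to\mathrm{gr}\,\mathrm Y(\mathfrak q_N)$ such that $$F_{ji}^{(s)}\mapsto-(-1)^{\bar\jmath}\,G_{ij}^{(s+1)}\qquad\text{for all }i,j\text{ and all }s\ge0.$$ -/

import Mathlib

open scoped DirectSum Polynomial

/-! ### Conventions on signs and on gradations -/

/-- The sign `(-1) ^ a` for `a` in `ℤ/2`. -/
def superSign (a : ZMod 2) : ℂ := (-1) ^ a.val

theorem superSign_mul_self (a : ZMod 2) : superSign a * superSign a = 1 := by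
  fin_cases a <;> simp [superSign, ZMod.val]

/-- For a family `g` of elements of an algebra, whose members carry degrees `deg`, the linear span
of all the products `g x₁ ⋯ g xₘ` (with `m ≥ 0`) whose total degree satisfies the condition `P`. -/
def wordSpan {S M B : Type*} [AddMonoid M] [Ring B] [Algebra ℂ B]
    (g : S → B) (deg : S → M) (P : M → Prop) : Submodule ℂ B :=
  Submodule.span ℂ {b | ∃ w : List S, P (w.map deg).sum ∧ b = (w.map g).prod}

/-- The subspaces `𝒜 0` and `𝒜 1` make `A` into a `ℤ/2`-graded algebra. -/
structure IsSuperGrading {A : Type*} [Ring A] [Algebra ℂ A] (𝒜 : ZMod 2 → Submodule ℂ A) :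
    Prop where
  gradedMonoid : SetLike.GradedMonoid 𝒜
  isInternal : DirectSum.IsInternal 𝒜

/-! ### Lie superalgebras and their enveloping algebras -/

/-- A complex Lie superalgebra. -/
class LieSuperalgebra (L : Type*) [AddCommGroup L] [Module ℂ L] where
  /-- The even part `parity 0` and the odd part `parity 1`. -/
  parity : ZMod 2 → Submodule ℂ L
  isInternal : DirectSum.IsInternal parity
  /-- The supercommutator. -/
  bracket : L →ₗ[ℂ] L →ₗ[ℂ] L
  bracket_mem : ∀ {a b : ZMod 2} {x y : L}, x ∈ parity a → y ∈ parity b →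
    bracket x y ∈ parity (a + b)
  bracket_skew : ∀ {a b : ZMod 2} {x y : L}, x ∈ parity a → y ∈ parity b →
    bracket x y = -(superSign (a * b) • bracket y x)
  bracket_jacobi : ∀ {a b c : ZMod 2} {x y z : L}, x ∈ parity a → y ∈ parity b → z ∈ parity c →
    bracket x (bracket y z) =
      bracket (bracket x y) z + superSign (a * b) • bracket y (bracket x z)

namespace SuperEnveloping

variable (L : Type*) [AddCommGroup L] [Module ℂ L] [LieSuperalgebra L]

/-- The relations `x y = (-1)^{ab} y x + [x, y]` for `x` of degree `a` and `y` of degree `b`. -/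
inductive Rel : TensorAlgebra ℂ L → TensorAlgebra ℂ L → Prop
  | comm {a b : ZMod 2} {x y : L} (hx : x ∈ LieSuperalgebra.parity a)
      (hy : y ∈ LieSuperalgebra.parity b) :
      Rel (TensorAlgebra.ι ℂ x * TensorAlgebra.ι ℂ y)
        (superSign (a * b) • (TensorAlgebra.ι ℂ y * TensorAlgebra.ι ℂ x)
          + TensorAlgebra.ι ℂ (LieSuperalgebra.bracket x y))

end SuperEnveloping

/-- The universal enveloping algebra of a complex Lie superalgebra. -/
def SuperEnveloping (L : Type*) [AddCommGroup L] [Module ℂ L] [LieSuperalgebra L] : Type _ :=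
  RingQuot (SuperEnveloping.Rel L)

namespace SuperEnveloping

variable (L : Type*) [AddCommGroup L] [Module ℂ L] [LieSuperalgebra L]

instance : Ring (SuperEnveloping L) := inferInstanceAs (Ring (RingQuot (SuperEnveloping.Rel L)))

instance : Algebra ℂ (SuperEnveloping L) :=
  inferInstanceAs (Algebra ℂ (RingQuot (SuperEnveloping.Rel L)))

/-- The canonical map from a Lie superalgebra to its enveloping algebra. -/
def ι : L →ₗ[ℂ] SuperEnveloping L :=
  (RingQuot.mkAlgHom ℂ (SuperEnveloping.Rel L)).toLinearMap ∘ₗ TensorAlgebra.ι ℂ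

/-- The natural `ℤ/2`-gradation of the enveloping algebra: the component of degree `a` is spanned
by the products of homogeneous elements of `L` with the sum of the degrees equal to `a`. -/
def parity (a : ZMod 2) : Submodule ℂ (SuperEnveloping L) :=
  wordSpan (S := Σ b : ZMod 2, (LieSuperalgebra.parity b : Submodule ℂ L))
    (fun x => ι L x.2) (fun x => x.1) (fun b => b = a)

end SuperEnveloping

/-! ### The graded algebra of an algebra with an ascending `ℤ`-filtration -/

section AssociatedGraded

variable {A : Type*} [Ring A] [Algebra ℂ A] (F : ℤ → Submodule ℂ A)

/-- The quotient `F d / F (d - 1)`. -/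
def GrPiece (d : ℤ) : Type _ := F d ⧸ (F (d - 1)).submoduleOf (F d)

namespace GrPiece

instance (d : ℤ) : AddCommGroup (GrPiece F d) :=
  inferInstanceAs (AddCommGroup (F d ⧸ (F (d - 1)).submoduleOf (F d)))

instance (d : ℤ) : Module ℂ (GrPiece F d) :=
  inferInstanceAs (Module ℂ (F d ⧸ (F (d - 1)).submoduleOf (F d)))

/-- The class in `F d / F (d - 1)` of an element of `F d`. -/
def mk (d : ℤ) : F d →ₗ[ℂ] GrPiece F d := ((F (d - 1)).submoduleOf (F d)).mkQ

variable {F}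

theorem mk_surjective (d : ℤ) : Function.Surjective (mk F d) := Submodule.mkQ_surjective _

theorem mk_eq_zero {d : ℤ} {x : F d} : mk F d x = 0 ↔ (x : A) ∈ F (d - 1) := by
  exact (Submodule.Quotient.mk_eq_zero ((F (d - 1)).submoduleOf (F d))).trans Iff.rfl

theorem sigma_ext {d e : ℤ} (h : d = e) {x : F d} {y : F e} (hxy : (x : A) = y) :
    (⟨d, mk F d x⟩ : GradedMonoid (GrPiece F)) = ⟨e, mk F e y⟩ := by
  subst h
  rw [Subtype.ext hxy]

variable [IsRingFiltration F (fun d : ℤ => F (d - 1))]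

variable (F)

/-- The product of an element of `F d` and an element of `F e`, as an element of `F (d + e)`. -/
def preMul (d e : ℤ) : F d →ₗ[ℂ] F e →ₗ[ℂ] F (d + e) :=
  LinearMap.mk₂ ℂ (fun x y => ⟨x * y, SetLike.mul_mem_graded x.2 y.2⟩)
    (fun _ _ _ => Subtype.ext (add_mul _ _ _)) (fun _ _ _ => Subtype.ext (smul_mul_assoc _ _ _))
    (fun _ _ _ => Subtype.ext (mul_add _ _ _)) (fun _ _ _ => Subtype.ext (mul_smul_comm _ _ _))

/-- The multiplication `F d / F (d - 1) × F e / F (e - 1) → F (d + e) / F (d + e - 1)` induced by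
the multiplication of `A`. -/
def mul (d e : ℤ) : GrPiece F d →ₗ[ℂ] GrPiece F e →ₗ[ℂ] GrPiece F (d + e) :=
  Submodule.liftQ _
    (LinearMap.flip (Submodule.liftQ _
      (LinearMap.flip ((preMul F d e).compr₂ (mk F (d + e))))
      (by
        intro y hy
        rw [LinearMap.mem_ker]
        ext x
        have h : (x : A) * y ∈ F (d + (e - 1)) := SetLike.mul_mem_graded x.2 hy
        rw [← add_sub_assoc] at h
        exact mk_eq_zero.2 h)))
    (by
      intro x hx
      rw [LinearMap.mem_ker]
      refine LinearMap.ext fun y => ?_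
      obtain ⟨y, rfl⟩ := mk_surjective e y
      have h : (x : A) * y ∈ F ((d - 1) + e) := SetLike.mul_mem_graded hx y.2
      rw [sub_add_eq_add_sub] at h
      exact mk_eq_zero.2 h)

theorem mul_mk (d e : ℤ) (x : F d) (y : F e) : mul F d e (mk F d x) (mk F e y)
    = mk F (d + e) ⟨(x : A) * (y : A), SetLike.mul_mem_graded x.2 y.2⟩ := rfl

instance gOne : GradedMonoid.GOne (GrPiece F) where
  one := mk F 0 ⟨1, SetLike.one_mem_graded F⟩

instance gMul : GradedMonoid.GMul (GrPiece F) where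
  mul {d e} x y := mul F d e x y

instance gMonoid : GradedMonoid.GMonoid (GrPiece F) where
  one_mul := by
    rintro ⟨d, x⟩
    obtain ⟨x, rfl⟩ := mk_surjective d x
    exact sigma_ext (zero_add d) (one_mul (x : A))
  mul_one := by
    rintro ⟨d, x⟩
    obtain ⟨x, rfl⟩ := mk_surjective d x
    exact sigma_ext (add_zero d) (mul_one (x : A))
  mul_assoc := by
    rintro ⟨d, x⟩ ⟨e, y⟩ ⟨f, z⟩
    obtain ⟨x, rfl⟩ := mk_surjective d x
    obtain ⟨y, rfl⟩ := mk_surjective e y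
    obtain ⟨z, rfl⟩ := mk_surjective f z
    exact sigma_ext (add_assoc d e f) (mul_assoc (x : A) y z)

instance gRing : DirectSum.GRing (GrPiece F) where
  __ := gMonoid F
  mul_zero {d e} x := map_zero (mul F d e x)
  zero_mul {d e} y := LinearMap.map_zero₂ (mul F d e) y
  mul_add {d e} x y z := map_add (mul F d e x) y z
  add_mul {d e} x y z := LinearMap.map_add₂ (mul F d e) x y z
  natCast n := n • mk F 0 ⟨1, SetLike.one_mem_graded F⟩
  natCast_zero := zero_smul _ _
  natCast_succ _ := succ_nsmul _ _
  intCast n := n • mk F 0 ⟨1, SetLike.one_mem_graded F⟩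
  intCast_ofNat _ := natCast_zsmul _ _
  intCast_negSucc_ofNat _ := negSucc_zsmul _ _

instance gAlgebra : DirectSum.GAlgebra ℂ (GrPiece F) where
  toFun :=
    { toFun := fun c => c • mk F 0 ⟨1, SetLike.one_mem_graded F⟩
      map_zero' := zero_smul _ _
      map_add' := fun a b => add_smul a b _ }
  map_one := one_smul _ _
  map_mul a b := by
    refine sigma_ext (x := (a * b) • ⟨1, SetLike.one_mem_graded F⟩) (zero_add (0 : ℤ)).symm ?_
    change (a * b) • (1 : A) = (a • (1 : A)) * (b • (1 : A))
    rw [smul_mul_smul_comm, one_mul]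
  commutes := by
    rintro c ⟨d, x⟩
    obtain ⟨x, rfl⟩ := mk_surjective d x
    refine sigma_ext ((zero_add d).trans (add_zero d).symm) ?_
    change (c • (1 : A)) * (x : A) = (x : A) * (c • (1 : A))
    rw [smul_one_mul, mul_smul_one]
  smul_def := by
    rintro c ⟨d, x⟩
    obtain ⟨x, rfl⟩ := mk_surjective d x
    refine sigma_ext (x := c • x) (zero_add d).symm ?_
    change c • (x : A) = (c • (1 : A)) * (x : A)
    rw [smul_one_mul]

end GrPiece

/-- The graded algebra `⨁ F d / F (d - 1)`. When `F` is multiplicative, the instances above make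
it into an associative unital complex algebra. -/
abbrev AssocGraded : Type _ := ⨁ d : ℤ, GrPiece F d

/-- The class in the graded algebra of an element of `F d`. -/
def AssocGraded.symbol (d : ℤ) : F d →ₗ[ℂ] AssocGraded F :=
  DirectSum.lof ℂ ℤ (GrPiece F) d ∘ₗ GrPiece.mk F d

/-- The gradation which the graded algebra inherits from a gradation `𝒜` of the filtered algebra:
the component of degree `a` is spanned by the classes of the elements of `F d ∩ 𝒜 a`, `d ∈ ℤ`. -/
def AssocGraded.parity (𝒜 : ZMod 2 → Submodule ℂ A) (a : ZMod 2) :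
    Submodule ℂ (AssocGraded F) :=
  ⨆ d : ℤ, ((𝒜 a).submoduleOf (F d)).map (AssocGraded.symbol F d)

end AssociatedGraded

/-! ### The index set `±1, …, ±N` -/

/-- The set of the indices `±1, …, ±N`; `bar` is `0` on the positive and `1` on the negative
indices. -/
@[ext]
structure QIndex (N : ℕ) where
  abs : Fin N
  bar : ZMod 2
deriving DecidableEq, Fintype

instance (N : ℕ) : Neg (QIndex N) := ⟨fun i => ⟨i.abs, i.bar + 1⟩⟩

instance (N : ℕ) : InvolutiveNeg (QIndex N) where
  neg_neg i := by
    refine QIndex.ext rfl ?_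
    change i.bar + 1 + 1 = i.bar
    rw [add_assoc, show (1 + 1 : ZMod 2) = 0 from rfl, add_zero]

theorem QIndex.neg_bar {N : ℕ} (i : QIndex N) : (-i).bar = i.bar + 1 := rfl

theorem QIndex.neg_bar_add_neg_bar {N : ℕ} (i j : QIndex N) :
    (-i).bar + (-j).bar = i.bar + j.bar := by
  rw [QIndex.neg_bar, QIndex.neg_bar, add_add_add_comm, show (1 + 1 : ZMod 2) = 0 from rfl,
    add_zero]

/-! ### The twisted polynomial current Lie superalgebra -/

/-- The polynomial functions of `u` with values in the matrices of the size `N|N`, that is, the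
underlying space of `gl_{N|N}[u]`. -/
abbrev CurrentMatrix (N : ℕ) : Type := Matrix (QIndex N) (QIndex N) ℂ[X]

namespace CurrentMatrix

variable {N : ℕ}

/-- The homogeneous component of degree `a`; the degree of `E_{ij} u^s` is `ī + j̄`. -/
noncomputable def component (a : ZMod 2) : CurrentMatrix N →ₗ[ℂ] CurrentMatrix N where
  toFun M := Matrix.of fun i j => if i.bar + j.bar = a then M i j else 0
  map_add' M M' := by
    ext1 i j
    by_cases h : i.bar + j.bar = a <;> simp [h]
  map_smul' c M := by
    ext1 i j
    by_cases h : i.bar + j.bar = a <;> simp [h]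

theorem component_apply (a : ZMod 2) (M : CurrentMatrix N) (i j : QIndex N) :
    component a M i j = if i.bar + j.bar = a then M i j else 0 := rfl

/-- `M` is homogeneous of degree `a`. -/
def IsHomog (a : ZMod 2) (M : CurrentMatrix N) : Prop :=
  ∀ i j : QIndex N, i.bar + j.bar ≠ a → M i j = 0

theorem component_isHomog (a : ZMod 2) (M : CurrentMatrix N) : IsHomog a (component a M) :=
  fun _ _ h => if_neg h

theorem IsHomog.component_eq {a : ZMod 2} {M : CurrentMatrix N} (h : IsHomog a M) (b : ZMod 2) :
    component b M = if b = a then M else 0 := by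
  ext1 i j
  rw [component_apply]
  by_cases hij : i.bar + j.bar = a
  · by_cases hb : b = a
    · simp [hij, hb]
    · have hb' : ¬ a = b := fun e => hb e.symm
      simp [hij, hb, hb']
  · rw [h i j hij]
    by_cases hb : b = a
    · simp [hb, h i j hij]
    · simp [hb]

theorem IsHomog.mul {a b : ZMod 2} {M M' : CurrentMatrix N} (h : IsHomog a M)
    (h' : IsHomog b M') : IsHomog (a + b) (M * M') := by
  intro i j hij
  rw [Matrix.mul_apply]
  refine Finset.sum_eq_zero fun k _ => ?_
  by_cases hik : i.bar + k.bar = a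
  · by_cases hkj : k.bar + j.bar = b
    · refine absurd ?_ hij
      have hk : k.bar + k.bar = 0 := CharTwo.add_self_eq_zero _
      rw [← hik, ← hkj, add_add_add_comm, add_comm k.bar j.bar, add_add_add_comm i.bar k.bar,
        ← add_assoc, add_assoc, hk, add_zero]
    · rw [h' k j hkj, mul_zero]
  · rw [h i k hik, zero_mul]

theorem IsHomog.sub {a : ZMod 2} {M M' : CurrentMatrix N} (h : IsHomog a M)
    (h' : IsHomog a M') : IsHomog a (M - M') := by
  intro i j hij
  rw [Matrix.sub_apply, h i j hij, h' i j hij, sub_zero]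

theorem IsHomog.smul {a : ZMod 2} {M : CurrentMatrix N} (h : IsHomog a M) (c : ℂ) :
    IsHomog a (c • M) := by
  intro i j hij
  rw [Matrix.smul_apply, h i j hij, smul_zero]

/-- The supercommutator: it is bilinear, and `[X, Y] = X Y - (-1)^{ab} Y X` if `X` and `Y` are
homogeneous of degrees `a` and `b`. -/
noncomputable def superBracket : CurrentMatrix N →ₗ[ℂ] CurrentMatrix N →ₗ[ℂ] CurrentMatrix N :=
  ∑ a : ZMod 2, ∑ b : ZMod 2,
    ((LinearMap.mul ℂ (CurrentMatrix N)).compl₁₂ (component a) (component b)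
      - superSign (a * b) •
        (LinearMap.mul ℂ (CurrentMatrix N)).flip.compl₁₂ (component a) (component b))

theorem superBracket_apply (X Y : CurrentMatrix N) :
    superBracket X Y = ∑ a : ZMod 2, ∑ b : ZMod 2,
      (component a X * component b Y
        - superSign (a * b) • (component b Y * component a X)) := by
  simp [superBracket, LinearMap.sum_apply]

theorem IsHomog.superBracket_eq {a b : ZMod 2} {X Y : CurrentMatrix N} (hX : IsHomog a X)
    (hY : IsHomog b Y) : superBracket X Y = X * Y - superSign (a * b) • (Y * X) := by
  rw [superBracket_apply, Finset.sum_eq_single a, Finset.sum_eq_single b]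
  · rw [hX.component_eq, hY.component_eq, if_pos rfl, if_pos rfl]
  · intro b' _ hb'
    rw [hY.component_eq, if_neg hb']
    simp
  · simp
  · intro a' _ ha'
    refine Finset.sum_eq_zero fun b' _ => ?_
    rw [hX.component_eq, if_neg ha']
    simp
  · simp

/-- The automorphism `η`, applied pointwise: `E_{ij} ↦ E_{-i,-j}`. -/
noncomputable def eta : CurrentMatrix N →ₐ[ℂ] CurrentMatrix N :=
  (Matrix.reindexAlgEquiv ℂ ℂ[X] (Equiv.neg (QIndex N))).toAlgHom

theorem eta_apply (M : CurrentMatrix N) (i j : QIndex N) : eta M i j = M (-i) (-j) := rfl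

/-- The substitution `X(u) ↦ X(-u)`. -/
noncomputable def substNeg : CurrentMatrix N →ₐ[ℂ] CurrentMatrix N :=
  (Polynomial.aeval (-Polynomial.X : ℂ[X])).mapMatrix

theorem substNeg_apply (M : CurrentMatrix N) (i j : QIndex N) :
    substNeg M i j = (M i j).comp (-Polynomial.X) := rfl

theorem eta_single (i j : QIndex N) (p : ℂ[X]) :
    eta (Matrix.single i j p) = Matrix.single (-i) (-j) p := by
  ext1 k l
  rw [eta_apply, Matrix.single_apply, Matrix.single_apply]
  simp only [neg_eq_iff_eq_neg]

theorem substNeg_single (i j : QIndex N) (p : ℂ[X]) :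
    substNeg (Matrix.single i j p) = Matrix.single i j (p.comp (-Polynomial.X)) := by
  ext1 k l
  rw [substNeg_apply, Matrix.single_apply, Matrix.single_apply]
  split_ifs <;> simp

theorem eta_component (a : ZMod 2) (M : CurrentMatrix N) :
    eta (component a M) = component a (eta M) := by
  ext1 i j
  rw [eta_apply, component_apply, component_apply, QIndex.neg_bar_add_neg_bar, eta_apply]

theorem substNeg_component (a : ZMod 2) (M : CurrentMatrix N) :
    substNeg (component a M) = component a (substNeg M) := by
  ext1 i j
  rw [substNeg_apply, component_apply, component_apply, substNeg_apply]
  split_ifs <;> simp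

theorem component_add_component (M : CurrentMatrix N) : component 0 M + component 1 M = M := by
  ext1 i j
  rw [Matrix.add_apply, component_apply, component_apply]
  have h : ∀ c : ZMod 2, c = 0 ∨ c = 1 := by decide
  rcases h (i.bar + j.bar) with h | h <;> simp [h]

end CurrentMatrix

open CurrentMatrix in
/-- The twisted polynomial current Lie superalgebra
`𝔤 = {X(u) ∈ gl_{N|N}[u] : η(X(u)) = X(-u)}`. -/
def twistedCurrent (N : ℕ) : Submodule ℂ (CurrentMatrix N) where
  carrier := {M | eta M = substNeg M}
  add_mem' {x y} hx hy := by
    change eta (x + y) = substNeg (x + y)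
    rw [map_add, map_add, hx, hy]
  zero_mem' := by
    change eta 0 = substNeg 0
    rw [map_zero, map_zero]
  smul_mem' c x hx := by
    change eta (c • x) = substNeg (c • x)
    rw [map_smul, map_smul, hx]

namespace twistedCurrent

open CurrentMatrix

variable {N : ℕ}

theorem mul_mem {x y : CurrentMatrix N} (hx : x ∈ twistedCurrent N) (hy : y ∈ twistedCurrent N) :
    x * y ∈ twistedCurrent N := by
  change eta (x * y) = substNeg (x * y)
  rw [map_mul, map_mul, hx, hy]

theorem component_mem (a : ZMod 2) {x : CurrentMatrix N} (hx : x ∈ twistedCurrent N) :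
    component a x ∈ twistedCurrent N := by
  change eta _ = substNeg _
  rw [eta_component, substNeg_component, hx]

theorem superBracket_mem {x y : CurrentMatrix N} (hx : x ∈ twistedCurrent N)
    (hy : y ∈ twistedCurrent N) : superBracket x y ∈ twistedCurrent N := by
  rw [superBracket_apply]
  refine Submodule.sum_mem _ fun a _ => Submodule.sum_mem _ fun b _ => Submodule.sub_mem _ ?_ ?_
  · exact mul_mem (component_mem a hx) (component_mem b hy)
  · exact Submodule.smul_mem _ _ (mul_mem (component_mem b hy) (component_mem a hx))

/-- The homogeneous elements of degree `a` in `𝔤`. -/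
def parity (a : ZMod 2) : Submodule ℂ (twistedCurrent N) where
  carrier := {x | IsHomog a (x : CurrentMatrix N)}
  add_mem' {x y} hx hy i j hij := by
    change (x : CurrentMatrix N) i j + (y : CurrentMatrix N) i j = 0
    rw [hx i j hij, hy i j hij, add_zero]
  zero_mem' _ _ _ := rfl
  smul_mem' c _ hx := IsHomog.smul hx c

theorem parity_isInternal : DirectSum.IsInternal (parity (N := N)) := by
  refine (DirectSum.isInternal_submodule_iff_isCompl _ (i := 0) (j := 1) (by decide)
    (by ext c; revert c; decide)).2 ⟨?_, ?_⟩
  · rw [Submodule.disjoint_def]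
    intro x h0 h1
    refine Subtype.ext ?_
    rw [← component_add_component (x : CurrentMatrix N), IsHomog.component_eq h1 0,
      IsHomog.component_eq h0 1]
    simp
  · rw [codisjoint_iff, eq_top_iff]
    intro x _
    refine Submodule.mem_sup.2
      ⟨⟨component 0 x, component_mem 0 x.2⟩, component_isHomog 0 _,
        ⟨component 1 x, component_mem 1 x.2⟩, component_isHomog 1 _, ?_⟩
    exact Subtype.ext (component_add_component _)

/-- The supercommutator on `𝔤`, restricted from `gl_{N|N}[u]`. -/
noncomputable def bracket : twistedCurrent N →ₗ[ℂ] twistedCurrent N →ₗ[ℂ] twistedCurrent N :=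
  LinearMap.mk₂ ℂ
    (fun x y => ⟨superBracket (x : CurrentMatrix N) (y : CurrentMatrix N),
      superBracket_mem x.2 y.2⟩)
    (fun x x' y => by
      ext1
      simp only [Submodule.coe_add, map_add, LinearMap.add_apply])
    (fun c x y => by
      ext1
      simp only [Submodule.coe_smul, map_smul, LinearMap.smul_apply])
    (fun x y y' => by
      ext1
      simp only [Submodule.coe_add, map_add])
    (fun c x y => by
      ext1
      simp only [Submodule.coe_smul, map_smul])

theorem bracket_coe (x y : twistedCurrent N) :
    (bracket x y : CurrentMatrix N) = superBracket (x : CurrentMatrix N) y := rfl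

theorem isHomog_superBracket {a b : ZMod 2} {X Y : CurrentMatrix N} (hX : IsHomog a X)
    (hY : IsHomog b Y) : IsHomog (a + b) (superBracket X Y) := by
  rw [hX.superBracket_eq hY]
  refine (hX.mul hY).sub (IsHomog.smul ?_ _)
  rw [add_comm]
  exact hY.mul hX

noncomputable instance : LieSuperalgebra (twistedCurrent N) where
  parity := parity
  isInternal := parity_isInternal
  bracket := bracket
  bracket_mem hx hy := isHomog_superBracket hx hy
  bracket_skew {a b x y} hx hy := by
    refine Subtype.ext ?_
    have hx' : IsHomog a (x : CurrentMatrix N) := hx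
    have hy' : IsHomog b (y : CurrentMatrix N) := hy
    simp only [Submodule.coe_neg, Submodule.coe_smul, bracket_coe]
    rw [hx'.superBracket_eq hy', hy'.superBracket_eq hx', smul_sub, smul_smul, mul_comm b a,
      superSign_mul_self, one_smul, neg_sub]
  bracket_jacobi {a b c x y z} hx hy hz := by
    refine Subtype.ext ?_
    have hx' : IsHomog a (x : CurrentMatrix N) := hx
    have hy' : IsHomog b (y : CurrentMatrix N) := hy
    have hz' : IsHomog c (z : CurrentMatrix N) := hz
    simp only [Submodule.coe_add, Submodule.coe_smul, bracket_coe]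
    rw [hx'.superBracket_eq (isHomog_superBracket hy' hz'),
      (isHomog_superBracket hx' hy').superBracket_eq hz',
      hy'.superBracket_eq (isHomog_superBracket hx' hz'),
      hx'.superBracket_eq hy', hy'.superBracket_eq hz', hx'.superBracket_eq hz']
    have h : ∀ d : ZMod 2, d = 0 ∨ d = 1 := by decide
    have s0 : superSign 0 = 1 := by simp [superSign]
    have s1 : superSign 1 = -1 := pow_one _
    have e : (1 + 1 : ZMod 2) = 0 := rfl
    rcases h a with rfl | rfl <;> rcases h b with rfl | rfl <;> rcases h c with rfl | rfl <;>
      simp only [s0, s1, e, mul_zero, mul_one, add_zero, zero_add, one_smul,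
        neg_smul] <;> noncomm_ring

/-- The element `F_{ij}^{(s)} = E_{ij} u^s + E_{-i,-j} (-u)^s` of `𝔤`. -/
noncomputable def elemF (i j : QIndex N) (s : ℕ) : twistedCurrent N :=
  ⟨Matrix.single i j (Polynomial.X ^ s) + Matrix.single (-i) (-j) ((-Polynomial.X) ^ s), by
    change eta _ = substNeg _
    rw [map_add, map_add, eta_single, eta_single, substNeg_single, substNeg_single, neg_neg,
      neg_neg, add_comm]
    simp⟩

end twistedCurrent

/-! ### The Yangian of the queer Lie superalgebra -/

namespace QueerYangian

variable (N : ℕ)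

/-- The labels of the generators; `⟨i, j, s⟩` is the label of `T_{ij}^{(s+1)}`, where `s ≥ 0`. -/
structure Gen where
  i : QIndex N
  j : QIndex N
  s : ℕ

variable {N}

/-- The coefficient of `u^{-m}` in the series
`T_{ij}(u) = δ_{ij} + T_{ij}^{(1)} u^{-1} + T_{ij}^{(2)} u^{-2} + ⋯`
over the free algebra; it is `0` for `m < 0`. -/
def freeT (i j : QIndex N) : ℤ → FreeAlgebra ℂ (Gen N)
  | .ofNat 0 => if i = j then 1 else 0
  | .ofNat (s + 1) => FreeAlgebra.ι ℂ ⟨i, j, s⟩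
  | .negSucc _ => 0

/-- The coefficient of `u^{-p} v^{-q}` in the supercommutator `[T_{ij}(u), T_{kl}(v)]`. -/
def freeComm (i j k l : QIndex N) (p q : ℤ) : FreeAlgebra ℂ (Gen N) :=
  freeT i j p * freeT k l q
    - superSign ((i.bar + j.bar) * (k.bar + l.bar)) • (freeT k l q * freeT i j p)

/-- The coefficient of `u^{-p} v^{-q}` in `T_{kj}(u) T_{il}(v) - T_{kj}(v) T_{il}(u)`. -/
def freeDiff (i j k l : QIndex N) (p q : ℤ) : FreeAlgebra ℂ (Gen N) :=
  freeT k j p * freeT i l q - freeT k j q * freeT i l p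

/-- The coefficient of `u^{-p} v^{-q}` in
`T_{-k,j}(u) T_{-i,l}(v) - T_{k,-j}(v) T_{i,-l}(u)`. -/
def freeTwistedDiff (i j k l : QIndex N) (p q : ℤ) : FreeAlgebra ℂ (Gen N) :=
  freeT (-k) j p * freeT (-i) l q - freeT k (-j) q * freeT i (-l) p

/-- The defining relations of the Yangian.

`quadratic` is the equality of the coefficients of `u^{-p} v^{-q}`, for all integers `p` and `q`,
on the two sides of the relation
`(u² - v²) [T_{ij}(u), T_{kl}(v)] (-1)^{īk̄ + īl̄ + k̄l̄}
  = (u + v) (T_{kj}(u) T_{il}(v) - T_{kj}(v) T_{il}(u))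
    - (u - v) (T_{-k,j}(u) T_{-i,l}(v) - T_{k,-j}(v) T_{i,-l}(u)) (-1)^{k̄ + l̄}`,
where multiplication by `u` replaces the coefficient at `(p, q)` by the one at `(p + 1, q)`, and
multiplication by `v` replaces it by the one at `(p, q + 1)`.

`symmetry` is the equality of the coefficients of `u^{-m}` in `T_{-i,-j}(u) = T_{ij}(-u)`. -/
inductive Rel : FreeAlgebra ℂ (Gen N) → FreeAlgebra ℂ (Gen N) → Prop
  | quadratic (i j k l : QIndex N) (p q : ℤ) :
      Rel
        (superSign (i.bar * k.bar + i.bar * l.bar + k.bar * l.bar) •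
          (freeComm i j k l (p + 2) q - freeComm i j k l p (q + 2)))
        ((freeDiff i j k l (p + 1) q + freeDiff i j k l p (q + 1))
          - superSign (k.bar + l.bar) •
            (freeTwistedDiff i j k l (p + 1) q - freeTwistedDiff i j k l p (q + 1)))
  | symmetry (i j : QIndex N) (m : ℕ) :
      Rel (freeT (-i) (-j) m) ((-1 : ℂ) ^ m • freeT i j m)

end QueerYangian

/-- The Yangian `Y(q_N)` of the queer Lie superalgebra `q_N`. -/
def QueerYangian (N : ℕ) : Type := RingQuot (QueerYangian.Rel (N := N))

namespace QueerYangian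

variable (N : ℕ)

instance : Ring (QueerYangian N) := inferInstanceAs (Ring (RingQuot (Rel (N := N))))

instance : Algebra ℂ (QueerYangian N) := inferInstanceAs (Algebra ℂ (RingQuot (Rel (N := N))))

variable {N}

/-- The generator of the Yangian with a given label. -/
def gen (x : Gen N) : QueerYangian N := RingQuot.mkAlgHom ℂ (Rel (N := N)) (FreeAlgebra.ι ℂ x)

variable (N)

/-- The `ℤ/2`-gradation of the Yangian, where `T_{ij}^{(s)}` has degree `ī + j̄`. -/
def parity (a : ZMod 2) : Submodule ℂ (QueerYangian N) :=
  wordSpan gen (fun x : Gen N => x.i.bar + x.j.bar) (fun b => b = a)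

/-- The ascending `ℤ`-filtration of the Yangian, where `T_{ij}^{(s)}` has degree `s - 1`: the
subspace of degree `d` is spanned by the monomials of degree at most `d` in the generators. -/
def filtration (d : ℤ) : Submodule ℂ (QueerYangian N) :=
  wordSpan gen (fun x : Gen N => (x.s : ℤ)) (fun e => e ≤ d)

theorem filtration_mono : Monotone (filtration N) := by
  intro d e hde
  refine Submodule.span_mono ?_
  rintro _ ⟨w, hw, rfl⟩
  exact ⟨w, hw.trans hde, rfl⟩

instance : SetLike.GradedMonoid (filtration N) where
  one_mem := Submodule.subset_span ⟨[], by simp, by simp⟩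
  mul_mem d e x y hx hy := by
    have h := Submodule.mul_mem_mul hx hy
    unfold filtration wordSpan at h
    rw [Submodule.span_mul_span] at h
    refine Submodule.span_mono ?_ h
    rintro _ ⟨_, ⟨w, hw, rfl⟩, _, ⟨w', hw', rfl⟩, rfl⟩
    exact ⟨w ++ w', by simpa using add_le_add hw hw', by simp⟩

instance : IsRingFiltration (filtration N) (fun d : ℤ => filtration N (d - 1)) :=
  IsRingFiltration.mk_int _ (filtration_mono N)

variable {N}

theorem gen_mem_filtration (x : Gen N) : gen x ∈ filtration N x.s :=
  Submodule.subset_span ⟨[x], by simp, by simp⟩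

/-- The graded algebra of the Yangian for this filtration. -/
abbrev Gr (N : ℕ) : Type := AssocGraded (filtration N)

/-- The `ℤ/2`-gradation which the graded algebra inherits from the Yangian. -/
def grParity (N : ℕ) : ZMod 2 → Submodule ℂ (Gr N) :=
  AssocGraded.parity (filtration N) (parity N)

/-- The element `G_{ij}^{(s+1)}`, where `s ≥ 0`: the class of the generator `T_{ij}^{(s+1)}` in
the component of degree `s` of the graded algebra. -/
def elemG (i j : QIndex N) (s : ℕ) : Gr N :=
  AssocGraded.symbol (filtration N) s ⟨gen ⟨i, j, s⟩, gen_mem_filtration ⟨i, j, s⟩⟩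

end QueerYangian

open scoped TensorProduct

/-! The homomorphism comes from the quadratic relation read coefficient by coefficient. It compares
the supercommutator of $T^{(r+1)}$ and $T^{(s+1)}$ with that of $T^{(r-1)}$ and $T^{(s+3)}$, modulo
products of lower filtration degree. Descending by steps of two ends at $T^{(0)}=\delta$ or at a
negative index, where the supercommutator vanishes, and the terms containing a $\delta$ survive as a
leading part that is linear in the generators (`serComm_sub_commLead_mem`). Up to signs this is the
bracket of the elements $F_{ji}^{(r)}$ in $\mathfrak g$, so `toGr` exists. It is surjective because
the $G_{ij}^{(s)}$ generate the graded algebra.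

Injectivity is proved without a Poincaré–Birkhoff–Witt theorem, by means of enough representations
of the Yangian. The relations hold for the evaluation series
$\delta_{ij}-(-1)^{\bar\jmath}\bigl(e_{ji}/(u-\zeta)+e_{-j,-i}/(u+\zeta)\bigr)$ with $\zeta$ central
(`isYangianSeries_siteSeries`), and they are inherited by products of matrices with supercommuting
entries (`IsYangianSeries.superMatMul`). Take $\zeta=zX$, where $z$ is the current variable and $X$
marks the degree. Then $T^{(s+1)}$ acts by a polynomial in $X$ of degree at most $s$, and highest
coefficients give a homomorphism from the graded algebra (`lead`). In highest degree the
comultiplication is $T\mapsto T\otimes1+1\otimes T$. Hence on $n$ sites the composite with `toGr` is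
the iterated coproduct of $\mathrm U(\mathfrak g)$ followed by the inclusion $\mathfrak
g\subset\mathfrak{gl}_{N|N}[z]$ at each site (`PolynomialModel.extend_top`).

This composite is injective on words of length at most $n$, by induction on $n$. If $u$ has length
at most $m$, the part of its coproduct that is linear in the last factor multiplies back to $mu$
modulo shorter words (`exists_leading`). So if the image of $u$ vanishes, $u$ is shorter than $m$,
and the preceding case applies (`injective_succ`). The number of sites is unbounded, so `toGr` is
injective.

The gradations are eigenspace decompositions for the automorphisms that negate odd elements. The
gradation of the graded algebra is transported along the isomorphism. -/

/-! ### Signs, and gradations spanned by words. -/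

theorem superSign_zero : superSign 0 = 1 := by simp [superSign]

theorem superSign_one : superSign 1 = -1 := pow_one _

theorem ZMod.two_cases (a : ZMod 2) : a = 0 ∨ a = 1 := by
  revert a; decide

theorem superSign_add (a b : ZMod 2) : superSign (a + b) = superSign a * superSign b := by
  have e : (1 + 1 : ZMod 2) = 0 := rfl
  rcases ZMod.two_cases a with rfl | rfl <;> rcases ZMod.two_cases b with rfl | rfl <;>
    simp [superSign_zero, superSign_one, e]

section WordSpan

variable {S B : Type*} [Ring B] [Algebra ℂ B] {g : S → B}

theorem word_mem_wordSpan {M : Type*} [AddMonoid M] (g : S → B) (deg : S → M) {P : M → Prop}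
    {w : List S} (hw : P (w.map deg).sum) : (w.map g).prod ∈ wordSpan g deg P :=
  Submodule.subset_span ⟨w, hw, rfl⟩

theorem wordSpan_true {M : Type*} [AddMonoid M] (deg : S → M)
    (hg : Algebra.adjoin ℂ (Set.range g) = ⊤) : wordSpan g deg (fun _ => True) = ⊤ := by
  rw [eq_top_iff, ← Algebra.top_toSubmodule, ← hg, Algebra.adjoin_eq_span, Submodule.span_le]
  intro x hx
  obtain ⟨l, hl, rfl⟩ := Submonoid.exists_list_of_mem_closure hx
  have : ∃ w : List S, l = w.map g := by
    clear hx
    induction l with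
    | nil => exact ⟨[], rfl⟩
    | cons y l ih =>
      obtain ⟨w, rfl⟩ := ih fun y hy => hl y (List.mem_cons_of_mem _ hy)
      obtain ⟨s, rfl⟩ := hl y List.mem_cons_self
      exact ⟨s :: w, rfl⟩
  obtain ⟨w, rfl⟩ := this
  exact word_mem_wordSpan g deg trivial

theorem wordSpan_gradedMonoid {M : Type*} [AddMonoid M] (g : S → B) (deg : S → M) :
    SetLike.GradedMonoid fun a : M => wordSpan g deg (fun b => b = a) where
  one_mem := Submodule.subset_span ⟨[], by simp, by simp⟩
  mul_mem a b x y hx hy := by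
    have h := Submodule.mul_mem_mul hx hy
    unfold wordSpan at h
    rw [Submodule.span_mul_span] at h
    refine Submodule.span_mono ?_ h
    rintro _ ⟨_, ⟨w, rfl, rfl⟩, _, ⟨w', rfl, rfl⟩, rfl⟩
    exact ⟨w ++ w', by simp, by simp⟩

variable {deg : S → ZMod 2} {τ : B →ₐ[ℂ] B}

theorem parity_map_word (hτ : ∀ x, τ (g x) = superSign (deg x) • g x) (w : List S) :
    τ (w.map g).prod = superSign (w.map deg).sum • (w.map g).prod := by
  induction w with
  | nil => simp [superSign_zero]
  | cons x w ih =>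
    simp only [List.map_cons, List.prod_cons, List.sum_cons, map_mul, ih, hτ, superSign_add,
      smul_mul_smul_comm]

theorem parity_map_of_mem (hτ : ∀ x, τ (g x) = superSign (deg x) • g x) {a : ZMod 2} {x : B}
    (hx : x ∈ wordSpan g deg (fun b => b = a)) : τ x = superSign a • x := by
  induction hx using Submodule.span_induction with
  | mem x h => obtain ⟨w, rfl, rfl⟩ := h; exact parity_map_word hτ w
  | zero => simp
  | add x y _ _ hx hy => rw [map_add, hx, hy, smul_add]
  | smul c x _ hx => rw [map_smul, hx, smul_comm]

/-- The two components are the eigenspaces of `τ` for the eigenvalues 1 and −1. They meet in 0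
because 2 is invertible, and together they contain all words. -/
theorem isSuperGrading_wordSpan (hτ : ∀ x, τ (g x) = superSign (deg x) • g x)
    (hg : Algebra.adjoin ℂ (Set.range g) = ⊤) :
    IsSuperGrading fun a : ZMod 2 => wordSpan g deg (fun b => b = a) where
  gradedMonoid := wordSpan_gradedMonoid g deg
  isInternal := by
    refine (DirectSum.isInternal_submodule_iff_isCompl _ (i := 0) (j := 1) (by decide)
      (by ext c; revert c; decide)).2 ⟨?_, ?_⟩
    · rw [Submodule.disjoint_def]
      intro x h0 h1
      have e0 := parity_map_of_mem hτ h0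
      have e1 := parity_map_of_mem hτ h1
      rw [e0, superSign_zero, superSign_one, one_smul, neg_smul, one_smul] at e1
      have h2 : (2 : ℂ) • x = 0 := by rw [two_smul]; nth_rw 1 [e1]; exact neg_add_cancel x
      exact (smul_eq_zero.1 h2).resolve_left two_ne_zero
    · rw [codisjoint_iff, eq_top_iff, ← wordSpan_true deg hg]
      refine Submodule.span_le.2 ?_
      rintro _ ⟨w, -, rfl⟩
      rcases ZMod.two_cases (w.map deg).sum with h | h
      · exact Submodule.mem_sup_left (word_mem_wordSpan g deg h)
      · exact Submodule.mem_sup_right (word_mem_wordSpan g deg h)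

end WordSpan

/-- Supplies the gradation of the graded Yangian, whose directness is not checked independently. -/
theorem IsSuperGrading.map {A B : Type*} [Ring A] [Algebra ℂ A] [Ring B] [Algebra ℂ B]
    {𝒜 : ZMod 2 → Submodule ℂ A} (h : IsSuperGrading 𝒜) (e : A ≃ₐ[ℂ] B) :
    IsSuperGrading fun a => (𝒜 a).map e.toLinearMap where
  gradedMonoid :=
    { one_mem := ⟨1, h.gradedMonoid.one_mem, map_one e⟩
      mul_mem := by
        rintro a b _ _ ⟨x, hx, rfl⟩ ⟨y, hy, rfl⟩
        exact ⟨x * y, h.gradedMonoid.mul_mem hx hy, map_mul e x y⟩ }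
  isInternal := by
    have hA := (DirectSum.isInternal_submodule_iff_isCompl _ (i := 0) (j := 1) (by decide)
      (by ext c; revert c; decide)).1 h.isInternal
    refine (DirectSum.isInternal_submodule_iff_isCompl _ (i := 0) (j := 1) (by decide)
      (by ext c; revert c; decide)).2 ?_
    exact hA.map (Submodule.orderIsoMapComap e.toLinearEquiv)

/-! ### Universal property and gradation of the enveloping algebra. -/

namespace SuperEnveloping

variable {L : Type*} [AddCommGroup L] [Module ℂ L] [LieSuperalgebra L]

open LieSuperalgebra

theorem ι_mul_ι {a b : ZMod 2} {x y : L} (hx : x ∈ LieSuperalgebra.parity a)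
    (hy : y ∈ LieSuperalgebra.parity b) :
    ι L x * ι L y = superSign (a * b) • (ι L y * ι L x) + ι L (bracket x y) := by
  have h := RingQuot.mkAlgHom_rel ℂ (Rel.comm hx hy)
  rwa [map_mul, map_add, map_smul, map_mul] at h

/-- The universal property of the enveloping algebra. -/
noncomputable def lift {B : Type*} [Ring B] [Algebra ℂ B] (f : L →ₗ[ℂ] B)
    (hf : ∀ (a b : ZMod 2) (x y : L), x ∈ LieSuperalgebra.parity a → y ∈ LieSuperalgebra.parity b →
      f x * f y = superSign (a * b) • (f y * f x) + f (bracket x y)) :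
    SuperEnveloping L →ₐ[ℂ] B :=
  RingQuot.liftAlgHom ℂ ⟨TensorAlgebra.lift ℂ f, by
    rintro _ _ ⟨hx, hy⟩
    simp only [map_mul, map_add, map_smul, TensorAlgebra.lift_ι_apply]
    exact hf _ _ _ _ hx hy⟩

theorem lift_ι {B : Type*} [Ring B] [Algebra ℂ B] (f : L →ₗ[ℂ] B)
    (hf : ∀ (a b : ZMod 2) (x y : L), x ∈ LieSuperalgebra.parity a → y ∈ LieSuperalgebra.parity b →
      f x * f y = superSign (a * b) • (f y * f x) + f (bracket x y)) (x : L) :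
    lift f hf (ι L x) = f x := by
  change RingQuot.liftAlgHom ℂ _ (RingQuot.mkAlgHom ℂ _ (TensorAlgebra.ι ℂ x)) = _
  rw [RingQuot.liftAlgHom_mkAlgHom_apply, TensorAlgebra.lift_ι_apply]

theorem adjoin_range_ι : Algebra.adjoin ℂ (Set.range (ι L)) = ⊤ := by
  have h : Set.range (ι L) = RingQuot.mkAlgHom ℂ (Rel L) '' Set.range (TensorAlgebra.ι ℂ) := by
    rw [← Set.range_comp]; rfl
  rw [h]
  refine (AlgHom.map_adjoin (RingQuot.mkAlgHom ℂ (Rel L)) _).symm.trans ?_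
  rw [TensorAlgebra.adjoin_range_ι, Algebra.map_top]
  exact AlgHom.range_eq_top _ |>.2 (RingQuot.mkAlgHom_surjective ℂ (Rel L))

theorem exists_homogeneous_add (x : L) : ∃ y ∈ LieSuperalgebra.parity (L := L) 0,
    ∃ z ∈ LieSuperalgebra.parity (L := L) 1,
    y + z = x := by
  have h := (DirectSum.isInternal_submodule_iff_isCompl _ (i := 0) (j := 1) (by decide)
      (by ext c; revert c; decide)).1 (LieSuperalgebra.isInternal (L := L))
  have hx : x ∈ LieSuperalgebra.parity (L := L) 0 ⊔ LieSuperalgebra.parity (L := L) 1 := by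
    rw [h.sup_eq_top]; trivial
  exact Submodule.mem_sup.1 hx

theorem adjoin_homogeneous : Algebra.adjoin ℂ (Set.range
    fun x : Σ b : ZMod 2, (LieSuperalgebra.parity b : Submodule ℂ L) => ι L x.2) = ⊤ := by
  rw [eq_top_iff, ← adjoin_range_ι]
  refine Algebra.adjoin_le ?_
  rintro _ ⟨x, rfl⟩
  obtain ⟨y, hy, z, hz, rfl⟩ := exists_homogeneous_add x
  rw [map_add]
  exact add_mem (Algebra.subset_adjoin ⟨⟨0, y, hy⟩, rfl⟩)
    (Algebra.subset_adjoin ⟨⟨1, z, hz⟩, rfl⟩)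

/-- The projection to the homogeneous component of degree `a`. -/
noncomputable def projParity (a : ZMod 2) : L →ₗ[ℂ] L :=
  (LieSuperalgebra.parity a).subtype ∘ₗ
    DirectSum.component ℂ (ZMod 2) (fun b => LieSuperalgebra.parity (L := L) b) a ∘ₗ
    (LinearEquiv.ofBijective (DirectSum.coeLinearMap (LieSuperalgebra.parity (L := L)))
      LieSuperalgebra.isInternal).symm.toLinearMap

theorem projParity_of_mem {a : ZMod 2} {x : L} (hx : x ∈ LieSuperalgebra.parity a) (b : ZMod 2) :
    projParity b x = if a = b then x else 0 := by
  have h : (LinearEquiv.ofBijective (DirectSum.coeLinearMap (LieSuperalgebra.parity (L := L)))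
      LieSuperalgebra.isInternal).symm x
      = DirectSum.lof ℂ (ZMod 2) (fun b => LieSuperalgebra.parity (L := L) b) a ⟨x, hx⟩ := by
    rw [LinearEquiv.symm_apply_eq]
    exact (DirectSum.coeLinearMap_lof _ a ⟨x, hx⟩).symm
  simp only [projParity, LinearMap.comp_apply, LinearEquiv.coe_coe, h]
  by_cases hab : a = b
  · subst hab
    rw [DirectSum.component.lof_self]; simp
  · rw [DirectSum.component.of, dif_neg (by exact hab)]; simp [hab]

/-- The automorphism of a Lie superalgebra which multiplies the odd elements by `-1`. -/
noncomputable def lieParityMap : L →ₗ[ℂ] L := projParity 0 - projParity 1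

theorem lieParityMap_of_mem {a : ZMod 2} {x : L} (hx : x ∈ LieSuperalgebra.parity a) :
    lieParityMap x = superSign a • x := by
  rw [lieParityMap, LinearMap.sub_apply, projParity_of_mem hx, projParity_of_mem hx]
  rcases ZMod.two_cases a with rfl | rfl <;> simp [superSign_zero, superSign_one]

variable (L) in
/-- The automorphism of the enveloping algebra which multiplies the odd elements by `-1`. -/
noncomputable def parityMap : SuperEnveloping L →ₐ[ℂ] SuperEnveloping L :=
  lift (ι L ∘ₗ lieParityMap) fun a b x y hx hy => by
    simp only [LinearMap.comp_apply, lieParityMap_of_mem hx, lieParityMap_of_mem hy,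
      lieParityMap_of_mem (bracket_mem hx hy), map_smul, smul_mul_smul_comm, ι_mul_ι hx hy,
      superSign_add, smul_add]
    rw [smul_comm, mul_comm (superSign b)]

theorem parityMap_ι {a : ZMod 2} {x : L} (hx : x ∈ LieSuperalgebra.parity a) :
    parityMap L (ι L x) = superSign a • ι L x := by
  rw [parityMap, lift_ι, LinearMap.comp_apply, lieParityMap_of_mem hx, map_smul]

variable (L) in
theorem isSuperGrading_parity : IsSuperGrading (SuperEnveloping.parity L) :=
  isSuperGrading_wordSpan (τ := parityMap L) (fun x => parityMap_ι x.2.2) adjoin_homogeneous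

end SuperEnveloping

/-! ### The quadratic relation is stable under products of matrices. -/

/-- The quadratic relation of the Yangian for the values `xu`, `xv` of a matrix-valued function at
two points, with the coefficients `u² - v²`, `u + v`, `u - v` replaced by `a`, `b`, `d`. -/
def QuadraticRelation {N : ℕ} {W : Type*} [Ring W] [Algebra ℂ W] (a b d : W)
    (xu xv : QIndex N → QIndex N → W) : Prop :=
  ∀ i j k l : QIndex N,
    superSign (i.bar * k.bar + i.bar * l.bar + k.bar * l.bar) •
        (a * (xu i j * xv k l
          - superSign ((i.bar + j.bar) * (k.bar + l.bar)) • (xv k l * xu i j)))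
      = b * (xu k j * xv i l - xv k j * xu i l)
        - superSign (k.bar + l.bar) •
          (d * (xu (-k) j * xv (-i) l - xv k (-j) * xu i (-l)))

/-- The product of two matrices with supercommuting entries. -/
noncomputable def superMatMul {N : ℕ} {W : Type*} [Ring W] [Algebra ℂ W]
    (x y : QIndex N → QIndex N → W) (i j : QIndex N) : W :=
  ∑ m, superSign ((i.bar + m.bar) * (m.bar + j.bar)) • (x i m * y m j)

section Coproduct

variable {N : ℕ} {W : Type*} [Ring W] [Algebra ℂ W]

/-- The entries of `y` supercommute with those of `x`. -/
def SuperCommute (x y : QIndex N → QIndex N → W) : Prop :=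
  ∀ i j k l, y i j * x k l = superSign ((i.bar + j.bar) * (k.bar + l.bar)) • (x k l * y i j)

theorem superMatMul_mul {x y x' y' : QIndex N → QIndex N → W} (h : SuperCommute x' y)
    (i j k l : QIndex N) :
    superMatMul x y i j * superMatMul x' y' k l = ∑ m, ∑ n,
      superSign ((i.bar + m.bar) * (m.bar + j.bar) + (k.bar + n.bar) * (n.bar + l.bar)
        + (m.bar + j.bar) * (k.bar + n.bar)) • (x i m * x' k n * (y m j * y' n l)) := by
  rw [superMatMul, superMatMul, Finset.sum_mul_sum]
  refine Finset.sum_congr rfl fun m _ => Finset.sum_congr rfl fun n _ => ?_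
  rw [smul_mul_smul_comm, superSign_add, superSign_add, mul_smul, mul_assoc (x i m),
    ← mul_assoc (y m j), h m j k n, smul_mul_assoc, mul_smul_comm]
  simp only [mul_assoc, smul_smul]

/-- The relation for `x` turns $x_ux_v$ into $x_vx_u$ plus corrections, and then the relation for
`y` does the same for $y_uy_v$. Both kinds of correction contain terms of the mixed shape
$x_vx_uy_uy_v$. These do not cancel for fixed `m`, `n`, only after summation. -/
theorem quadratic_summand {a b d : W} {xu xv yu yv : QIndex N → QIndex N → W}
    (ha : ∀ w, Commute a w) (hb : ∀ w, Commute b w) (hd : ∀ w, Commute d w)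
    (hx : QuadraticRelation a b d xu xv) (hy : QuadraticRelation a b d yu yv)
    (i j k l m n : QIndex N) :
    superSign (i.bar * k.bar + i.bar * l.bar + k.bar * l.bar) • (a *
      (superSign ((i.bar + m.bar) * (m.bar + j.bar) + (k.bar + n.bar) * (n.bar + l.bar)
          + (m.bar + j.bar) * (k.bar + n.bar)) • (xu i m * xv k n * (yu m j * yv n l))
        - superSign ((i.bar + j.bar) * (k.bar + l.bar)) •
          superSign ((k.bar + n.bar) * (n.bar + l.bar) + (i.bar + m.bar) * (m.bar + j.bar)
            + (n.bar + l.bar) * (i.bar + m.bar)) • (xv k n * xu i m * (yv n l * yu m j))))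
    = (superSign ((k.bar + m.bar) * (m.bar + j.bar) + (i.bar + n.bar) * (n.bar + l.bar)
          + (m.bar + j.bar) * (i.bar + n.bar)) • (b * (xu k m * xv i n * (yu m j * yv n l)))
       - superSign ((k.bar + m.bar) * (m.bar + j.bar) + (i.bar + n.bar) * (n.bar + l.bar)
          + (m.bar + j.bar) * (i.bar + n.bar)) • (b * (xv k m * xu i n * (yu m j * yv n l))))
      - (superSign (k.bar + l.bar) •
          superSign (((-k).bar + m.bar) * (m.bar + j.bar) + ((-i).bar + n.bar) * (n.bar + l.bar)
          + (m.bar + j.bar) * ((-i).bar + n.bar)) •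
            (d * (xu (-k) m * xv (-i) n * (yu m j * yv n l)))
         - superSign (k.bar + l.bar) •
          superSign (((-k).bar + m.bar) * (m.bar + j.bar) + ((-i).bar + n.bar) * (n.bar + l.bar)
          + (m.bar + j.bar) * ((-i).bar + n.bar)) •
            (d * (xv k (-m) * xu i (-n) * (yu m j * yv n l))))
      + (superSign ((k.bar + n.bar) * (n.bar + j.bar) + (i.bar + m.bar) * (m.bar + l.bar)
          + (n.bar + j.bar) * (i.bar + m.bar)) • (b * (xv k n * xu i m * (yu n j * yv m l)))
       - superSign ((k.bar + n.bar) * (n.bar + j.bar) + (i.bar + m.bar) * (m.bar + l.bar)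
          + (n.bar + j.bar) * (i.bar + m.bar)) • (b * (xv k n * xu i m * (yv n j * yu m l))))
      - (superSign (k.bar + l.bar) •
          superSign ((k.bar + n.bar) * (n.bar + (-j).bar) + (i.bar + m.bar) * (m.bar + (-l).bar)
          + (n.bar + (-j).bar) * (i.bar + m.bar)) •
            (d * (xv k n * xu i m * (yu (-n) j * yv (-m) l)))
         - superSign (k.bar + l.bar) •
          superSign ((k.bar + n.bar) * (n.bar + (-j).bar) + (i.bar + m.bar) * (m.bar + (-l).bar)
          + (n.bar + (-j).bar) * (i.bar + m.bar)) •
            (d * (xv k n * xu i m * (yv n (-j) * yu m (-l))))) := by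
  have key : ∀ (t s : ℂ) (p q r : W), t * t = 1 → t • (a * (p - s • q)) = r →
      a * p = s • (a * q) + t • r := by
    rintro t s p q _ ht rfl
    rw [smul_smul, ht, one_smul, mul_sub, mul_smul_comm, add_sub_cancel]
  have ex := key _ _ _ _ _ (superSign_mul_self _) (hx i m k n)
  have ey := key _ _ _ _ _ (superSign_mul_self _) (hy m j n l)
  have cb : ∀ p q : W, p * (b * q) = b * (p * q) := fun p q => by
    rw [← mul_assoc, ← (hb p).eq, mul_assoc]
  have cd : ∀ p q : W, p * (d * q) = d * (p * q) := fun p q => by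
    rw [← mul_assoc, ← (hd p).eq, mul_assoc]
  -- The central factor `a` is used first on the `x`-factors. On the reordered term it is carried
  -- past $x_vx_u$ and used on the `y`-factors.
  have e1 : a * (xu i m * xv k n * (yu m j * yv n l))
      = superSign ((i.bar + m.bar) * (k.bar + n.bar)) •
          (superSign ((m.bar + j.bar) * (n.bar + l.bar)) •
            (xv k n * xu i m * (a * (yv n l * yu m j)))
          + superSign (m.bar * n.bar + m.bar * l.bar + n.bar * l.bar) •
            (xv k n * xu i m * (b * (yu n j * yv m l - yv n j * yu m l) -
              superSign (n.bar + l.bar) •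
                (d * (yu (-n) j * yv (-m) l - yv n (-j) * yu m (-l))))))
        + superSign (i.bar * k.bar + i.bar * n.bar + k.bar * n.bar) •
          ((b * (xu k m * xv i n - xv k m * xu i n) -
            superSign (k.bar + n.bar) • (d * (xu (-k) m * xv (-i) n - xv k (-m) * xu i (-n))))
              * (yu m j * yv n l)) := by
    rw [← mul_assoc, ex, add_mul, smul_mul_assoc, smul_mul_assoc, (ha (xv k n * xu i m)).eq,
      mul_assoc _ a, ey, mul_add (xv k n * xu i m), mul_smul_comm, mul_smul_comm]
  have e2 : a * (xv k n * xu i m * (yv n l * yu m j))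
      = xv k n * xu i m * (a * (yv n l * yu m j)) := by
    rw [← mul_assoc a, (ha (xv k n * xu i m)).eq, mul_assoc (xv k n * xu i m) a]
  rw [mul_sub, mul_smul_comm, e1, mul_smul_comm, mul_smul_comm, e2]
  clear e1 e2 ex ey hx hy key ha hb hd
  generalize a * (yv n l * yu m j) = aY
  simp only [QIndex.neg_bar, smul_smul, ← superSign_add]
  generalize i.bar = i', j.bar = j', k.bar = k', l.bar = l', m.bar = m', n.bar = n'
  -- Each of the five sign identities is an equality of polynomial functions on ℤ/2, settled by
  -- evaluating at all parities. Afterwards the signs can be treated as independent scalars.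
  have h0 : superSign ((i' + j') * (k' + l') + ((k' + n') * (n' + l') + (i' + m') * (m' + j')
        + (n' + l') * (i' + m')))
      = superSign ((i' + m') * (m' + j') + (k' + n') * (n' + l') + (m' + j') * (k' + n'))
        * superSign ((i' + m') * (k' + n')) * superSign ((m' + j') * (n' + l')) := by
    simp only [← superSign_add]; congr 1; decide +revert
  have h1 : superSign ((k' + m') * (m' + j') + (i' + n') * (n' + l') + (m' + j') * (i' + n'))
      = superSign (i' * k' + i' * l' + k' * l')
        * superSign ((i' + m') * (m' + j') + (k' + n') * (n' + l') + (m' + j') * (k' + n'))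
        * superSign (i' * k' + i' * n' + k' * n') := by
    simp only [← superSign_add]; congr 1; clear h0; decide +revert
  have h2 : superSign ((k' + n') * (n' + j') + (i' + m') * (m' + l') + (n' + j') * (i' + m'))
      = superSign (i' * k' + i' * l' + k' * l')
        * superSign ((i' + m') * (m' + j') + (k' + n') * (n' + l') + (m' + j') * (k' + n'))
        * superSign ((i' + m') * (k' + n')) * superSign (m' * n' + m' * l' + n' * l') := by
    simp only [← superSign_add]; congr 1; clear h0 h1; decide +revert
  have h3 : superSign (k' + l' + ((k' + 1 + m') * (m' + j') + (i' + 1 + n') * (n' + l')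
        + (m' + j') * (i' + 1 + n')))
      = superSign (i' * k' + i' * l' + k' * l')
        * superSign ((i' + m') * (m' + j') + (k' + n') * (n' + l') + (m' + j') * (k' + n'))
        * superSign (i' * k' + i' * n' + k' * n') * superSign (k' + n') := by
    simp only [← superSign_add]; congr 1; clear h0 h1 h2; decide +revert
  have h4 : superSign (k' + l' + ((k' + n') * (n' + (j' + 1)) + (i' + m') * (m' + (l' + 1))
        + (n' + (j' + 1)) * (i' + m')))
      = superSign (i' * k' + i' * l' + k' * l')
        * superSign ((i' + m') * (m' + j') + (k' + n') * (n' + l') + (m' + j') * (k' + n'))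
        * superSign ((i' + m') * (k' + n')) * superSign (m' * n' + m' * l' + n' * l')
        * superSign (n' + l') := by
    simp only [← superSign_add]; congr 1; clear h0 h1 h2 h3; decide +revert
  rw [h0, h1, h2, h3, h4]
  clear h0 h1 h2 h3 h4
  generalize superSign (i' * k' + i' * l' + k' * l') = t1,
    superSign ((i' + m') * (m' + j') + (k' + n') * (n' + l') + (m' + j') * (k' + n')) = t2,
    superSign ((i' + m') * (k' + n')) = t3, superSign ((m' + j') * (n' + l')) = t4,
    superSign (i' * k' + i' * n' + k' * n') = t5, superSign (k' + n') = t6,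
    superSign (m' * n' + m' * l' + n' * l') = t7, superSign (n' + l') = t8
  simp only [mul_sub, sub_mul, mul_smul_comm, smul_mul_assoc, cb, cd, mul_assoc]
  module

/-- After summing over the intermediate indices the mixed terms $x_vx_uy_uy_v$ cancel. What is left,
$x_ux_vy_uy_v$ and $x_vx_uy_vy_u$, is the right-hand side for the product matrix. -/
theorem QuadraticRelation.superMatMul {a b d : W} {xu xv yu yv : QIndex N → QIndex N → W}
    (ha : ∀ w, Commute a w) (hb : ∀ w, Commute b w) (hd : ∀ w, Commute d w)
    (hx : QuadraticRelation a b d xu xv) (hy : QuadraticRelation a b d yu yv)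
    (huv : SuperCommute xu yv) (hvu : SuperCommute xv yu) :
    QuadraticRelation a b d (superMatMul xu yu) (superMatMul xv yv) := by
  intro i j k l
  simp only [superMatMul_mul hvu, superMatMul_mul huv]
  rw [Finset.sum_comm (γ := QIndex N) (f := fun m n => superSign ((k.bar + m.bar) * (m.bar + l.bar)
    + (i.bar + n.bar) * (n.bar + j.bar) + (m.bar + l.bar) * (i.bar + n.bar)) •
    (xv k m * xu i n * (yv m l * yu n j)))]
  simp only [mul_sub, Finset.smul_sum, Finset.mul_sum, ← Finset.sum_sub_distrib, smul_sub]
  have hs := fun m n => quadratic_summand ha hb hd hx hy i j k l m n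
  simp only [mul_sub, smul_sub] at hs
  simp only [hs]
  simp only [Finset.sum_add_distrib, Finset.sum_sub_distrib, mul_smul_comm]
  -- The untwisted mixed terms agree after exchanging `m` and `n`.
  have c1 : ∑ m : QIndex N, ∑ n : QIndex N,
      superSign ((k.bar + m.bar) * (m.bar + j.bar) + (i.bar + n.bar) * (n.bar + l.bar)
          + (m.bar + j.bar) * (i.bar + n.bar)) • (b * (xv k m * xu i n * (yu m j * yv n l)))
      = ∑ m : QIndex N, ∑ n : QIndex N,
      superSign ((k.bar + n.bar) * (n.bar + j.bar) + (i.bar + m.bar) * (m.bar + l.bar)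
          + (n.bar + j.bar) * (i.bar + m.bar)) • (b * (xv k n * xu i m * (yu n j * yv m l))) :=
    Finset.sum_comm
  -- The twisted mixed terms agree after replacing `(m, n)` by `(-n, -m)`. This is where negation of
  -- indices has to be compatible with the signs.
  have c2 : ∑ m : QIndex N, ∑ n : QIndex N, superSign (k.bar + l.bar) •
          superSign (((-k).bar + m.bar) * (m.bar + j.bar) + ((-i).bar + n.bar) * (n.bar + l.bar)
          + (m.bar + j.bar) * ((-i).bar + n.bar)) •
            (d * (xv k (-m) * xu i (-n) * (yu m j * yv n l)))
      = ∑ m : QIndex N, ∑ n : QIndex N, superSign (k.bar + l.bar) •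
          superSign ((k.bar + n.bar) * (n.bar + (-j).bar) + (i.bar + m.bar) * (m.bar + (-l).bar)
          + (n.bar + (-j).bar) * (i.bar + m.bar)) •
            (d * (xv k n * xu i m * (yu (-n) j * yv (-m) l))) := by
    rw [Finset.sum_comm]
    refine Fintype.sum_equiv (Equiv.neg _) _ _ fun m => ?_
    refine Fintype.sum_equiv (Equiv.neg _) _ _ fun n => ?_
    simp only [Equiv.neg_apply, neg_neg, QIndex.neg_bar]
    congr 3
    generalize i.bar = i', j.bar = j', k.bar = k', l.bar = l', m.bar = m', n.bar = n'
    revert i' j' k' l' m' n'; decide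
  have c3 : ∑ m : QIndex N, ∑ n : QIndex N,
      superSign ((k.bar + n.bar) * (n.bar + j.bar) + (i.bar + m.bar) * (m.bar + l.bar)
          + (n.bar + j.bar) * (i.bar + m.bar)) • (b * (xv k n * xu i m * (yv n j * yu m l)))
      = ∑ m : QIndex N, ∑ n : QIndex N,
      superSign ((k.bar + m.bar) * (m.bar + j.bar) + (i.bar + n.bar) * (n.bar + l.bar)
          + (m.bar + j.bar) * (i.bar + n.bar)) • (b * (xv k m * xu i n * (yv m j * yu n l))) :=
    Finset.sum_comm
  have c4 : ∑ m : QIndex N, ∑ n : QIndex N, superSign (k.bar + l.bar) •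
          superSign ((k.bar + n.bar) * (n.bar + (-j).bar) + (i.bar + m.bar) * (m.bar + (-l).bar)
          + (n.bar + (-j).bar) * (i.bar + m.bar)) •
            (d * (xv k n * xu i m * (yv n (-j) * yu m (-l))))
      = ∑ m : QIndex N, ∑ n : QIndex N, superSign (k.bar + l.bar) •
          superSign ((k.bar + m.bar) * (m.bar + (-j).bar) + (i.bar + n.bar) * (n.bar + (-l).bar)
          + (m.bar + (-j).bar) * (i.bar + n.bar)) •
            (d * (xv k m * xu i n * (yv m (-j) * yu n (-l)))) :=
    Finset.sum_comm
  rw [c1, c2, c3, c4]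
  abel

end Coproduct

/-! ### The quadratic relation for the evaluation representation. -/

/-- The entries of the `R`-matrix: `e` are matrix units, `A` and `B` stand for `1 / (u - z)` and
`1 / (u + z)`. -/
noncomputable def siteMatrix {N : ℕ} {K W : Type*} [CommRing K] [Ring W] [Algebra ℂ W]
    [Algebra K W] (e : QIndex N → QIndex N → W) (A B : K) (i j : QIndex N) : W :=
  (if i = j then 1 else 0) - superSign j.bar • (A • e j i + B • e (-j) (-i))

/-- Here `w` and `y` stand for $u^{-1}$ and $v^{-1}$. The hypotheses `h1` to `h4` are the partial
fraction identities for products of $1/(u\mp z)$ and $1/(v\mp z)$, cleared of denominators. They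
turn every product of two matrix units into a difference or sum of single fractions, as the
right-hand side demands. -/
theorem siteMatrix_quadratic {N : ℕ} {K W : Type*} [CommRing K] [Algebra ℂ K] [Ring W]
    [Algebra ℂ W] [Algebra K W] [IsScalarTower ℂ K W] {e : QIndex N → QIndex N → W}
    (he : ∀ i j k l, e i j * e k l = if j = k then e i l else 0) {A B A' B' y w : K}
    (h1 : A * A' * (y - w) = w * y * (A' - A)) (h2 : B * B' * (y - w) = w * y * (B' - B))
    (h3 : A * B' * (y + w) = w * y * (A + B')) (h4 : A' * B * (y + w) = w * y * (A' + B)) :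
    QuadraticRelation (algebraMap K W (y ^ 2 - w ^ 2)) (algebraMap K W (w * y * (y + w)))
      (algebraMap K W (w * y * (y - w))) (siteMatrix e A B) (siteMatrix e A' B') := by
  intro i j k l
  obtain ⟨D, hD⟩ : ∃ D : QIndex N → QIndex N → K, ∀ i j, D i j = if i = j then 1 else 0 :=
    ⟨_, fun _ _ => rfl⟩
  have he' : ∀ i j k l, e i j * e k l = D j k • e i l := fun i j k l => by
    rw [he, hD]; split_ifs <;> simp
  have hone : ∀ i j, (if i = j then (1 : W) else 0) = D i j • (1 : W) := fun i j => by
    rw [hD]; split_ifs <;> simp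
  have hneg : ∀ i j, D (-i) j = D i (-j) := fun i j => by
    simp only [hD, neg_eq_iff_eq_neg]
  have hsw : ∀ i j, i ≠ j → D i j = 0 := fun i j h => by rw [hD, if_neg h]
  obtain ⟨S, hS⟩ : ∃ S : ZMod 2 → K, ∀ a, S a = algebraMap ℂ K (superSign a) := ⟨_, fun _ => rfl⟩
  have hSs : ∀ (a : ZMod 2) (x : W), superSign a • x = S a • x := fun a x => by
    rw [hS, algebraMap_smul]
  have hSadd : ∀ a b, S a * S b = S (a + b) := fun a b => by
    rw [hS, hS, hS, superSign_add, map_mul]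
  have hS0 : S 0 = 1 := by rw [hS, superSign_zero, map_one]
  have hS1 : S 1 = -1 := by rw [hS, superSign_one, map_neg, map_one]
  -- The sign identities `f1` to `f7` hold only on the support of the Kronecker delta in front, so
  -- the delta is kept as a factor.
  have f1 : D i l * (S (i.bar * k.bar + i.bar * l.bar + k.bar * l.bar) * S l.bar) = D i l := by
    by_cases h : i = l
    · subst h
      rw [hSadd, ← mul_one (D i i), ← hS0, mul_assoc, hSadd]; congr 2
      generalize i.bar = i, k.bar = k; decide +revert
    · rw [hsw i l h, zero_mul]
  have f2 : D k j * (S (i.bar * k.bar + i.bar * l.bar + k.bar * l.bar) * S j.bar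
      * S ((i.bar + j.bar) * (k.bar + l.bar))) = D k j := by
    by_cases h : k = j
    · subst h
      rw [hSadd, hSadd, ← mul_one (D k k), ← hS0, mul_assoc, hSadd]; congr 2
      generalize i.bar = i, k.bar = k, l.bar = l; decide +revert
    · rw [hsw k j h, zero_mul]
  have f3 : D i (-l) * (S (i.bar * k.bar + i.bar * l.bar + k.bar * l.bar) * S l.bar)
      = D i (-l) * S (k.bar + l.bar) := by
    by_cases h : i = -l
    · subst h
      rw [hSadd]; congr 2; rw [QIndex.neg_bar]
      generalize k.bar = k, l.bar = l; decide +revert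
    · rw [hsw i _ h, zero_mul, zero_mul]
  have f4 : D k (-j) * (S (i.bar * k.bar + i.bar * l.bar + k.bar * l.bar) * S j.bar
      * S ((i.bar + j.bar) * (k.bar + l.bar))) = - (D k (-j) * S (k.bar + l.bar)) := by
    by_cases h : k = -j
    · subst h
      rw [← mul_neg, ← neg_one_mul (S _), ← hS1, hSadd, hSadd, hSadd]; congr 2
      rw [QIndex.neg_bar]
      generalize i.bar = i, j.bar = k, l.bar = l; decide +revert
    · rw [hsw k _ h, zero_mul, zero_mul, neg_zero]
  have f5 : D k l * S ((i.bar + j.bar) * (k.bar + l.bar)) = D k l := by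
    by_cases h : k = l
    · subst h
      rw [CharTwo.add_self_eq_zero, mul_zero, hS0, mul_one]
    · rw [hsw _ _ h, zero_mul]
  have f6 : D i j * S ((i.bar + j.bar) * (k.bar + l.bar)) = D i j := by
    by_cases h : i = j
    · subst h
      rw [CharTwo.add_self_eq_zero, zero_mul, hS0, mul_one]
    · rw [hsw _ _ h, zero_mul]
  have f7 : D k (-l) * S (k.bar + l.bar) = - D k (-l) := by
    by_cases h : k = -l
    · subst h
      rw [QIndex.neg_bar, add_right_comm, CharTwo.add_self_eq_zero, zero_add, hS1, mul_neg_one]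
    · rw [hsw _ _ h, zero_mul, neg_zero]
  have hSn : ∀ a, S (a + 1) = - S a := fun a => by rw [← hSadd, hS1, mul_neg_one]
  have hc : ∀ i j, D i j = D j i := fun i j => by simp only [hD, eq_comm]
  simp only [siteMatrix, hone, hSs, QIndex.neg_bar, hSn]
  clear hS hSadd hS0 hS1 hSn hSs hone
  generalize S (i.bar * k.bar + i.bar * l.bar + k.bar * l.bar) = T at *
  generalize S ((i.bar + j.bar) * (k.bar + l.bar)) = E at *
  generalize S (k.bar + l.bar) = R at *
  generalize S i.bar = Si, S j.bar = Sj, S k.bar = Sk, S l.bar = Sl at *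
  simp only [Algebra.algebraMap_eq_smul_one, neg_neg, mul_add, add_mul, mul_sub, sub_mul,
    smul_mul_assoc, mul_smul_comm, one_mul, mul_one, he', hneg, smul_add,
    smul_sub, smul_smul]
  clear he he' hneg hsw
  -- Compare the coefficients of 1 and of the matrix units. The last two goals collect products
  -- carrying $\delta_{k,-l}$. These occur only on the right, and cancel between its straight and
  -- its twisted half.
  match_scalars
  · linear_combination (-(T * D k l * (y ^ 2 - w ^ 2))) * f6
  · linear_combination (T * Sj * A * (y ^ 2 - w ^ 2)) * f5
  · linear_combination (T * Sj * B * (y ^ 2 - w ^ 2)) * f5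
  · linear_combination (T * Sl * A' * (y ^ 2 - w ^ 2)) * f6
  · linear_combination (Sj * A * A' * (y ^ 2 - w ^ 2)) * f1 + (Sj * D i l * (y + w)) * h1
  · linear_combination (Sj * A' * B * (y ^ 2 - w ^ 2)) * f3 + (Sj * D i (-l) * R * (y - w)) * h4
  · linear_combination (T * Sl * B' * (y ^ 2 - w ^ 2)) * f6
  · linear_combination (Sj * A * B' * (y ^ 2 - w ^ 2)) * f3 + (Sj * D i (-l) * R * (y - w)) * h3
  · linear_combination (Sj * B * B' * (y ^ 2 - w ^ 2)) * f1 + (Sj * D i l * (y + w)) * h2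
  · linear_combination (-(Sl * A * A' * (y ^ 2 - w ^ 2))) * f2 - (Sl * D k j * (y + w)) * h1
  · linear_combination (-(Sl * A * B' * (y ^ 2 - w ^ 2))) * f4 + (Sl * D k (-j) * R * (y - w)) * h3
  · linear_combination (-(Sl * A' * B * (y ^ 2 - w ^ 2))) * f4 + (Sl * D k (-j) * R * (y - w)) * h4
  · linear_combination (-(Sl * B * B' * (y ^ 2 - w ^ 2))) * f2 - (Sl * D k j * (y + w)) * h2
  · linear_combination (Sl * Sj * w * y * D k (-l)) * (h3 - h4 + h1 - h2)
      - (Sl * Sj * w * y * (y - w) * (A * A' - B * B')) * f7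
  · linear_combination (-(Sl * Sj * w * y * D k (-l))) * (h3 - h4 + h1 - h2)
      + (Sl * Sj * w * y * (y - w) * (A * A' - B * B')) * f7

/-! ### Power series in two variables $w=u^{-1}$ and $y=v^{-1}$. -/

section CentralSeries

variable {R : Type*} [Ring R]

variable (R) in
/-- The first of the two variables. -/
noncomputable def varW : PowerSeries (PowerSeries R) := PowerSeries.X

variable (R) in
/-- The second of the two variables. -/
noncomputable def varY : PowerSeries (PowerSeries R) := PowerSeries.C PowerSeries.X

theorem PowerSeries.commute_of_coeff {f : PowerSeries R} (h : ∀ n r, Commute (PowerSeries.coeff n f) r)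
    (g : PowerSeries R) : Commute f g := by
  refine PowerSeries.ext fun n => ?_
  rw [PowerSeries.coeff_mul, PowerSeries.coeff_mul, ← Finset.Nat.sum_antidiagonal_swap]
  exact Finset.sum_congr rfl fun x _ => (h _ _).eq

theorem varW_commute (Z : PowerSeries (PowerSeries R)) : Commute (varW R) Z :=
  (PowerSeries.commute_X Z).symm

theorem varY_commute (Z : PowerSeries (PowerSeries R)) : Commute (varY R) Z := by
  refine PowerSeries.commute_of_coeff (fun n r => ?_) Z
  rw [varY, PowerSeries.coeff_C]
  split_ifs
  · exact (PowerSeries.commute_X r).symm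
  · exact Commute.zero_left r

end CentralSeries

section TwoVariables

variable {R : Type*} [Ring R] [Algebra ℂ R]

/-- The coefficient with an integral index of a power series. -/
noncomputable def icoeff (p : ℤ) : PowerSeries R →ₗ[ℂ] R where
  toFun f := if 0 ≤ p then PowerSeries.coeff p.toNat f else 0
  map_add' f g := by split_ifs <;> simp
  map_smul' c f := by
    split_ifs
    · rfl
    · simp

theorem icoeff_natCast (n : ℕ) (f : PowerSeries R) : icoeff (n : ℤ) f = PowerSeries.coeff n f := by
  simp [icoeff]

theorem icoeff_of_neg {p : ℤ} (hp : p < 0) (f : PowerSeries R) : icoeff p f = 0 := by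
  simp [icoeff, hp]

/-- With integral indices, multiplication by the variable is a shift without a boundary case. This
matches the defining relations, which are indexed by all integers. -/
theorem icoeff_X_mul (p : ℤ) (f : PowerSeries R) :
    icoeff p (PowerSeries.X * f) = icoeff (p - 1) f := by
  rcases lt_or_ge p 0 with hp | hp
  · rw [icoeff_of_neg hp, icoeff_of_neg (by omega)]
  · obtain ⟨n, rfl⟩ := Int.eq_ofNat_of_zero_le hp
    rw [icoeff_natCast]
    cases n with
    | zero => rw [icoeff_of_neg (by simp), PowerSeries.coeff_zero_X_mul]
    | succ n =>
      rw [PowerSeries.coeff_succ_X_mul, Nat.cast_succ, add_sub_cancel_right, icoeff_natCast]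

theorem icoeff_C_mul (p : ℤ) (a : R) (f : PowerSeries R) :
    icoeff p (PowerSeries.C a * f) = a * icoeff p f := by
  simp only [icoeff, LinearMap.coe_mk, AddHom.coe_mk]
  split_ifs
  · rw [PowerSeries.coeff_C_mul]
  · rw [mul_zero]

theorem icoeff_mul_C (p : ℤ) (a : R) (f : PowerSeries R) :
    icoeff p (f * PowerSeries.C a) = icoeff p f * a := by
  simp only [icoeff, LinearMap.coe_mk, AddHom.coe_mk]
  split_ifs
  · rw [PowerSeries.coeff_mul_C]
  · rw [zero_mul]

variable (R) in
/-- A power series in one variable as a power series in the first of two variables. -/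
noncomputable def firstVar : PowerSeries R →ₐ[ℂ] PowerSeries (PowerSeries R) where
  __ := PowerSeries.map PowerSeries.C
  commutes' c := by
    ext n : 1
    simp only [PowerSeries.algebraMap_apply, RingHom.toMonoidHom_eq_coe, OneHom.toFun_eq_coe,
      MonoidHom.toOneHom_coe, MonoidHom.coe_coe, PowerSeries.map_C]

variable (R) in
/-- A power series in one variable as a power series in the second of two variables. -/
noncomputable def secondVar : PowerSeries R →ₐ[ℂ] PowerSeries (PowerSeries R) where
  __ := PowerSeries.C
  commutes' _ := (PowerSeries.algebraMap_apply (R := ℂ) (A := PowerSeries R)).symm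

theorem firstVar_apply (f : PowerSeries R) : firstVar R f = PowerSeries.map PowerSeries.C f := rfl

theorem secondVar_apply (f : PowerSeries R) : secondVar R f = PowerSeries.C f := rfl

theorem icoeff_firstVar (p : ℤ) (f : PowerSeries R) :
    icoeff p (firstVar R f) = PowerSeries.C (icoeff p f) := by
  simp only [icoeff, LinearMap.coe_mk, AddHom.coe_mk, firstVar_apply]
  split_ifs
  · rw [PowerSeries.coeff_map]
  · rw [map_zero]

theorem icoeff_firstVar_mul_secondVar (p q : ℤ) (f g : PowerSeries R) :
    icoeff q (icoeff p (firstVar R f * secondVar R g)) = icoeff p f * icoeff q g := by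
  rw [secondVar_apply, icoeff_mul_C, icoeff_firstVar, icoeff_C_mul]

theorem icoeff_secondVar_mul_firstVar (p q : ℤ) (f g : PowerSeries R) :
    icoeff q (icoeff p (secondVar R g * firstVar R f)) = icoeff q g * icoeff p f := by
  rw [secondVar_apply, icoeff_C_mul, icoeff_firstVar, icoeff_mul_C]

theorem icoeff_ext {f g : PowerSeries R} (h : ∀ p, icoeff p f = icoeff p g) : f = g := by
  ext n; simpa only [icoeff_natCast] using h n

theorem icoeff_varW_mul (p q : ℤ) (Z : PowerSeries (PowerSeries R)) :
    icoeff q (icoeff p (varW R * Z)) = icoeff q (icoeff (p - 1) Z) := by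
  rw [varW, icoeff_X_mul]

theorem icoeff_varY_mul (p q : ℤ) (Z : PowerSeries (PowerSeries R)) :
    icoeff q (icoeff p (varY R * Z)) = icoeff (q - 1) (icoeff p Z) := by
  rw [varY, icoeff_C_mul, icoeff_X_mul]

theorem firstVar_commute {f : PowerSeries R} (h : ∀ n r, Commute (PowerSeries.coeff n f) r)
    (Z : PowerSeries (PowerSeries R)) : Commute (firstVar R f) Z := by
  refine PowerSeries.commute_of_coeff (fun n r => ?_) Z
  rw [firstVar_apply, PowerSeries.coeff_map]
  refine PowerSeries.commute_of_coeff (fun m s => ?_) r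
  rw [PowerSeries.coeff_C]
  split_ifs
  · exact h _ _
  · exact Commute.zero_left s

theorem secondVar_commute {f : PowerSeries R} (h : ∀ n r, Commute (PowerSeries.coeff n f) r)
    (Z : PowerSeries (PowerSeries R)) : Commute (secondVar R f) Z := by
  refine PowerSeries.commute_of_coeff (fun n r => ?_) Z
  rw [secondVar_apply, PowerSeries.coeff_C]
  split_ifs
  · exact PowerSeries.commute_of_coeff h r
  · exact Commute.zero_left r

end TwoVariables

/-! ### Families of series that define representations of the Yangian. -/

section Series

variable {N : ℕ} {R : Type*} [Ring R] [Algebra ℂ R]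

/-- A family of power series in `u⁻¹` satisfying the relations of the series `T_{ij}(u)`. -/
structure IsYangianSeries (t : QIndex N → QIndex N → PowerSeries R) : Prop where
  coeff_zero : ∀ i j, PowerSeries.coeff 0 (t i j) = if i = j then 1 else 0
  symm : ∀ i j m, PowerSeries.coeff m (t (-i) (-j)) = (-1 : ℂ) ^ m • PowerSeries.coeff m (t i j)
  -- The coefficients are $u^2-v^2$, $u+v$ and $u-v$ multiplied by $u^{-2}v^{-2}$, so that only
  -- nonnegative powers of $w$ and $y$ occur.
  quadratic : QuadraticRelation (varY R ^ 2 - varW R ^ 2) (varW R * varY R * (varY R + varW R))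
    (varW R * varY R * (varY R - varW R)) (fun i j => firstVar R (t i j))
    (fun i j => secondVar R (t i j))

namespace IsYangianSeries

variable {t : QIndex N → QIndex N → PowerSeries R}

open QueerYangian

theorem lift_freeT (ht : IsYangianSeries t) (i j : QIndex N) (p : ℤ) :
    FreeAlgebra.lift ℂ (fun x : Gen N => PowerSeries.coeff (x.s + 1) (t x.i x.j)) (freeT i j p)
      = icoeff p (t i j) := by
  match p with
  | .ofNat 0 =>
    change _ = icoeff ((0 : ℕ) : ℤ) _
    rw [icoeff_natCast, ht.coeff_zero, freeT]
    split_ifs <;> simp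
  | .ofNat (s + 1) =>
    change _ = icoeff ((s + 1 : ℕ) : ℤ) _
    rw [icoeff_natCast, freeT, FreeAlgebra.lift_ι_apply]
  | .negSucc n =>
    rw [icoeff_of_neg (Int.negSucc_lt_zero n), freeT, map_zero]

theorem coeff_quadratic (ht : IsYangianSeries t) (i j k l : QIndex N) (p q : ℤ) :
    superSign (i.bar * k.bar + i.bar * l.bar + k.bar * l.bar) •
      ((icoeff (p + 2) (t i j) * icoeff q (t k l)
        - superSign ((i.bar + j.bar) * (k.bar + l.bar)) •
          (icoeff q (t k l) * icoeff (p + 2) (t i j)))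
      - (icoeff p (t i j) * icoeff (q + 2) (t k l)
        - superSign ((i.bar + j.bar) * (k.bar + l.bar)) •
          (icoeff (q + 2) (t k l) * icoeff p (t i j))))
    = ((icoeff (p + 1) (t k j) * icoeff q (t i l) - icoeff q (t k j) * icoeff (p + 1) (t i l))
        + (icoeff p (t k j) * icoeff (q + 1) (t i l) - icoeff (q + 1) (t k j) * icoeff p (t i l)))
      - superSign (k.bar + l.bar) •
        ((icoeff (p + 1) (t (-k) j) * icoeff q (t (-i) l)
            - icoeff q (t k (-j)) * icoeff (p + 1) (t i (-l)))
          - (icoeff p (t (-k) j) * icoeff (q + 1) (t (-i) l)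
            - icoeff (q + 1) (t k (-j)) * icoeff p (t i (-l)))) := by
  have h := ht.quadratic i j k l
  generalize superSign (i.bar * k.bar + i.bar * l.bar + k.bar * l.bar) = T,
    superSign ((i.bar + j.bar) * (k.bar + l.bar)) = E, superSign (k.bar + l.bar) = S at h ⊢
  -- The index is shifted by 2 in both variables because the relation was multiplied by $w^2y^2$.
  replace h := congrArg (fun Z => icoeff (q + 2) (icoeff (p + 2) Z)) h
  simp only [pow_two, sub_mul, mul_assoc, mul_add, add_mul, map_sub, map_add, map_smul,
    icoeff_varW_mul, icoeff_varY_mul, icoeff_firstVar_mul_secondVar,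
    icoeff_secondVar_mul_firstVar, mul_sub, mul_smul_comm,
    show p + 2 - 1 = p + 1 by ring, show p + 1 - 1 = p by ring,
    show q + 2 - 1 = q + 1 by ring, show q + 1 - 1 = q by ring] at h
  simp only [smul_sub] at h ⊢
  rw [sub_sub_sub_comm, h]
  abel

/-- The representation of the Yangian defined by a family of power series. -/
noncomputable def hom (ht : IsYangianSeries t) : QueerYangian N →ₐ[ℂ] R :=
  RingQuot.liftAlgHom ℂ ⟨FreeAlgebra.lift ℂ fun x : Gen N =>
      PowerSeries.coeff (x.s + 1) (t x.i x.j), by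
    rintro _ _ (⟨i, j, k, l, p, q⟩ | ⟨i, j, m⟩)
    · simp only [freeComm, freeDiff, freeTwistedDiff, map_smul, map_sub, map_add, map_mul,
        ht.lift_freeT]
      exact ht.coeff_quadratic i j k l p q
    · rw [map_smul, ht.lift_freeT, ht.lift_freeT, icoeff_natCast, icoeff_natCast, ht.symm]⟩

theorem hom_gen (ht : IsYangianSeries t) (x : Gen N) :
    ht.hom (gen x) = PowerSeries.coeff (x.s + 1) (t x.i x.j) := by
  refine (RingQuot.liftAlgHom_mkAlgHom_apply (S := ℂ) _ _ _).trans ?_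
  rw [FreeAlgebra.lift_ι_apply]

/-- The comultiplication of the Yangian in terms of representations. -/
theorem superMatMul {x y : QIndex N → QIndex N → PowerSeries R} (hx : IsYangianSeries x)
    (hy : IsYangianSeries y)
    (h : ∀ i j k l p q, PowerSeries.coeff p (y i j) * PowerSeries.coeff q (x k l)
      = superSign ((i.bar + j.bar) * (k.bar + l.bar)) •
        (PowerSeries.coeff q (x k l) * PowerSeries.coeff p (y i j))) :
    IsYangianSeries (superMatMul x y) where
  coeff_zero i j := by
    rw [_root_.superMatMul, map_sum]
    have hz : ∀ m, PowerSeries.coeff 0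
        (superSign ((i.bar + m.bar) * (m.bar + j.bar)) • (x i m * y m j))
        = if m = i then (if i = j then 1 else 0) else 0 := fun m => by
      rw [show ∀ (c : ℂ) (f : PowerSeries R), PowerSeries.coeff 0 (c • f)
        = c • PowerSeries.coeff 0 f from fun _ _ => rfl, PowerSeries.coeff_mul]
      simp only [Finset.Nat.antidiagonal_zero, Finset.sum_singleton, hx.coeff_zero, hy.coeff_zero]
      by_cases h1 : m = i
      · subst h1
        by_cases h2 : m = j
        · subst h2
          simp [CharTwo.add_self_eq_zero, superSign_zero]
        · simp [h2]
      · simp [h1, Ne.symm h1]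
    simp only [hz, Finset.sum_ite_eq', Finset.mem_univ, if_true]
  symm i j m := by
    have hs : ∀ (c : ℂ) (f : PowerSeries R), PowerSeries.coeff m (c • f)
        = c • PowerSeries.coeff m f := fun _ _ => rfl
    rw [_root_.superMatMul, _root_.superMatMul, map_sum, map_sum, Finset.smul_sum]
    -- Negating the intermediate index leaves the signs unchanged, and the factors $(-1)^a(-1)^b$ of
    -- the two series combine to $(-1)^m$.
    refine Fintype.sum_equiv (Equiv.neg _) _ _ fun k => ?_
    obtain ⟨k, rfl⟩ : ∃ k', k = -k' := ⟨-k, (neg_neg k).symm⟩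
    rw [Equiv.neg_apply, neg_neg]
    rw [hs, hs, QIndex.neg_bar_add_neg_bar, QIndex.neg_bar_add_neg_bar, smul_comm]
    congr 1
    rw [PowerSeries.coeff_mul, PowerSeries.coeff_mul, Finset.smul_sum]
    refine Finset.sum_congr rfl fun a ha => ?_
    rw [hx.symm, hy.symm, smul_mul_smul_comm, ← pow_add, Finset.HasAntidiagonal.mem_antidiagonal.1 ha]
  quadratic := by
    have e1 : (fun i j => firstVar R (_root_.superMatMul x y i j))
        = _root_.superMatMul (fun i j => firstVar R (x i j)) (fun i j => firstVar R (y i j)) := by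
      ext1 i; ext1 j
      simp only [_root_.superMatMul, map_sum, map_smul, map_mul]
    have e2 : (fun i j => secondVar R (_root_.superMatMul x y i j))
        = _root_.superMatMul (fun i j => secondVar R (x i j)) (fun i j => secondVar R (y i j)) := by
      ext1 i; ext1 j
      simp only [_root_.superMatMul, map_sum, map_smul, map_mul]
    have hi : ∀ i j k l p q, icoeff p (y i j) * icoeff q (x k l)
        = superSign ((i.bar + j.bar) * (k.bar + l.bar)) • (icoeff q (x k l) * icoeff p (y i j)) := by
      intro i j k l p q
      simp only [icoeff, LinearMap.coe_mk, AddHom.coe_mk]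
      split_ifs
      · exact h _ _ _ _ _ _
      all_goals simp
    have cw := varW_commute (R := R)
    have cy := varY_commute (R := R)
    rw [e1, e2]
    refine QuadraticRelation.superMatMul (fun Z => ?_) (fun Z => ?_) (fun Z => ?_) hx.quadratic
      hy.quadratic (fun i j k l => ?_) (fun i j k l => ?_)
    · exact ((cy Z).pow_left 2).sub_left ((cw Z).pow_left 2)
    · exact ((cw Z).mul_left (cy Z)).mul_left ((cy Z).add_left (cw Z))
    · exact ((cw Z).mul_left (cy Z)).mul_left ((cy Z).sub_left (cw Z))
    · refine icoeff_ext fun p => icoeff_ext fun q => ?_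
      simp only [map_smul, icoeff_secondVar_mul_firstVar, icoeff_firstVar_mul_secondVar, hi]
    · refine icoeff_ext fun p => icoeff_ext fun q => ?_
      simp only [map_smul, icoeff_secondVar_mul_firstVar, icoeff_firstVar_mul_secondVar, hi]

end IsYangianSeries

end Series

/-! ### The evaluation series. -/

section Geometric

variable {R : Type*} [Ring R]

/-- The power series `w / (1 - ζ w)`. -/
noncomputable def geomSeries (ζ : R) : PowerSeries R :=
  PowerSeries.X * PowerSeries.mk fun n => ζ ^ n

theorem coeff_zero_geomSeries (ζ : R) : PowerSeries.coeff 0 (geomSeries ζ) = 0 := by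
  rw [geomSeries, PowerSeries.coeff_zero_X_mul]

theorem coeff_succ_geomSeries (ζ : R) (n : ℕ) :
    PowerSeries.coeff (n + 1) (geomSeries ζ) = ζ ^ n := by
  rw [geomSeries, PowerSeries.coeff_succ_X_mul, PowerSeries.coeff_mk]

/-- The recursion $A=w+w\zeta A$ that characterizes $1/(u-\zeta)$. The partial fraction identities
are deduced from it alone, without division. -/
theorem geomSeries_eq (ζ : R) :
    geomSeries ζ = PowerSeries.X + PowerSeries.X * (PowerSeries.C ζ * geomSeries ζ) := by
  ext n
  rw [map_add]
  rcases n with _ | _ | n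
  · rw [coeff_zero_geomSeries, PowerSeries.coeff_zero_X_mul, PowerSeries.coeff_zero_X, add_zero]
  · rw [coeff_succ_geomSeries, PowerSeries.coeff_succ_X_mul, PowerSeries.coeff_C_mul,
      coeff_zero_geomSeries, zero_add, PowerSeries.coeff_one_X, mul_zero, add_zero, pow_zero]
  · rw [coeff_succ_geomSeries, PowerSeries.coeff_succ_X_mul, PowerSeries.coeff_C_mul,
      coeff_succ_geomSeries, PowerSeries.coeff_X, if_neg (by omega), zero_add, pow_succ']

theorem geomSeries_central {ζ : R} (hζ : ∀ r, Commute ζ r) (n : ℕ) (r : R) :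
    Commute (PowerSeries.coeff n (geomSeries ζ)) r := by
  cases n with
  | zero => rw [coeff_zero_geomSeries]; exact Commute.zero_left r
  | succ n => rw [coeff_succ_geomSeries]; exact (hζ r).pow_left n

end Geometric

section PartialFractions

variable {K : Type*} [CommRing K] {A B w y z : K}

theorem partialFraction_sub (hA : A = w + w * (z * A)) (hB : B = y + y * (z * B)) :
    A * B * (y - w) = w * y * (B - A) := by
  linear_combination (B * y) * hA - (A * w) * hB

theorem partialFraction_add (hA : A = w + w * (z * A)) (hB : B = y - y * (z * B)) :
    A * B * (y + w) = w * y * (A + B) := by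
  linear_combination (B * y) * hA + (A * w) * hB

theorem partialFraction_sub_neg (hA : A = w - w * (z * A)) (hB : B = y - y * (z * B)) :
    A * B * (y - w) = w * y * (B - A) := by
  linear_combination (B * y) * hA - (A * w) * hB

theorem partialFraction_add' (hA : A = y + y * (z * A)) (hB : B = w - w * (z * B)) :
    A * B * (y + w) = w * y * (A + B) := by
  linear_combination (B * w) * hA + (A * y) * hB

end PartialFractions

section SiteSeries

variable {N : ℕ} {R : Type*} [Ring R] [Algebra ℂ R]

/-- The series `δ_{ij} - (-1)^{j̄} (e_{ji} / (u - ζ) + e_{-j,-i} / (u + ζ))`. -/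
noncomputable def siteSeries (e : QIndex N → QIndex N → R) (ζ : R) (i j : QIndex N) :
    PowerSeries R :=
  (if i = j then 1 else 0) - superSign j.bar • (geomSeries ζ * PowerSeries.C (e j i)
    + geomSeries (-ζ) * PowerSeries.C (e (-j) (-i)))

theorem coeff_zero_siteSeries (e : QIndex N → QIndex N → R) (ζ : R) (i j : QIndex N) :
    PowerSeries.coeff 0 (siteSeries e ζ i j) = if i = j then 1 else 0 := by
  have hs : ∀ (c : ℂ) (f : PowerSeries R), PowerSeries.coeff 0 (c • f)
    = c • PowerSeries.coeff 0 f := fun _ _ => rfl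
  rw [siteSeries, map_sub, hs, map_add, PowerSeries.coeff_mul_C, PowerSeries.coeff_mul_C,
    coeff_zero_geomSeries, coeff_zero_geomSeries, zero_mul, zero_mul, add_zero, smul_zero, sub_zero]
  split_ifs
  · exact PowerSeries.coeff_zero_one
  · exact map_zero _

theorem coeff_succ_siteSeries (e : QIndex N → QIndex N → R) (ζ : R) (i j : QIndex N) (n : ℕ) :
    PowerSeries.coeff (n + 1) (siteSeries e ζ i j)
      = -(superSign j.bar • (ζ ^ n * e j i + (-ζ) ^ n * e (-j) (-i))) := by
  have hs : ∀ (c : ℂ) (f : PowerSeries R), PowerSeries.coeff (n + 1) (c • f)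
    = c • PowerSeries.coeff (n + 1) f := fun _ _ => rfl
  rw [siteSeries, map_sub, hs, map_add, PowerSeries.coeff_mul_C, PowerSeries.coeff_mul_C,
    coeff_succ_geomSeries, coeff_succ_geomSeries]
  split_ifs
  · rw [PowerSeries.coeff_one, if_neg (Nat.succ_ne_zero n), zero_sub]
  · rw [map_zero, zero_sub]

/-- Any system of matrix units and any central `ζ` give an evaluation representation. The matrix
units are ordinary ones: their parity enters only through the signs of the indices. -/
theorem isYangianSeries_siteSeries {e : QIndex N → QIndex N → R}
    (he : ∀ i j k l, e i j * e k l = if j = k then e i l else 0) {ζ : R}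
    (hζ : ∀ r, Commute ζ r) : IsYangianSeries (siteSeries e ζ) where
  coeff_zero := coeff_zero_siteSeries e ζ
  symm i j m := by
    cases m with
    | zero => simp only [coeff_zero_siteSeries, neg_inj, pow_zero, one_smul]
    | succ m =>
      rw [coeff_succ_siteSeries, coeff_succ_siteSeries, neg_neg, neg_neg, QIndex.neg_bar,
        superSign_add, superSign_one]
      have h1 : (-ζ) ^ m = (-1 : ℂ) ^ m • ζ ^ m := by
        rw [← neg_one_smul ℂ ζ, smul_pow]
      rw [h1, smul_mul_assoc, smul_mul_assoc, pow_succ]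
      rcases neg_one_pow_eq_or ℂ m with h | h <;> rw [h] <;> module
  quadratic := by
    -- The fractions and variables are all central, so the identities between them can be verified
    -- in the centre, a commutative ring.
    let _ : Algebra (Subalgebra.center ℂ (PowerSeries (PowerSeries R)))
        (PowerSeries (PowerSeries R)) :=
      RingHom.toAlgebra' (Subalgebra.center ℂ (PowerSeries (PowerSeries R))).subtype
        fun c x => (Subalgebra.mem_center_iff.1 c.2 x).symm
    have tower := IsScalarTower.of_algebraMap_eq (R := ℂ)
      (S := Subalgebra.center ℂ (PowerSeries (PowerSeries R)))
      (A := PowerSeries (PowerSeries R)) fun _ => rfl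
    have hm : ∀ {x : PowerSeries (PowerSeries R)}, (∀ Z, Commute x Z) →
        x ∈ Subalgebra.center ℂ (PowerSeries (PowerSeries R)) := fun h =>
      Subalgebra.mem_center_iff.2 fun Z => (h Z).symm.eq
    have hζ' : ∀ r, Commute (-ζ) r := fun r => (hζ r).neg_left
    let A : Subalgebra.center ℂ (PowerSeries (PowerSeries R)) :=
      ⟨_, hm (firstVar_commute (geomSeries_central hζ))⟩
    let B : Subalgebra.center ℂ (PowerSeries (PowerSeries R)) :=
      ⟨_, hm (firstVar_commute (geomSeries_central hζ'))⟩
    let A' : Subalgebra.center ℂ (PowerSeries (PowerSeries R)) :=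
      ⟨_, hm (secondVar_commute (geomSeries_central hζ))⟩
    let B' : Subalgebra.center ℂ (PowerSeries (PowerSeries R)) :=
      ⟨_, hm (secondVar_commute (geomSeries_central hζ'))⟩
    let w : Subalgebra.center ℂ (PowerSeries (PowerSeries R)) := ⟨varW R, hm varW_commute⟩
    let y : Subalgebra.center ℂ (PowerSeries (PowerSeries R)) := ⟨varY R, hm varY_commute⟩
    have hz : ∀ Z, Commute (PowerSeries.C (PowerSeries.C ζ) : PowerSeries (PowerSeries R)) Z := by
      refine fun Z => secondVar_commute (R := R) (f := PowerSeries.C ζ) (fun n r => ?_) Z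
      rw [PowerSeries.coeff_C]
      split_ifs
      · exact hζ r
      · exact Commute.zero_left r
    let z : Subalgebra.center ℂ (PowerSeries (PowerSeries R)) := ⟨_, hm hz⟩
    have hA : A = w + w * (z * A) := Subtype.ext <| by
      change firstVar R (geomSeries ζ) = varW R
        + varW R * (PowerSeries.C (PowerSeries.C ζ) * firstVar R (geomSeries ζ))
      conv_lhs => rw [geomSeries_eq, map_add, map_mul, map_mul]
      simp only [firstVar_apply, PowerSeries.map_X, PowerSeries.map_C, varW]
    have hB : B = w - w * (z * B) := Subtype.ext <| by
      change firstVar R (geomSeries (-ζ)) = varW R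
        - varW R * (PowerSeries.C (PowerSeries.C ζ) * firstVar R (geomSeries (-ζ)))
      conv_lhs => rw [geomSeries_eq, map_add, map_mul, map_mul]
      simp only [firstVar_apply, PowerSeries.map_X, PowerSeries.map_C, varW, map_neg, neg_mul,
        mul_neg, sub_eq_add_neg]
    have hA' : A' = y + y * (z * A') := Subtype.ext <| by
      change secondVar R (geomSeries ζ) = varY R
        + varY R * (PowerSeries.C (PowerSeries.C ζ) * secondVar R (geomSeries ζ))
      conv_lhs => rw [geomSeries_eq, map_add, map_mul, map_mul]
      simp only [secondVar_apply, varY]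
    have hB' : B' = y - y * (z * B') := Subtype.ext <| by
      change secondVar R (geomSeries (-ζ)) = varY R
        - varY R * (PowerSeries.C (PowerSeries.C ζ) * secondVar R (geomSeries (-ζ)))
      conv_lhs => rw [geomSeries_eq, map_add, map_mul, map_mul]
      simp only [secondVar_apply, varY, map_neg, neg_mul, mul_neg, sub_eq_add_neg]
    have e1 : (fun i j => firstVar R (siteSeries e ζ i j))
        = siteMatrix (fun i j => PowerSeries.C (PowerSeries.C (e i j))) A B := by
      ext1 i; ext1 j
      rw [siteSeries, map_sub, map_smul, map_add, map_mul, map_mul, firstVar_apply (PowerSeries.C _),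
        firstVar_apply (PowerSeries.C _), PowerSeries.map_C, PowerSeries.map_C, siteMatrix]
      congr 1
      split_ifs
      · exact map_one _
      · exact map_zero _
    have e2 : (fun i j => secondVar R (siteSeries e ζ i j))
        = siteMatrix (fun i j => PowerSeries.C (PowerSeries.C (e i j))) A' B' := by
      ext1 i; ext1 j
      rw [siteSeries, map_sub, map_smul, map_add, map_mul, map_mul,
        secondVar_apply (PowerSeries.C _), secondVar_apply (PowerSeries.C _), siteMatrix]
      congr 1
      split_ifs
      · exact map_one _
      · exact map_zero _
    rw [e1, e2]
    refine siteMatrix_quadratic (y := y) (w := w) (fun i j k l => ?_) ?_ ?_ ?_ ?_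
    · rw [← map_mul, ← map_mul, he]
      split_ifs
      · rfl
      · rw [map_zero, map_zero]
    · exact partialFraction_sub hA hA'
    · exact partialFraction_sub_neg hB hB'
    · exact partialFraction_add hA hB'
    · exact partialFraction_add' hA' hB

end SiteSeries

/-! ### Symbols in the graded algebra. -/

namespace AssocGraded

variable {A : Type*} [Ring A] [Algebra ℂ A] {F : ℤ → Submodule ℂ A}

theorem symbol_congr {d e : ℤ} (h : d = e) {x : F d} {y : F e} (hxy : (x : A) = y) :
    symbol F d x = symbol F e y := by
  subst h
  rw [Subtype.ext hxy]

theorem symbol_eq_zero {d : ℤ} {x : F d} (h : (x : A) ∈ F (d - 1)) : symbol F d x = 0 := by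
  rw [symbol, LinearMap.comp_apply, GrPiece.mk_eq_zero.2 h, map_zero]

variable [IsRingFiltration F (fun d : ℤ => F (d - 1))]

theorem symbol_mul (d e : ℤ) (x : F d) (y : F e) : symbol F d x * symbol F e y
    = symbol F (d + e) ⟨(x : A) * (y : A), SetLike.mul_mem_graded x.2 y.2⟩ := by
  simp only [symbol, LinearMap.comp_apply, DirectSum.lof_eq_of]
  rw [DirectSum.of_mul_of]
  rfl

theorem symbol_one : symbol F 0 ⟨1, SetLike.one_mem_graded F⟩ = 1 := rfl

theorem parity_mul_mem {𝒜 : ZMod 2 → Submodule ℂ A} [SetLike.GradedMonoid 𝒜] {a b : ZMod 2}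
    {x y : AssocGraded F} (hx : x ∈ parity F 𝒜 a) (hy : y ∈ parity F 𝒜 b) :
    x * y ∈ parity F 𝒜 (a + b) := by
  induction hx using Submodule.iSup_induction' with
  | mem d x hx =>
    obtain ⟨x, hx, rfl⟩ := hx
    induction hy using Submodule.iSup_induction' with
    | mem e y hy =>
      obtain ⟨y, hy, rfl⟩ := hy
      rw [symbol_mul]
      refine Submodule.mem_iSup_of_mem (d + e) ⟨_, ?_, rfl⟩
      exact SetLike.mul_mem_graded (S := Submodule ℂ A) (A := 𝒜) hx hy
    | zero => rw [mul_zero]; exact zero_mem _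
    | add y y' _ _ hy hy' => rw [mul_add]; exact add_mem hy hy'
  | zero => rw [zero_mul]; exact zero_mem _
  | add y y' _ _ hy hy' => rw [add_mul]; exact add_mem hy hy'

theorem one_mem_parity {𝒜 : ZMod 2 → Submodule ℂ A} [SetLike.GradedMonoid 𝒜] :
    (1 : AssocGraded F) ∈ parity F 𝒜 0 :=
  Submodule.mem_iSup_of_mem 0 ⟨⟨1, SetLike.one_mem_graded F⟩,
    SetLike.one_mem_graded (S := Submodule ℂ A) 𝒜, rfl⟩

end AssocGraded

/-! ### Supercommutators in the graded Yangian. -/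

namespace QueerYangian

variable {N : ℕ}

/-- The coefficient of `u⁻ᵖ` of the series `T_{ij}(u)` over the Yangian. -/
def serT (i j : QIndex N) (p : ℤ) : QueerYangian N :=
  RingQuot.mkAlgHom ℂ (Rel (N := N)) (freeT i j p)

theorem serT_zero (i j : QIndex N) : serT i j 0 = if i = j then 1 else 0 := by
  have h : freeT i j 0 = if i = j then 1 else 0 := rfl
  rw [serT, h]
  split_ifs
  · exact map_one _
  · exact map_zero _

theorem serT_succ (i j : QIndex N) (s : ℕ) : serT i j (s + 1) = gen ⟨i, j, s⟩ := rfl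

theorem serT_neg (i j : QIndex N) {p : ℤ} (hp : p < 0) : serT i j p = 0 := by
  match p, hp with
  | .negSucc _, _ => exact map_zero (RingQuot.mkAlgHom ℂ (Rel (N := N)))

/-- The coefficient of `u⁻ᵖ v⁻ᵠ` of the supercommutator `[T_{ij}(u), T_{kl}(v)]`. -/
noncomputable def serComm (i j k l : QIndex N) (p q : ℤ) : QueerYangian N :=
  serT i j p * serT k l q
    - superSign ((i.bar + j.bar) * (k.bar + l.bar)) • (serT k l q * serT i j p)

theorem serT_quadratic (i j k l : QIndex N) (p q : ℤ) :
    superSign (i.bar * k.bar + i.bar * l.bar + k.bar * l.bar) •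
      (serComm i j k l (p + 2) q - serComm i j k l p (q + 2))
    = ((serT k j (p + 1) * serT i l q - serT k j q * serT i l (p + 1))
        + (serT k j p * serT i l (q + 1) - serT k j (q + 1) * serT i l p))
      - superSign (k.bar + l.bar) •
        ((serT (-k) j (p + 1) * serT (-i) l q - serT k (-j) q * serT i (-l) (p + 1))
          - (serT (-k) j p * serT (-i) l (q + 1) - serT k (-j) (q + 1) * serT i (-l) p)) := by
  have h := RingQuot.mkAlgHom_rel ℂ (Rel.quadratic i j k l p q)
  simp only [freeComm, freeDiff, freeTwistedDiff, map_smul, map_sub, map_add, map_mul] at h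
  exact h

theorem serT_symm (i j : QIndex N) (m : ℕ) : serT (-i) (-j) m = (-1 : ℂ) ^ m • serT i j m := by
  have h := RingQuot.mkAlgHom_rel ℂ (Rel.symmetry i j m)
  rw [map_smul] at h
  exact h

theorem gen_symm (i j : QIndex N) (s : ℕ) :
    gen ⟨-i, -j, s⟩ = (-1 : ℂ) ^ (s + 1) • gen ⟨i, j, s⟩ := serT_symm i j (s + 1)

theorem serT_mem (i j : QIndex N) (s : ℕ) : serT i j (s + 1) ∈ filtration N s :=
  gen_mem_filtration ⟨i, j, s⟩

theorem serComm_zero_left (i j k l : QIndex N) (q : ℤ) : serComm i j k l 0 q = 0 := by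
  rw [serComm, serT_zero]
  split_ifs with h
  · subst h
    rw [CharTwo.add_self_eq_zero, zero_mul, superSign_zero, one_smul, one_mul, mul_one, sub_self]
  · simp

theorem serComm_neg_left (i j k l : QIndex N) {p : ℤ} (hp : p < 0) (q : ℤ) :
    serComm i j k l p q = 0 := by
  rw [serComm, serT_neg _ _ hp]
  simp

/-- The leading term of the supercommutator of `T_{ij}^{(r+1)}` and `T_{kl}^{(s+1)}`, where
`m = r + s`. -/
noncomputable def commLead (i j k l : QIndex N) (r m : ℕ) : QueerYangian N :=
  superSign (i.bar * k.bar + i.bar * l.bar + k.bar * l.bar) •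
    (((if k = j then gen ⟨i, l, m⟩ else 0) - (if i = l then gen ⟨k, j, m⟩ else 0))
      - ((-1) ^ r * superSign (k.bar + l.bar)) •
        ((if -k = j then gen ⟨-i, l, m⟩ else 0) - (if i = -l then gen ⟨k, -j, m⟩ else 0)))

theorem mul_mem_of_le {x y : QueerYangian N} {a b d : ℤ} (hx : x ∈ filtration N a)
    (hy : y ∈ filtration N b) (h : a + b ≤ d) : x * y ∈ filtration N d :=
  filtration_mono N h (SetLike.mul_mem_graded hx hy)

theorem serT_mul_mem (i j k l : QIndex N) (r s : ℕ) {p q d : ℤ} (hp : p = r + 1) (hq : q = s + 1)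
    (hd : (r : ℤ) + s ≤ d) : serT i j p * serT k l q ∈ filtration N d := by
  subst hp hq
  exact mul_mem_of_le (serT_mem i j r) (serT_mem k l s) hd

/-- Solved for its first supercommutator, the quadratic relation lowers the first index by 2 and
raises the second by 2. The correction is a combination of products of total degree $r+s-1$, unless
one factor has index 0 and is a Kronecker delta. `commLead` depends on `r` only through its parity
and through the sum `r + s`, so it is unchanged by the step. -/
theorem serComm_sub_commLead_mem (i j k l : QIndex N) (r s : ℕ) :
    serComm i j k l (r + 1) (s + 1) - commLead i j k l r (r + s) ∈ filtration N ((r + s : ℤ) - 1) := by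
  have hinv : ∀ {t : ℂ} {x y : QueerYangian N}, t * t = 1 → t • x = y → x = t • y := by
    rintro t x _ ht rfl
    rw [smul_smul, ht, one_smul]
  have hdelta : ∀ (a b : QIndex N) (x : QueerYangian N),
      serT a b 0 * x = if a = b then x else 0 := fun a b x => by
    rw [serT_zero]; split_ifs <;> simp
  have hdelta' : ∀ (a b : QIndex N) (x : QueerYangian N),
      x * serT a b 0 = if a = b then x else 0 := fun a b x => by
    rw [serT_zero]; split_ifs <;> simp
  induction r using Nat.strong_induction_on generalizing s with
  | _ r ih =>
  rcases r with _ | _ | r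
  -- At `p = -1` the second supercommutator is zero, and every product on the right has a factor of
  -- index 0 or −1. The formula is therefore exact.
  · have h := hinv (superSign_mul_self _) (serT_quadratic i j k l (-1) (s + 1))
    rw [serComm_neg_left _ _ _ _ (by norm_num : (-1 : ℤ) < 0), sub_zero] at h
    have hz : ∀ a b : QIndex N, serT a b (-1) = 0 := fun a b => serT_neg a b (by norm_num)
    simp only [hz, neg_add_cancel, hdelta, hdelta', zero_mul, mul_zero, sub_self, add_zero,
      sub_zero] at h
    have e : serComm i j k l ((0 : ℕ) + 1) (s + 1) = commLead i j k l 0 (0 + s) := by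
      rw [commLead, pow_zero, one_mul, zero_add]
      exact h
    rw [e, sub_self]
    exact zero_mem _
  -- At `p = 0` the second supercommutator involves a scalar and vanishes. The deltas now come from
  -- the summands with factor $v$ in $u+v$ and $u-v$, which produces the sign $(-1)^r$ of the
  -- twisted part.
  · have h := hinv (superSign_mul_self _) (serT_quadratic i j k l 0 (s + 1))
    rw [serComm_zero_left, sub_zero] at h
    simp only [zero_add, hdelta, hdelta'] at h
    have e : serComm i j k l ((0 + 1 : ℕ) + 1) (s + 1) - commLead i j k l (0 + 1) (0 + 1 + s)
        = superSign (i.bar * k.bar + i.bar * l.bar + k.bar * l.bar) •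
          ((serT k j 1 * serT i l (s + 1) - serT k j (s + 1) * serT i l 1)
          - superSign (k.bar + l.bar) •
            (serT (-k) j 1 * serT (-i) l (s + 1) - serT k (-j) (s + 1) * serT i (-l) 1)) := by
      have e1 : serComm i j k l ((0 + 1 : ℕ) + 1) (s + 1) = serComm i j k l 2 (s + 1) := rfl
      have e2 : ∀ a b : QIndex N, serT a b ((s : ℤ) + 1 + 1) = gen ⟨a, b, 0 + 1 + s⟩ := fun a b => by
        rw [zero_add, add_comm 1 s, ← serT_succ]; push_cast; rfl
      rw [e1, h, commLead]
      simp only [e2]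
      module
    rw [e]
    have hd : ((0 + 1 : ℕ) : ℤ) + s - 1 = s := by push_cast; ring
    rw [hd]
    refine Submodule.smul_mem _ _ (Submodule.sub_mem _ (Submodule.sub_mem _ ?_ ?_)
      (Submodule.smul_mem _ _ (Submodule.sub_mem _ ?_ ?_)))
    · exact serT_mul_mem _ _ _ _ 0 s (by simp) rfl (by simp)
    · exact serT_mul_mem _ _ _ _ s 0 rfl (by simp) (by simp)
    · exact serT_mul_mem _ _ _ _ 0 s (by simp) rfl (by simp)
    · exact serT_mul_mem _ _ _ _ s 0 rfl (by simp) (by simp)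
  -- All indices are now positive, so the right-hand side has no delta and lies entirely in lower
  -- degree.
  · have h := hinv (superSign_mul_self _) (serT_quadratic i j k l (r + 1) (s + 1))
    have h2 := ih r (by omega) (s + 2)
    have e : commLead i j k l (r + 1 + 1) (r + 1 + 1 + s) = commLead i j k l r (r + (s + 2)) := by
      rw [commLead, commLead, show r + 1 + 1 + s = r + (s + 2) by ring, pow_succ, pow_succ,
        mul_neg_one, mul_neg_one, neg_neg]
    rw [e]
    have e1 : (((r + 1 + 1 : ℕ) : ℤ) + 1) = (r : ℤ) + 1 + 2 := by push_cast; ring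
    have e2 : (((s + 2 : ℕ) : ℤ) + 1) = (s : ℤ) + 1 + 2 := by push_cast; ring
    have e3 : ((r + 1 + 1 : ℕ) : ℤ) + s - 1 = r + s + 1 := by push_cast; ring
    have e4 : (r : ℤ) + (s + 2 : ℕ) - 1 = r + s + 1 := by push_cast; ring
    rw [e1, e3]
    rw [e2, e4] at h2
    rw [← sub_add_sub_cancel, h]
    refine Submodule.add_mem _ ?_ h2
    refine Submodule.smul_mem _ _ (Submodule.sub_mem _ (Submodule.add_mem _
      (Submodule.sub_mem _ ?_ ?_) (Submodule.sub_mem _ ?_ ?_))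
      (Submodule.smul_mem _ _ (Submodule.sub_mem _ (Submodule.sub_mem _ ?_ ?_)
      (Submodule.sub_mem _ ?_ ?_))))
    · exact serT_mul_mem _ _ _ _ (r + 1) s (by simp) rfl (by push_cast; linarith)
    · exact serT_mul_mem _ _ _ _ s (r + 1) rfl (by simp) (by push_cast; linarith)
    · exact serT_mul_mem _ _ _ _ r (s + 1) rfl (by simp) (by push_cast; linarith)
    · exact serT_mul_mem _ _ _ _ (s + 1) r (by simp) rfl (by push_cast; linarith)
    · exact serT_mul_mem _ _ _ _ (r + 1) s (by simp) rfl (by push_cast; linarith)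
    · exact serT_mul_mem _ _ _ _ s (r + 1) rfl (by simp) (by push_cast; linarith)
    · exact serT_mul_mem _ _ _ _ r (s + 1) rfl (by simp) (by push_cast; linarith)
    · exact serT_mul_mem _ _ _ _ (s + 1) r (by simp) rfl (by push_cast; linarith)

theorem elemG_symm (i j : QIndex N) (s : ℕ) :
    elemG (-i) (-j) s = (-1 : ℂ) ^ (s + 1) • elemG i j s := by
  rw [elemG, elemG, ← map_smul]
  exact AssocGraded.symbol_congr rfl (gen_symm i j s)

/-- The supercommutation relations of the generators of the graded algebra. -/
theorem elemG_comm (i j k l : QIndex N) (r s : ℕ) :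
    elemG i j r * elemG k l s
      - superSign ((i.bar + j.bar) * (k.bar + l.bar)) • (elemG k l s * elemG i j r)
    = superSign (i.bar * k.bar + i.bar * l.bar + k.bar * l.bar) •
    (((if k = j then elemG i l (r + s) else 0) - (if i = l then elemG k j (r + s) else 0))
      - ((-1) ^ r * superSign (k.bar + l.bar)) •
        ((if -k = j then elemG (-i) l (r + s) else 0)
          - (if i = -l then elemG k (-j) (r + s) else 0))) := by
  have hG : ∀ (a b : QIndex N) (c : Prop) [Decidable c], (if c then elemG a b (r + s) else 0)
      = AssocGraded.symbol (filtration N) (r + s : ℕ)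
        (if c then ⟨gen ⟨a, b, r + s⟩, gen_mem_filtration ⟨a, b, r + s⟩⟩ else 0) := fun a b c _ => by
    split_ifs
    · rfl
    · rw [map_zero]
  have h1 : elemG i j r * elemG k l s = AssocGraded.symbol (filtration N) (r + s : ℕ)
      ⟨gen ⟨i, j, r⟩ * gen ⟨k, l, s⟩, by
        push_cast
        exact SetLike.mul_mem_graded (gen_mem_filtration ⟨i, j, r⟩) (gen_mem_filtration ⟨k, l, s⟩)⟩ :=
    (AssocGraded.symbol_mul _ _ _ _).trans (AssocGraded.symbol_congr (by simp) rfl)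
  have h2 : elemG k l s * elemG i j r = AssocGraded.symbol (filtration N) (r + s : ℕ)
      ⟨gen ⟨k, l, s⟩ * gen ⟨i, j, r⟩, by
        push_cast
        rw [add_comm]
        exact SetLike.mul_mem_graded (gen_mem_filtration ⟨k, l, s⟩) (gen_mem_filtration ⟨i, j, r⟩)⟩ :=
    (AssocGraded.symbol_mul _ _ _ _).trans (AssocGraded.symbol_congr (by push_cast; ring) rfl)
  rw [h1, h2]
  simp only [hG, ← map_smul, ← map_sub]
  rw [← sub_eq_zero, ← map_sub]
  refine AssocGraded.symbol_eq_zero ?_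
  have h := serComm_sub_commLead_mem i j k l r s
  have hc : ∀ (c : Prop) [Decidable c] (x : filtration N (r + s : ℕ)),
      ((if c then x else 0 : filtration N (r + s : ℕ)) : QueerYangian N)
        = if c then (x : QueerYangian N) else 0 := fun c _ x => by
    split_ifs <;> rfl
  simp only [Submodule.coe_sub, Submodule.coe_smul, hc]
  rw [Nat.cast_add]
  exact h

end QueerYangian

/-! ### Spanning elements of the current superalgebra and their brackets. -/

namespace twistedCurrent

open CurrentMatrix

variable {N : ℕ}

/-- The element `E_{ij} p(u) + E_{-i,-j} p(-u)` of `𝔤`. -/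
noncomputable def elemP (i j : QIndex N) : ℂ[X] →ₗ[ℂ] twistedCurrent N where
  toFun p := ⟨Matrix.single i j p + Matrix.single (-i) (-j) (p.comp (-Polynomial.X)), by
    change eta _ = substNeg _
    rw [map_add, map_add, eta_single, eta_single, substNeg_single, substNeg_single, neg_neg,
      neg_neg, add_comm, Polynomial.comp_assoc]
    simp⟩
  map_add' p q := Subtype.ext <| by
    simp only [Polynomial.add_comp, Matrix.single_add, Submodule.coe_add]
    abel
  map_smul' c p := Subtype.ext <| by
    simp only [Polynomial.smul_comp, ← Matrix.smul_single, RingHom.id_apply, Submodule.coe_smul,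
      smul_add]

theorem elemP_X_pow (i j : QIndex N) (s : ℕ) : elemP i j (Polynomial.X ^ s) = elemF i j s :=
  Subtype.ext <| by
    change Matrix.single i j _ + Matrix.single (-i) (-j) _ = _ + _
    rw [Polynomial.X_pow_comp]

theorem elemP_mem_span (i j : QIndex N) (p : ℂ[X]) :
    elemP i j p ∈ Submodule.span ℂ (Set.range (elemF i j)) := by
  induction p using Polynomial.induction_on' with
  | add p q hp hq => rw [map_add]; exact add_mem hp hq
  | monomial n c =>
    rw [← Polynomial.C_mul_X_pow_eq_monomial, ← Polynomial.smul_eq_C_mul, map_smul, elemP_X_pow]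
    exact Submodule.smul_mem _ _ (Submodule.subset_span ⟨n, rfl⟩)

/-- Summing over all `i` and `j` counts each entry twice, the second time through the symmetry
$\eta(X(u))=X(-u)$. -/
theorem eq_sum_elemP (x : twistedCurrent N) :
    x = (1 / 2 : ℂ) • ∑ i, ∑ j, elemP i j ((x : CurrentMatrix N) i j) := by
  have h : (2 : ℂ) • x = ∑ i, ∑ j, elemP i j ((x : CurrentMatrix N) i j) := by
    refine Subtype.ext ?_
    rw [Submodule.coe_smul, two_smul, Submodule.coe_sum]
    simp only [Submodule.coe_sum]
    change _ = ∑ i, ∑ j, (Matrix.single i j _ + Matrix.single (-i) (-j) _)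
    simp only [Finset.sum_add_distrib]
    congr 1
    · exact Matrix.matrix_eq_sum_single _
    · have hx : eta (x : CurrentMatrix N) = substNeg x := x.2
      have h2 : eta (substNeg (x : CurrentMatrix N)) = x := by
        rw [← hx]
        ext1 i j
        rw [eta_apply, eta_apply, neg_neg, neg_neg]
      conv_lhs => rw [← h2, Matrix.matrix_eq_sum_single (substNeg (x : CurrentMatrix N))]
      simp only [map_sum, eta_single]
      rfl
  rw [← h, smul_smul]
  norm_num

theorem elemF_isHomog (i j : QIndex N) (s : ℕ) :
    IsHomog (i.bar + j.bar) (elemF i j s : CurrentMatrix N) := by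
  intro k l h
  change (Matrix.single i j (Polynomial.X ^ s : ℂ[X])
    + Matrix.single (-i) (-j) ((-Polynomial.X) ^ s : ℂ[X])) k l = 0
  rw [Matrix.add_apply, Matrix.single_apply, Matrix.single_apply, if_neg, if_neg, add_zero]
  · rintro ⟨rfl, rfl⟩
    exact h (QIndex.neg_bar_add_neg_bar i j)
  · rintro ⟨rfl, rfl⟩
    exact h rfl

theorem elemF_mem_parity (i j : QIndex N) (s : ℕ) :
    elemF i j s ∈ LieSuperalgebra.parity (L := twistedCurrent N) (i.bar + j.bar) :=
  elemF_isHomog i j s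

theorem mem_span_elemF {a : ZMod 2} {x : twistedCurrent N}
    (hx : x ∈ LieSuperalgebra.parity (L := twistedCurrent N) a) :
    x ∈ Submodule.span ℂ {y | ∃ i j s, i.bar + j.bar = a ∧ y = elemF (N := N) i j s} := by
  rw [eq_sum_elemP x]
  refine Submodule.smul_mem _ _ (Submodule.sum_mem _ fun i _ => Submodule.sum_mem _ fun j _ => ?_)
  by_cases h : i.bar + j.bar = a
  · refine Submodule.span_mono ?_ (elemP_mem_span i j _)
    rintro _ ⟨s, rfl⟩
    exact ⟨i, j, s, h, rfl⟩
  · have : (x : CurrentMatrix N) i j = 0 := hx i j h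
    rw [this, map_zero]
    exact zero_mem _

/-- Since $F_{lk}^{(s)}=(-1)^sF_{-l,-k}^{(s)}$, the case $i=-l$ reduces to $i=l$ at the cost of the
sign. The two cases exclude each other because $l\neq-l$. -/
theorem elemF_mul (i j k l : QIndex N) (r s : ℕ) :
    (elemF j i r : CurrentMatrix N) * (elemF l k s : CurrentMatrix N)
      = (if i = l then (elemF j k (r + s) : CurrentMatrix N) else 0)
        + (-1 : ℂ) ^ s • (if i = -l then (elemF j (-k) (r + s) : CurrentMatrix N) else 0) := by
  have hF : ∀ (a b : QIndex N) (t : ℕ), (elemF a b t : CurrentMatrix N)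
      = Matrix.single a b (Polynomial.X ^ t) + Matrix.single (-a) (-b) ((-Polynomial.X) ^ t) :=
    fun _ _ _ => rfl
  have hm : ∀ (a b c d : QIndex N) (p q : ℂ[X]), Matrix.single a b p * Matrix.single c d q
      = if b = c then Matrix.single a d (p * q) else 0 := fun a b c d p q => by
    split_ifs with h
    · subst h; exact Matrix.single_mul_single_same _ _ _ _ _
    · exact Matrix.single_mul_single_of_ne _ _ _ _ h _
  have hne : ∀ a : QIndex N, a ≠ -a := fun a h => by
    have := congrArg QIndex.bar h
    rw [QIndex.neg_bar] at this
    exact absurd this (by generalize a.bar = b; decide +revert)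
  have hp : ∀ t : ℕ, (-Polynomial.X : ℂ[X]) ^ t = (-1 : ℂ) ^ t • Polynomial.X ^ t := fun t => by
    rw [← neg_one_smul ℂ (Polynomial.X : ℂ[X]), smul_pow]
  have hpp : ∀ t : ℕ, ((-1 : ℂ) ^ t * (-1) ^ t) = 1 := fun t => by rw [← mul_pow]; simp
  rw [hF, hF, mul_add, add_mul, add_mul, hm, hm, hm, hm, hF, hF]
  simp only [neg_eq_iff_eq_neg, neg_neg, hp]
  by_cases h1 : i = l
  · subst h1
    simp [hne, pow_add, smul_smul, mul_comm]
  · by_cases h2 : i = -l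
    · subst h2
      have h3 : ¬ -l = l := fun h => hne l h.symm
      simp only [h3, if_false, if_true, zero_add, add_zero, mul_smul_comm,
        smul_mul_assoc, ← Matrix.smul_single, smul_add, smul_smul, pow_add]
      rw [add_comm, mul_left_comm, hpp, mul_one]
    · simp [h1, h2]

theorem bracket_elemF (i j k l : QIndex N) (r s : ℕ) :
    LieSuperalgebra.bracket (elemF j i r) (elemF (N := N) l k s)
      = ((if i = l then elemF j k (r + s) else 0)
        + (-1 : ℂ) ^ s • (if i = -l then elemF j (-k) (r + s) else 0))
      - superSign ((i.bar + j.bar) * (k.bar + l.bar)) •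
        ((if k = j then elemF l i (r + s) else 0)
        + (-1 : ℂ) ^ r • (if k = -j then elemF l (-i) (r + s) else 0)) := by
  refine Subtype.ext ?_
  refine ((elemF_isHomog j i r).superBracket_eq (elemF_isHomog l k s)).trans ?_
  rw [elemF_mul, elemF_mul, add_comm j.bar, add_comm l.bar, add_comm s r]
  have hc : ∀ (c : Prop) [Decidable c] (x : twistedCurrent N),
      ((if c then x else 0 : twistedCurrent N) : CurrentMatrix N)
        = if c then (x : CurrentMatrix N) else 0 := fun c _ x => by
    split_ifs <;> rfl
  simp only [Submodule.coe_sub, Submodule.coe_add, Submodule.coe_smul, hc]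

end twistedCurrent

/-! ### The homomorphism from the enveloping algebra to the graded Yangian. -/

namespace QueerYangian

open twistedCurrent CurrentMatrix

variable {N : ℕ}

/-- The linear map `p ↦ ∑ₛ pₛ G_{ij}^{(s+1)}`. -/
noncomputable def polyG (i j : QIndex N) : ℂ[X] →ₗ[ℂ] Gr N :=
  (Polynomial.basisMonomials ℂ).constr ℂ (elemG i j)

theorem polyG_X_pow (i j : QIndex N) (s : ℕ) : polyG i j (Polynomial.X ^ s) = elemG i j s := by
  have h := Module.Basis.constr_basis (Polynomial.basisMonomials ℂ) ℂ (elemG i j) s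
  rw [Polynomial.coe_basisMonomials] at h
  rw [Polynomial.X_pow_eq_monomial]
  exact h

/-- The linear map from `𝔤` to the graded algebra with `F_{ji}^{(s)} ↦ -(-1)^{j̄} G_{ij}^{(s+1)}`. -/
noncomputable def linearToGr (N : ℕ) : twistedCurrent N →ₗ[ℂ] Gr N :=
  (∑ i : QIndex N, ∑ j : QIndex N, (-(superSign j.bar) / 2) •
    polyG i j ∘ₗ Matrix.entryLinearMap ℂ ℂ[X] j i) ∘ₗ (twistedCurrent N).subtype

/-- The map is defined on all matrices and then restricted, so it is well defined despite the linear
relations among the $F_{ji}^{(s)}$. The two matrix entries of $F_{ji}^{(s)}$ contribute equally by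
`elemG_symm`, hence the factor 1/2 in the definition. -/
theorem linearToGr_elemF (i j : QIndex N) (s : ℕ) :
    linearToGr N (elemF j i s) = -(superSign j.bar • elemG i j s) := by
  have hp : (-Polynomial.X : ℂ[X]) ^ s = (-1 : ℂ) ^ s • Polynomial.X ^ s := by
    rw [← neg_one_smul ℂ (Polynomial.X : ℂ[X]), smul_pow]
  have h : ∀ (a b : QIndex N) (p : ℂ[X]),
      (∑ i : QIndex N, ∑ j : QIndex N, (-(superSign j.bar) / 2) •
        polyG i j ∘ₗ Matrix.entryLinearMap ℂ ℂ[X] j i) (Matrix.single b a p)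
      = (-(superSign b.bar) / 2) • polyG a b p := fun a b p => by
    simp only [LinearMap.sum_apply, LinearMap.smul_apply, LinearMap.comp_apply,
      Matrix.entryLinearMap_apply, Matrix.single_apply]
    rw [Finset.sum_eq_single a, Finset.sum_eq_single b]
    · simp
    · intro c _ hc
      simp [hc.symm]
    · simp
    · intro c _ hc
      simp [hc.symm]
    · simp
  change (∑ i : QIndex N, ∑ j : QIndex N, (-(superSign j.bar) / 2) •
    polyG i j ∘ₗ Matrix.entryLinearMap ℂ ℂ[X] j i)
      (Matrix.single j i (Polynomial.X ^ s) + Matrix.single (-j) (-i) ((-Polynomial.X) ^ s)) = _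
  rw [map_add, h, h, hp, map_smul, polyG_X_pow, polyG_X_pow, elemG_symm, QIndex.neg_bar,
    superSign_add, superSign_one, pow_succ]
  rcases neg_one_pow_eq_or ℂ s with h | h <;> rw [h] <;> module

/-- Both the relation in the graded algebra and the bracket of $\mathfrak g$ have four delta terms.
They match one by one, once $G_{k,-j}$ is rewritten through $G_{-k,j}$. -/
theorem linearToGr_comm_elemF (i j k l : QIndex N) (r s : ℕ) :
    linearToGr N (elemF j i r) * linearToGr N (elemF l k s)
      = superSign ((i.bar + j.bar) * (k.bar + l.bar)) •
          (linearToGr N (elemF l k s) * linearToGr N (elemF j i r))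
        + linearToGr N (LieSuperalgebra.bracket (elemF j i r) (elemF l k s)) := by
  have h := elemG_comm i j k l r s
  have hc : ∀ (c : Prop) [Decidable c] (x : twistedCurrent N),
      linearToGr N (if c then x else 0) = if c then linearToGr N x else 0 := fun c _ x => by
    split_ifs
    · rfl
    · exact map_zero _
  rw [bracket_elemF]
  simp only [map_sub, map_add, map_smul, hc, linearToGr_elemF]
  rw [sub_eq_iff_eq_add] at h
  simp only [neg_mul_neg, smul_mul_smul_comm, h]
  have hG : elemG k (-j) (r + s) = (-1 : ℂ) ^ (r + s + 1) • elemG (-k) j (r + s) := by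
    rw [← elemG_symm, neg_neg]
  have e1 : -k = j ↔ k = -j := neg_eq_iff_eq_neg
  rw [hG]
  simp only [e1]
  -- Each of the signs agrees only when its delta is nonzero.
  have a1 : i = l → superSign j.bar * superSign l.bar
      * superSign (i.bar * k.bar + i.bar * l.bar + k.bar * l.bar) = superSign j.bar := by
    rintro rfl
    simp only [← superSign_add]; congr 1
    generalize i.bar = i, j.bar = j, k.bar = k; decide +revert
  have a2 : k = j → superSign j.bar * superSign l.bar
      * superSign (i.bar * k.bar + i.bar * l.bar + k.bar * l.bar)
      = superSign ((i.bar + j.bar) * (k.bar + l.bar)) * superSign l.bar := by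
    rintro rfl
    simp only [← superSign_add]; congr 1
    generalize i.bar = i, k.bar = k, l.bar = l; decide +revert
  have a3 : i = -l → superSign j.bar * superSign l.bar
      * superSign (i.bar * k.bar + i.bar * l.bar + k.bar * l.bar) * superSign (k.bar + l.bar)
      = superSign j.bar := by
    rintro rfl
    simp only [← superSign_add, QIndex.neg_bar]; congr 1
    generalize l.bar = l, j.bar = j, k.bar = k; decide +revert
  have a4 : k = -j → superSign j.bar * superSign l.bar
      * superSign (i.bar * k.bar + i.bar * l.bar + k.bar * l.bar) * superSign (k.bar + l.bar)
      = -(superSign ((i.bar + j.bar) * (k.bar + l.bar)) * superSign l.bar) := by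
    rintro rfl
    rw [← neg_one_mul, ← superSign_one]
    simp only [← superSign_add, QIndex.neg_bar]; congr 1
    generalize l.bar = l, j.bar = j, i.bar = i; decide +revert
  generalize superSign (i.bar * k.bar + i.bar * l.bar + k.bar * l.bar) = T at *
  generalize superSign ((i.bar + j.bar) * (k.bar + l.bar)) = E at *
  generalize superSign (k.bar + l.bar) = S at *
  generalize superSign j.bar = sj at *
  generalize superSign l.bar = sl at *
  have b1 : (sj * sl * T) • (if i = l then elemG k j (r + s) else 0)
      = sj • (if i = l then elemG k j (r + s) else 0) := by
    split_ifs with c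
    · rw [a1 c]
    · rw [smul_zero, smul_zero]
  have b2 : (sj * sl * T) • (if k = j then elemG i l (r + s) else 0)
      = (E * sl) • (if k = j then elemG i l (r + s) else 0) := by
    split_ifs with c
    · rw [a2 c]
    · rw [smul_zero, smul_zero]
  have b3 : (sj * sl * T * S) • (if i = -l then elemG (-k) j (r + s) else 0)
      = sj • (if i = -l then elemG (-k) j (r + s) else 0) := by
    split_ifs with c
    · rw [a3 c]
    · rw [smul_zero, smul_zero]
  have b4 : (sj * sl * T * S) • (if k = -j then elemG (-i) l (r + s) else 0)
      = (-(E * sl)) • (if k = -j then elemG (-i) l (r + s) else 0) := by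
    split_ifs with c
    · rw [a4 c]
    · rw [smul_zero, smul_zero]
  have hi : ∀ (c : Prop) [Decidable c] (t : ℂ) (x : Gr N), (if c then t • x else 0)
      = t • (if c then x else 0) := fun c _ t x => by split_ifs <;> simp
  have hi' : ∀ (c : Prop) [Decidable c] (x : Gr N), (if c then -x else 0)
      = -(if c then x else 0) := fun c _ x => by split_ifs <;> simp
  simp only [hi, hi']
  generalize (if i = l then elemG k j (r + s) else 0) = X1 at *
  generalize (if k = j then elemG i l (r + s) else 0) = X2 at *
  generalize (if i = -l then elemG (-k) j (r + s) else 0) = X3 at *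
  generalize (if k = -j then elemG (-i) l (r + s) else 0) = X4 at *
  generalize elemG k l s * elemG i j r = P
  have : (sj * sl) • (T • (X2 - X1 - ((-1) ^ r * S) • (X4 - (-1 : ℂ) ^ (r + s + 1) • X3)) + E • P)
      = (sj * sl * T) • X2 - (sj * sl * T) • X1 - (-1 : ℂ) ^ r • ((sj * sl * T * S) • X4)
        + ((-1 : ℂ) ^ r * (-1 : ℂ) ^ (r + s + 1)) • ((sj * sl * T * S) • X3)
        + (sj * sl * E) • P := by module
  rw [this, b1, b2, b3, b4]
  rcases neg_one_pow_eq_or ℂ r with hr | hr <;> rcases neg_one_pow_eq_or ℂ s with hs | hs <;>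
    rw [pow_succ, pow_add, hr, hs] <;> module

theorem linearToGr_comm (a b : ZMod 2) (x y : twistedCurrent N)
    (hx : x ∈ LieSuperalgebra.parity a) (hy : y ∈ LieSuperalgebra.parity b) :
    linearToGr N x * linearToGr N y = superSign (a * b) • (linearToGr N y * linearToGr N x)
      + linearToGr N (LieSuperalgebra.bracket x y) := by
  have hx' := mem_span_elemF hx
  have hy' := mem_span_elemF hy
  clear hx hy
  induction hx' using Submodule.span_induction with
  | zero => simp
  | add x x' _ _ hx hx' =>
    rw [map_add, add_mul, hx, hx', map_add, LinearMap.add_apply, map_add, mul_add, smul_add]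
    abel
  | smul c x _ hx =>
    rw [map_smul, map_smul, LinearMap.smul_apply, map_smul, smul_mul_assoc, hx, mul_smul_comm,
      smul_add, smul_comm]
  | mem x hx =>
    obtain ⟨j, i, r, rfl, rfl⟩ := hx
    induction hy' using Submodule.span_induction with
    | zero => simp
    | add x x' _ _ hx hx' =>
      rw [map_add, mul_add, hx, hx', map_add, map_add, add_mul (linearToGr N x), smul_add]
      abel
    | smul c x _ hx =>
      rw [map_smul, map_smul, map_smul, mul_smul_comm, hx, smul_mul_assoc, smul_add, smul_comm]
    | mem y hy =>
      obtain ⟨l, k, s, rfl, rfl⟩ := hy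
      rw [linearToGr_comm_elemF, add_comm i.bar, add_comm k.bar]

variable (N) in
/-- The homomorphism from the enveloping algebra of `𝔤` to the graded algebra of the Yangian. -/
noncomputable def toGr : SuperEnveloping (twistedCurrent N) →ₐ[ℂ] Gr N :=
  SuperEnveloping.lift (linearToGr N) linearToGr_comm

theorem toGr_ι (x : twistedCurrent N) :
    toGr N (SuperEnveloping.ι _ x) = linearToGr N x := SuperEnveloping.lift_ι _ _ x

theorem toGr_elemF (i j : QIndex N) (s : ℕ) :
    toGr N (SuperEnveloping.ι _ (elemF j i s)) = -(superSign j.bar • elemG i j s) := by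
  rw [toGr_ι, linearToGr_elemF]

end QueerYangian

/-! ### Parity on the Yangian, surjectivity and comparison of gradations. -/

namespace QueerYangian

open twistedCurrent

variable {N : ℕ}

variable (N) in
/-- The automorphism of the Yangian which multiplies the odd elements by `-1`, as a map on the free
algebra. -/
noncomputable def freeParityMap : FreeAlgebra ℂ (Gen N) →ₐ[ℂ] QueerYangian N :=
  FreeAlgebra.lift ℂ fun x => superSign (x.i.bar + x.j.bar) • gen x

theorem freeParityMap_freeT (i j : QIndex N) (p : ℤ) :
    freeParityMap N (freeT i j p) = superSign (i.bar + j.bar) • serT i j p := by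
  match p with
  | .ofNat 0 =>
    change freeParityMap N (if i = j then 1 else 0) = superSign (i.bar + j.bar) • serT i j 0
    rw [serT_zero]
    split_ifs with h
    · rw [h, CharTwo.add_self_eq_zero, superSign_zero, one_smul, map_one]
    · rw [map_zero, smul_zero]
  | .ofNat (s + 1) => rw [freeT, freeParityMap, FreeAlgebra.lift_ι_apply]; rfl
  | .negSucc n => rw [freeT, map_zero, serT_neg _ _ (Int.negSucc_lt_zero n), smul_zero]

/-- The relations are homogeneous: every product in the quadratic one has parity
$\bar\imath+\bar\jmath+\bar k+\bar l$, since negating two indices changes nothing modulo 2. -/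
theorem freeParityMap_rel {x y : FreeAlgebra ℂ (Gen N)} (h : Rel x y) :
    freeParityMap N x = freeParityMap N y := by
  obtain ⟨i, j, k, l, p, q⟩ | ⟨i, j, m⟩ := h
  · have h := serT_quadratic i j k l p q
    have hm : ∀ (a b c d : QIndex N) (p q : ℤ), freeParityMap N (freeT a b p * freeT c d q)
        = superSign (a.bar + b.bar + (c.bar + d.bar)) • (serT a b p * serT c d q) :=
      fun a b c d p q => by
        rw [map_mul, freeParityMap_freeT, freeParityMap_freeT, smul_mul_smul_comm,
          ← superSign_add]
    simp only [freeComm, freeDiff, freeTwistedDiff, serComm, map_smul, map_sub, map_add, hm] at h ⊢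
    have a1 : k.bar + l.bar + (i.bar + j.bar) = i.bar + j.bar + (k.bar + l.bar) := by ring
    have a2 : k.bar + j.bar + (i.bar + l.bar) = i.bar + j.bar + (k.bar + l.bar) := by ring
    have a3 : (-k).bar + j.bar + ((-i).bar + l.bar) = i.bar + j.bar + (k.bar + l.bar) := by
      rw [QIndex.neg_bar, QIndex.neg_bar]
      generalize i.bar = i, j.bar = j, k.bar = k, l.bar = l; clear h hm; decide +revert
    have a4 : k.bar + (-j).bar + (i.bar + (-l).bar) = i.bar + j.bar + (k.bar + l.bar) := by
      rw [QIndex.neg_bar, QIndex.neg_bar]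
      generalize i.bar = i, j.bar = j, k.bar = k, l.bar = l; clear h hm; decide +revert
    rw [a1, a2, a3, a4]
    generalize superSign (i.bar + j.bar + (k.bar + l.bar)) = c
    have h' := congrArg (c • ·) h
    simp only [smul_sub, smul_add, smul_comm c] at h' ⊢
    exact h'
  · rw [map_smul, freeParityMap_freeT, freeParityMap_freeT, serT_symm,
      QIndex.neg_bar_add_neg_bar, smul_comm]

variable (N) in
/-- The automorphism of the Yangian which multiplies the odd elements by `-1`. -/
noncomputable def parityMap : QueerYangian N →ₐ[ℂ] QueerYangian N :=
  RingQuot.liftAlgHom ℂ ⟨freeParityMap N, fun _ _ => freeParityMap_rel⟩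

theorem parityMap_gen (x : Gen N) :
    parityMap N (gen x) = superSign (x.i.bar + x.j.bar) • gen x := by
  refine (RingQuot.liftAlgHom_mkAlgHom_apply (S := ℂ) _ _ _).trans ?_
  rw [freeParityMap, FreeAlgebra.lift_ι_apply]

instance : SetLike.GradedMonoid (parity N) := wordSpan_gradedMonoid _ _

theorem word_mem_filtration {w : List (Gen N)} {d : ℤ} (hw : (w.map fun x => (x.s : ℤ)).sum ≤ d) :
    (w.map gen).prod ∈ filtration N d := word_mem_wordSpan gen _ hw

/-- The symbol of a word of degree `d` is the product of the symbols of its letters. -/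
theorem symbol_word (w : List (Gen N)) :
    AssocGraded.symbol (filtration N) (w.map fun x => (x.s : ℤ)).sum
      ⟨(w.map gen).prod, word_mem_filtration le_rfl⟩
      = (w.map fun x => elemG x.i x.j x.s).prod := by
  induction w with
  | nil => exact AssocGraded.symbol_one
  | cons x w ih =>
    have h : ((x :: w).map fun x : Gen N => elemG x.i x.j x.s).prod
        = elemG x.i x.j x.s * (w.map fun x : Gen N => elemG x.i x.j x.s).prod := by simp
    rw [h, ← ih, elemG, AssocGraded.symbol_mul]
    exact AssocGraded.symbol_congr (by simp) (by simp)

theorem symbol_word_cases {d : ℤ} {w : List (Gen N)} (hw : (w.map fun x => (x.s : ℤ)).sum ≤ d) :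
    AssocGraded.symbol (filtration N) d ⟨(w.map gen).prod, word_mem_filtration hw⟩ = 0 ∨
    AssocGraded.symbol (filtration N) d ⟨(w.map gen).prod, word_mem_filtration hw⟩
      = (w.map fun x => elemG x.i x.j x.s).prod := by
  rcases hw.lt_or_eq with h | rfl
  · exact Or.inl (AssocGraded.symbol_eq_zero (word_mem_filtration (by omega)))
  · exact Or.inr (symbol_word w)

/-- The preimage is recorded with its parity, so that the same fact serves surjectivity and the
comparison of the gradations. -/
theorem elemG_mem_range (i j : QIndex N) (s : ℕ) :
    ∃ u ∈ SuperEnveloping.parity (twistedCurrent N) (i.bar + j.bar), toGr N u = elemG i j s := by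
  refine ⟨-(superSign j.bar • SuperEnveloping.ι _ (elemF j i s)), ?_, ?_⟩
  · refine neg_mem (Submodule.smul_mem _ _ ?_)
    refine Submodule.subset_span
      ⟨[⟨i.bar + j.bar, elemF j i s, add_comm i.bar j.bar ▸ elemF_mem_parity j i s⟩], ?_, ?_⟩ <;> simp
  · rw [map_neg, map_smul, toGr_elemF, smul_neg, neg_neg, smul_smul, superSign_mul_self, one_smul]

theorem elemG_prod_mem_range (w : List (Gen N)) :
    ∃ u ∈ SuperEnveloping.parity (twistedCurrent N) (w.map fun x => x.i.bar + x.j.bar).sum,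
      toGr N u = (w.map fun x => elemG x.i x.j x.s).prod := by
  have := (SuperEnveloping.isSuperGrading_parity (twistedCurrent N)).gradedMonoid
  induction w with
  | nil => exact ⟨1, SetLike.one_mem_graded _, map_one _⟩
  | cons x w ih =>
    obtain ⟨u, hu, hu'⟩ := ih
    obtain ⟨v, hv, hv'⟩ := elemG_mem_range x.i x.j x.s
    refine ⟨v * u, ?_, ?_⟩
    · simpa using SetLike.mul_mem_graded hv hu
    · rw [map_mul, hu', hv']; simp

theorem toGr_surjective : Function.Surjective (toGr N) := by
  intro x
  induction x using DirectSum.induction_on with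
  | zero => exact ⟨0, map_zero _⟩
  | add x y hx hy =>
    obtain ⟨u, rfl⟩ := hx
    obtain ⟨v, rfl⟩ := hy
    exact ⟨u + v, map_add _ _ _⟩
  | of d y =>
    obtain ⟨⟨y, hy⟩, rfl⟩ := GrPiece.mk_surjective d y
    change ∃ u, toGr N u = AssocGraded.symbol (filtration N) d ⟨y, hy⟩
    unfold filtration wordSpan at hy
    induction hy using Submodule.span_induction with
    | mem y h =>
      obtain ⟨w, hw, rfl⟩ := h
      rcases symbol_word_cases hw with h | h
      · exact ⟨0, (map_zero _).trans h.symm⟩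
      · obtain ⟨u, -, hu⟩ := elemG_prod_mem_range w
        exact ⟨u, hu.trans h.symm⟩
    | zero => exact ⟨0, (map_zero _).trans (map_zero _).symm⟩
    | add x y hx' hy' hx hy =>
      obtain ⟨u, hu⟩ := hx
      obtain ⟨v, hv⟩ := hy
      refine ⟨u + v, ?_⟩
      rw [map_add, hu, hv, ← map_add]
      rfl
    | smul c x hx' hx =>
      obtain ⟨u, hu⟩ := hx
      refine ⟨c • u, ?_⟩
      rw [map_smul, hu, ← map_smul]
      rfl

theorem linearToGr_mem_grParity {a : ZMod 2} {x : twistedCurrent N}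
    (hx : x ∈ LieSuperalgebra.parity (L := twistedCurrent N) a) :
    linearToGr N x ∈ grParity N a := by
  have hx' := mem_span_elemF hx
  clear hx
  induction hx' using Submodule.span_induction with
  | zero => rw [map_zero]; exact zero_mem _
  | add x y _ _ hx hy => rw [map_add]; exact add_mem hx hy
  | smul c x _ hx => rw [map_smul]; exact Submodule.smul_mem _ _ hx
  | mem x hx =>
    obtain ⟨j, i, s, rfl, rfl⟩ := hx
    rw [linearToGr_elemF]
    refine neg_mem (Submodule.smul_mem _ _ (Submodule.mem_iSup_of_mem (s : ℤ) ⟨_, ?_, rfl⟩))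
    exact Submodule.subset_span ⟨[⟨i, j, s⟩], by simp [add_comm], by simp⟩

/-- A homogeneous element of the filtration is a combination of homogeneous words. -/
theorem mem_span_homogeneous_words {a : ZMod 2} {d : ℤ} {y : QueerYangian N}
    (hd : y ∈ filtration N d) (ha : y ∈ parity N a) :
    y ∈ Submodule.span ℂ {b | ∃ w : List (Gen N), (w.map fun x => (x.s : ℤ)).sum ≤ d ∧
      (w.map fun x => x.i.bar + x.j.bar).sum = a ∧ b = (w.map gen).prod} := by
  set S := Submodule.span ℂ {b | ∃ w : List (Gen N), (w.map fun x => (x.s : ℤ)).sum ≤ d ∧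
      (w.map fun x => x.i.bar + x.j.bar).sum = a ∧ b = (w.map gen).prod}
  -- Twice the projector onto degree `a`. It sends each word to twice itself or to 0, hence respects
  -- the filtration, and it doubles `y`.
  have h : y + superSign a • parityMap N y ∈ S := by
    clear ha
    unfold filtration wordSpan at hd
    induction hd using Submodule.span_induction with
    | zero => rw [map_zero, smul_zero, add_zero]; exact zero_mem _
    | add x y _ _ hx hy =>
      rw [map_add, smul_add, add_add_add_comm]
      exact add_mem hx hy
    | smul c x _ hx =>
      rw [map_smul, smul_comm, ← smul_add]
      exact Submodule.smul_mem _ _ hx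
    | mem x hx =>
      obtain ⟨w, hw, rfl⟩ := hx
      rw [parity_map_word parityMap_gen, smul_smul, ← superSign_add]
      by_cases hb : (w.map fun x => x.i.bar + x.j.bar).sum = a
      · rw [hb, CharTwo.add_self_eq_zero, superSign_zero, one_smul]
        have hm : (w.map gen).prod ∈ S := Submodule.subset_span ⟨w, hw, hb, rfl⟩
        exact add_mem hm hm
      · have : a + (w.map fun x : Gen N => x.i.bar + x.j.bar).sum = 1 := by
          generalize (w.map fun x : Gen N => x.i.bar + x.j.bar).sum = b at hb
          revert a b; decide
        rw [this, superSign_one, neg_one_smul, add_neg_cancel]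
        exact zero_mem _
  rw [parity_map_of_mem parityMap_gen ha, smul_smul, superSign_mul_self, one_smul, ← two_smul ℂ] at h
  simpa [smul_smul] using S.smul_mem (1 / 2 : ℂ) h

/-- The inclusion from right to left needs homogeneous words of bounded filtration degree. This is
what `mem_span_homogeneous_words` provides. -/
theorem map_parity_toGr (a : ZMod 2) :
    (SuperEnveloping.parity (twistedCurrent N) a).map (toGr N).toLinearMap = grParity N a := by
  refine le_antisymm ?_ (iSup_le fun d => ?_)
  · rw [SuperEnveloping.parity, wordSpan, Submodule.map_span, Submodule.span_le]
    rintro _ ⟨_, ⟨w, rfl, rfl⟩, rfl⟩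
    change toGr N _ ∈ grParity N _
    induction w with
    | nil =>
      change toGr N 1 ∈ grParity N 0
      rw [map_one]
      exact AssocGraded.one_mem_parity
    | cons x w ih =>
      change toGr N (SuperEnveloping.ι _ (x.2 : twistedCurrent N) * _) ∈ grParity N (x.1 + _)
      rw [map_mul, toGr_ι]
      exact AssocGraded.parity_mul_mem (linearToGr_mem_grParity x.2.2) ih
  · rintro _ ⟨⟨y, hy⟩, hya, rfl⟩
    have hs := mem_span_homogeneous_words hy hya
    clear hya
    have : ∀ hy : y ∈ filtration N d, AssocGraded.symbol (filtration N) d ⟨y, hy⟩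
        ∈ (SuperEnveloping.parity (twistedCurrent N) a).map (toGr N).toLinearMap := by
      clear hy
      have hle : Submodule.span ℂ {b | ∃ w : List (Gen N), (w.map fun x => (x.s : ℤ)).sum ≤ d ∧
          (w.map fun x => x.i.bar + x.j.bar).sum = a ∧ b = (w.map gen).prod} ≤ filtration N d :=
        Submodule.span_mono fun b ⟨w, hw, _, hb⟩ => ⟨w, hw, hb⟩
      induction hs using Submodule.span_induction with
      | zero =>
        intro hy
        rw [AssocGraded.symbol_eq_zero (zero_mem _)]
        exact zero_mem _
      | add x y hx' hy' hx hy =>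
        intro _
        have h := add_mem (hx (hle hx')) (hy (hle hy'))
        rwa [← map_add] at h
      | smul c x hx' hx =>
        intro _
        have h := Submodule.smul_mem _ c (hx (hle hx'))
        rwa [← map_smul] at h
      | mem x hx =>
        intro _
        obtain ⟨w, hw, rfl, rfl⟩ := hx
        rcases symbol_word_cases hw with h | h
        · rw [h]; exact zero_mem _
        · rw [h]
          obtain ⟨u, hu, hu'⟩ := elemG_prod_mem_range w
          exact ⟨u, hu, hu'⟩
    exact this hy

end QueerYangian

/-! ### Filtration of the enveloping algebra by the length of words. -/

namespace SuperEnveloping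

section WordFiltration

variable {L : Type*} [AddCommGroup L] [Module ℂ L] [LieSuperalgebra L]

variable (L) in
/-- The span of the products of less than `m` elements of a Lie superalgebra. -/
def wordFiltration : ℕ → Submodule ℂ (SuperEnveloping L)
  -- The index is the length plus one. The zero space at index 0 keeps the truncated subtraction `m
  -- - 1` meaningful below.
  | 0 => ⊥
  | m + 1 => (1 ⊔ LinearMap.range (ι L)) ^ m

theorem wordFiltration_one_mem : (1 : SuperEnveloping L) ∈ wordFiltration L 1 := by
  rw [wordFiltration, pow_zero]
  exact Submodule.one_le.1 le_rfl

theorem wordFiltration_le_succ (m : ℕ) : wordFiltration L m ≤ wordFiltration L (m + 1) := by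
  cases m with
  | zero => exact bot_le
  | succ m =>
    simp only [wordFiltration, pow_succ]
    intro u hu
    rw [← mul_one u]
    exact Submodule.mul_mem_mul hu (Submodule.mem_sup_left (Submodule.one_le.1 le_rfl))

theorem wordFiltration_mono : Monotone (wordFiltration L) :=
  monotone_nat_of_le_succ wordFiltration_le_succ

theorem mul_ι_mem {m : ℕ} {u : SuperEnveloping L} (hu : u ∈ wordFiltration L m) (x : L) :
    u * ι L x ∈ wordFiltration L (m + 1) := by
  cases m with
  | zero =>
    rw [(Submodule.mem_bot ℂ).1 hu, zero_mul]
    exact zero_mem _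
  | succ m =>
    simp only [wordFiltration, pow_succ] at hu ⊢
    exact Submodule.mul_mem_mul hu (Submodule.mem_sup_right ⟨x, rfl⟩)

theorem mul_ι_mem_of_pred {m : ℕ} {u : SuperEnveloping L} (hu : u ∈ wordFiltration L (m - 1))
    (x : L) : u * ι L x ∈ wordFiltration L m := by
  cases m with
  | zero =>
    rw [(Submodule.mem_bot ℂ).1 hu, zero_mul]
    exact zero_mem _
  | succ m => exact mul_ι_mem hu x

theorem exists_mem_wordFiltration (u : SuperEnveloping L) : ∃ m, u ∈ wordFiltration L (m + 1) := by
  have hu : u ∈ Algebra.adjoin ℂ (Set.range (ι L)) := by rw [adjoin_range_ι]; trivial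
  induction hu using Algebra.adjoin_induction with
  | mem x hx =>
    obtain ⟨x, rfl⟩ := hx
    refine ⟨1, ?_⟩
    simp only [wordFiltration, pow_one]
    exact Submodule.mem_sup_right ⟨x, rfl⟩
  | algebraMap c =>
    refine ⟨0, ?_⟩
    rw [Algebra.algebraMap_eq_smul_one]
    exact Submodule.smul_mem _ _ wordFiltration_one_mem
  | add x y _ _ hx hy =>
    obtain ⟨m, hm⟩ := hx
    obtain ⟨n, hn⟩ := hy
    exact ⟨max m n, add_mem (wordFiltration_mono (by simp) hm) (wordFiltration_mono (by simp) hn)⟩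
  | mul x y _ _ hx hy =>
    obtain ⟨m, hm⟩ := hx
    obtain ⟨n, hn⟩ := hy
    refine ⟨m + n, ?_⟩
    simp only [wordFiltration, pow_add] at hm hn ⊢
    exact Submodule.mul_mem_mul hm hn

/-- Induction on the length of words in homogeneous elements. -/
theorem wordFiltration_induction {P : ℕ → SuperEnveloping L → Prop}
    (one : P 0 1) (mono : ∀ m u, u ∈ wordFiltration L (m + 1) → P m u → P (m + 1) u)
    (mul : ∀ m u a x, u ∈ wordFiltration L (m + 1) → P m u → x ∈ LieSuperalgebra.parity (L := L) a →
      P (m + 1) (u * ι L x))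
    (add : ∀ m u v, P m u → P m v → P m (u + v)) (smul : ∀ m (c : ℂ) u, P m u → P m (c • u)) :
    ∀ m u, u ∈ wordFiltration L (m + 1) → P m u := by
  intro m
  induction m with
  | zero =>
    intro u hu
    rw [wordFiltration, pow_zero, Submodule.mem_one] at hu
    obtain ⟨c, rfl⟩ := hu
    rw [Algebra.algebraMap_eq_smul_one]
    exact smul 0 c 1 one
  | succ m ih =>
    intro u hu
    rw [wordFiltration, pow_succ] at hu
    induction hu using Submodule.mul_induction_on' with
    | mem_mul_mem v hv w hw =>
      obtain ⟨y, hy, z, ⟨x, rfl⟩, rfl⟩ := Submodule.mem_sup.1 hw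
      obtain ⟨c, rfl⟩ := Submodule.mem_one.1 hy
      obtain ⟨x0, h0, x1, h1, rfl⟩ := exists_homogeneous_add x
      rw [mul_add, map_add, mul_add, Algebra.algebraMap_eq_smul_one, mul_smul_comm, mul_one]
      exact add _ _ _ (smul _ _ _ (mono _ _ hv (ih _ hv)))
        (add _ _ _ (mul _ _ _ _ hv (ih _ hv) h0) (mul _ _ _ _ hv (ih _ hv) h1))
    | add x _ y _ hx hy => exact add _ _ _ hx hy

end WordFiltration

end SuperEnveloping

/-! ### Injectivity on longer words by means of the coproduct. -/

/-- The power `σ ^ a` with an exponent in `ℤ/2`. -/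
def signPow {D : Type*} [Monoid D] (σ : D) (a : ZMod 2) : D := σ ^ a.val

section SignPow

variable {D : Type*} [Ring D] {σ : D}

theorem signPow_zero (σ : D) : signPow σ 0 = 1 := pow_zero σ

theorem signPow_one (σ : D) : signPow σ 1 = σ := pow_one σ

theorem signPow_mul (hσ : σ * σ = 1) (a b : ZMod 2) :
    signPow σ a * signPow σ b = signPow σ (a + b) := by
  have e : (1 + 1 : ZMod 2) = 0 := rfl
  rcases ZMod.two_cases a with rfl | rfl <;> rcases ZMod.two_cases b with rfl | rfl <;>
    simp [signPow_zero, signPow_one, e, hσ]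

theorem signPow_mul_self (hσ : σ * σ = 1) (a : ZMod 2) : signPow σ a * signPow σ a = 1 := by
  rw [signPow_mul hσ, CharTwo.add_self_eq_zero, signPow_zero]

theorem signPow_mul_of_supercommute [Algebra ℂ D] {b : ZMod 2} {d : D}
    (h : σ * d = superSign b • (d * σ)) (a : ZMod 2) :
    signPow σ a * d = superSign (a * b) • (d * signPow σ a) := by
  rcases ZMod.two_cases a with rfl | rfl
  · rw [signPow_zero, zero_mul, superSign_zero, one_smul, one_mul, mul_one]
  · rw [signPow_one, one_mul, h]

end SignPow

namespace SuperEnveloping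

/-- An algebra homomorphism `θ'` to `D ⊗ E`, the coproduct of a homomorphism `θ` to `D` and a
representation `j` in `E`; the odd elements of `E` anticommute with those of `D` by means of the
parity operator `σ`. -/
structure CoproductData (L : Type*) [AddCommGroup L] [Module ℂ L] [LieSuperalgebra L]
    {D E : Type*} [Ring D] [Algebra ℂ D] [Ring E] [Algebra ℂ E]
    (θ : SuperEnveloping L →ₐ[ℂ] D) (θ' : SuperEnveloping L →ₐ[ℂ] D ⊗[ℂ] E) where
  σ : D
  σ_sq : σ * σ = 1
  σ_mul : ∀ {a : ZMod 2} {x : L}, x ∈ LieSuperalgebra.parity a →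
    σ * θ (ι L x) = superSign a • (θ (ι L x) * σ)
  grading : ZMod 2 → Submodule ℂ E
  graded : SetLike.GradedMonoid grading
  proj : ZMod 2 → E →ₗ[ℂ] E
  proj_of_mem : ∀ {a : ZMod 2} {e : E}, e ∈ grading a → ∀ b, proj b e = if a = b then e else 0
  j : L →ₗ[ℂ] E
  j_mem : ∀ {a : ZMod 2} {x : L}, x ∈ LieSuperalgebra.parity a → j x ∈ grading a
  retract : E →ₗ[ℂ] L
  retract_j : ∀ x, retract (j x) = x
  retract_one : retract 1 = 0
  counit : E →ₐ[ℂ] ℂ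
  counit_j : ∀ x, counit (j x) = 0
  map_ι : ∀ {a : ZMod 2} {x : L}, x ∈ LieSuperalgebra.parity a →
    θ' (ι L x) = θ (ι L x) ⊗ₜ[ℂ] 1 + signPow σ a ⊗ₜ[ℂ] j x

namespace CoproductData

variable {L : Type*} [AddCommGroup L] [Module ℂ L] [LieSuperalgebra L]
  {D E : Type*} [Ring D] [Algebra ℂ D] [Ring E] [Algebra ℂ E]
  {θ : SuperEnveloping L →ₐ[ℂ] D} {θ' : SuperEnveloping L →ₐ[ℂ] D ⊗[ℂ] E}

/-- The counit kills the letters in the second factor, so applying it recovers `θ` from `θ'`. -/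
theorem counit_comp (S : CoproductData L θ θ') (u : SuperEnveloping L) :
    Algebra.TensorProduct.lift (AlgHom.id ℂ D) ((Algebra.ofId ℂ D).comp S.counit)
      (fun d e => by
        rw [AlgHom.comp_apply, Algebra.ofId_apply]
        exact Algebra.commute_algebraMap_right _ _) (θ' u) = θ u := by
  have hu : u ∈ Algebra.adjoin ℂ (Set.range fun x : Σ b : ZMod 2,
    (LieSuperalgebra.parity b : Submodule ℂ L) => ι L x.2) := by rw [adjoin_homogeneous]; trivial
  induction hu using Algebra.adjoin_induction with
  | mem x hx =>
    obtain ⟨x, rfl⟩ := hx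
    change Algebra.TensorProduct.lift _ _ _ (θ' (ι L (x.2 : L))) = _
    rw [S.map_ι x.2.2, map_add, Algebra.TensorProduct.lift_tmul, Algebra.TensorProduct.lift_tmul,
      map_one, mul_one, AlgHom.comp_apply, S.counit_j, map_zero, mul_zero, add_zero]
    rfl
  | algebraMap c => rw [AlgHom.commutes, AlgHom.commutes, AlgHom.commutes]
  | add x y _ _ hx hy => rw [map_add, map_add, hx, hy, map_add]
  | mul x y _ _ hx hy => rw [map_mul, map_mul, hx, hy, map_mul]

theorem eq_zero_of_map_eq_zero (S : CoproductData L θ θ') {u : SuperEnveloping L}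
    (h : θ' u = 0) : θ u = 0 := by
  rw [← S.counit_comp u, h, map_zero]

/-- The span of the tensors `θ(v) σᵃ ⊗ e` for `v` of length less than `k` and `e` of degree `a`. -/
def lower (S : CoproductData L θ θ') (k : ℕ) : Submodule ℂ (D ⊗[ℂ] E) :=
  Submodule.span ℂ {t | ∃ v ∈ wordFiltration L k, ∃ a, ∃ e ∈ S.grading a,
    t = (θ v * signPow S.σ a) ⊗ₜ[ℂ] e}

/-- The span of the pairs `(v x, θ(v) σᵃ ⊗ x)` for `v` of length less than `k` and `x` of
degree `a`. -/
def leading (S : CoproductData L θ θ') (k : ℕ) : Submodule ℂ (SuperEnveloping L × (D ⊗[ℂ] E)) :=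
  Submodule.span ℂ {t | ∃ v ∈ wordFiltration L k, ∃ a, ∃ x ∈ LieSuperalgebra.parity (L := L) a,
    t = (v * ι L x, (θ v * signPow S.σ a) ⊗ₜ[ℂ] S.j x)}

variable {S : CoproductData L θ θ'}

theorem lower_mono {k l : ℕ} (h : k ≤ l) : S.lower k ≤ S.lower l :=
  Submodule.span_mono fun _ ⟨v, hv, r⟩ => ⟨v, wordFiltration_mono h hv, r⟩

theorem leading_mono {k l : ℕ} (h : k ≤ l) : S.leading k ≤ S.leading l :=
  Submodule.span_mono fun _ ⟨v, hv, r⟩ => ⟨v, wordFiltration_mono h hv, r⟩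

theorem signPow_mul_map {b : ZMod 2} {x : L} (hx : x ∈ LieSuperalgebra.parity (L := L) b)
    (v : SuperEnveloping L) (a : ZMod 2) : θ v * signPow S.σ a * θ (ι L x)
      = superSign (a * b) • (θ (v * ι L x) * signPow S.σ a) := by
  rw [mul_assoc, signPow_mul_of_supercommute (S.σ_mul hx), mul_smul_comm, map_mul, mul_assoc]

theorem lower_mul_left {k l : ℕ} {b : ZMod 2} {x : L} (hx : x ∈ LieSuperalgebra.parity (L := L) b)
    (hkl : ∀ v ∈ wordFiltration L k, v * ι L x ∈ wordFiltration L l) {t : D ⊗[ℂ] E}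
    (ht : t ∈ S.lower k) : t * θ (ι L x) ⊗ₜ[ℂ] 1 ∈ S.lower l := by
  induction ht using Submodule.span_induction with
  | zero => rw [zero_mul]; exact zero_mem _
  | add t t' _ _ ht ht' => rw [add_mul]; exact add_mem ht ht'
  | smul c t _ ht => rw [smul_mul_assoc]; exact Submodule.smul_mem _ _ ht
  | mem t h =>
    obtain ⟨v, hv, a, e, he, rfl⟩ := h
    rw [Algebra.TensorProduct.tmul_mul_tmul, mul_one, signPow_mul_map hx, ← TensorProduct.smul_tmul']
    exact Submodule.smul_mem _ _ (Submodule.subset_span ⟨_, hkl v hv, a, e, he, rfl⟩)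

theorem lower_mul_right {k : ℕ} {b : ZMod 2} {x : L} (hx : x ∈ LieSuperalgebra.parity (L := L) b)
    {t : D ⊗[ℂ] E} (ht : t ∈ S.lower k) : t * signPow S.σ b ⊗ₜ[ℂ] S.j x ∈ S.lower k := by
  have := S.graded
  induction ht using Submodule.span_induction with
  | zero => rw [zero_mul]; exact zero_mem _
  | add t t' _ _ ht ht' => rw [add_mul]; exact add_mem ht ht'
  | smul c t _ ht => rw [smul_mul_assoc]; exact Submodule.smul_mem _ _ ht
  | mem t h =>
    obtain ⟨v, hv, a, e, he, rfl⟩ := h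
    rw [Algebra.TensorProduct.tmul_mul_tmul, mul_assoc, signPow_mul S.σ_sq]
    exact Submodule.subset_span ⟨v, hv, a + b, _, SetLike.mul_mem_graded he (S.j_mem hx), rfl⟩

theorem leading_snd_mem {k : ℕ} {p : SuperEnveloping L × (D ⊗[ℂ] E)} (hp : p ∈ S.leading k) :
    p.2 ∈ S.lower k := by
  induction hp using Submodule.span_induction with
  | zero => exact zero_mem _
  | add t t' _ _ ht ht' => exact add_mem ht ht'
  | smul c t _ ht => exact Submodule.smul_mem _ _ ht
  | mem t h =>
    obtain ⟨v, hv, a, x, hx, rfl⟩ := h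
    exact Submodule.subset_span ⟨v, hv, a, _, S.j_mem hx, rfl⟩

/-- Multiplying on the right by $\theta(x)\otimes1$ inserts `x` before the letter in the second
factor. Moving `x` back to the end of the word costs a sign, absorbed in the witness, and a bracket,
which makes the word shorter. -/
theorem leading_mul {k : ℕ} {b : ZMod 2} {x : L} (hx : x ∈ LieSuperalgebra.parity (L := L) b)
    {p : SuperEnveloping L × (D ⊗[ℂ] E)} (hp : p ∈ S.leading k) :
    ∃ q ∈ S.leading (k + 1), q.2 = p.2 * θ (ι L x) ⊗ₜ[ℂ] 1 ∧
      q.1 - p.1 * ι L x ∈ wordFiltration L (k + 1) := by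
  induction hp using Submodule.span_induction with
  | zero => exact ⟨0, zero_mem _, by simp, by simp⟩
  | add p p' _ _ hp hp' =>
    obtain ⟨q, hq, h1, h2⟩ := hp
    obtain ⟨q', hq', h1', h2'⟩ := hp'
    refine ⟨q + q', add_mem hq hq', ?_, ?_⟩
    · rw [Prod.snd_add, Prod.snd_add, add_mul, h1, h1']
    · rw [Prod.fst_add, Prod.fst_add, add_mul, add_sub_add_comm]
      exact add_mem h2 h2'
  | smul c p _ hp =>
    obtain ⟨q, hq, h1, h2⟩ := hp
    refine ⟨c • q, Submodule.smul_mem _ _ hq, ?_, ?_⟩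
    · rw [Prod.smul_snd, Prod.smul_snd, smul_mul_assoc, h1]
    · rw [Prod.smul_fst, Prod.smul_fst, smul_mul_assoc, ← smul_sub]
      exact Submodule.smul_mem _ _ h2
  | mem t h =>
    obtain ⟨v, hv, a, y, hy, rfl⟩ := h
    refine ⟨superSign (a * b) • (v * ι L x * ι L y,
      (θ (v * ι L x) * signPow S.σ a) ⊗ₜ[ℂ] S.j y),
      Submodule.smul_mem _ _ (Submodule.subset_span ⟨_, mul_ι_mem hv x, a, y, hy, rfl⟩), ?_, ?_⟩
    · rw [Prod.smul_snd, Algebra.TensorProduct.tmul_mul_tmul, mul_one, signPow_mul_map hx,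
        ← TensorProduct.smul_tmul']
    · rw [Prod.smul_fst, mul_assoc, mul_assoc, ι_mul_ι hy hx, mul_add, mul_smul_comm,
        sub_add_cancel_left]
      exact neg_mem (mul_ι_mem hv _)

/-- For a word $x_1\cdots x_m$, expand the product of the $\theta(x_i)\otimes1+\sigma^{a_i}\otimes
x_i$. No letter in the second factor gives $\theta(u)\otimes1$, and two or more give `lower`.
Exactly one gives `m` terms, each of which multiplies back to `u` modulo shorter words. The pairs in
`leading` remember this product even though `θ` may not be injective. -/
theorem exists_leading (S : CoproductData L θ θ') (m : ℕ) (u : SuperEnveloping L)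
    (hu : u ∈ wordFiltration L (m + 1)) :
    ∃ p ∈ S.leading m, ∃ t ∈ S.lower (m - 1), θ' u = θ u ⊗ₜ[ℂ] 1 + p.2 + t ∧
      p.1 - (m : ℂ) • u ∈ wordFiltration L m := by
  revert m u
  refine wordFiltration_induction ?_ ?_ ?_ ?_ ?_
  · refine ⟨0, zero_mem _, 0, zero_mem _, ?_, ?_⟩
    · rw [map_one, map_one, Prod.snd_zero, add_zero, add_zero]; rfl
    · simp
  · rintro m u hu ⟨p, hp, t, ht, h1, h2⟩
    refine ⟨p, leading_mono (Nat.le_succ m) hp, t, lower_mono (by simp) ht, h1, ?_⟩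
    rw [Nat.cast_succ, add_smul, one_smul, ← sub_sub]
    exact sub_mem (wordFiltration_le_succ m h2) hu
  · rintro m u b x hu ⟨p, hp, t, ht, h1, h2⟩ hx
    obtain ⟨q, hq, hq2, hq1⟩ := leading_mul hx hp
    -- The new pair is the term in which `x` is the only letter in the second factor. Terms of `p.2`
    -- multiplied by a second such letter pass to `lower`.
    refine ⟨q + (u * ι L x, (θ u * signPow S.σ b) ⊗ₜ[ℂ] S.j x),
      add_mem hq (Submodule.subset_span ⟨u, hu, b, x, hx, rfl⟩),
      t * θ (ι L x) ⊗ₜ[ℂ] 1 + (p.2 * signPow S.σ b ⊗ₜ[ℂ] S.j x + t * signPow S.σ b ⊗ₜ[ℂ] S.j x),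
      add_mem (lower_mul_left hx (fun v hv => mul_ι_mem_of_pred hv x) ht)
        (add_mem (lower_mul_right hx (leading_snd_mem hp))
          (lower_mono (by simp) (lower_mul_right hx ht))), ?_, ?_⟩
    · rw [map_mul, h1, S.map_ι hx, Prod.snd_add, hq2, mul_add, add_mul, add_mul, add_mul, add_mul,
        Algebra.TensorProduct.tmul_mul_tmul, Algebra.TensorProduct.tmul_mul_tmul, map_mul, one_mul,
        one_mul]
      abel
    · have e : q.1 + u * ι L x - ((m + 1 : ℕ) : ℂ) • (u * ι L x)
          = (q.1 - p.1 * ι L x) + (p.1 - (m : ℂ) • u) * ι L x := by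
        rw [Nat.cast_succ, sub_mul, smul_mul_assoc]
        module
      rw [Prod.fst_add, e]
      exact add_mem hq1 (mul_ι_mem h2 x)
  · rintro m u u' ⟨p, hp, t, ht, h1, h2⟩ ⟨p', hp', t', ht', h1', h2'⟩
    refine ⟨p + p', add_mem hp hp', t + t', add_mem ht ht', ?_, ?_⟩
    · rw [map_add, h1, h1', map_add, TensorProduct.add_tmul, Prod.snd_add]
      abel
    · rw [Prod.fst_add, smul_add, add_sub_add_comm]
      exact add_mem h2 h2'
  · rintro m c u ⟨p, hp, t, ht, h1, h2⟩
    refine ⟨c • p, Submodule.smul_mem _ _ hp, c • t, Submodule.smul_mem _ _ ht, ?_, ?_⟩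
    · rw [map_smul, h1, map_smul, ← TensorProduct.smul_tmul', Prod.smul_snd, smul_add, smul_add]
    · rw [Prod.smul_fst, smul_comm, ← smul_sub]
      exact Submodule.smul_mem _ _ h2

/-- If `θ` is injective on the words of length less than `m`, then `θ'` is injective on the words of
length at most `m`. -/
theorem injective_succ (S : CoproductData L θ θ') {m : ℕ} (hm : m ≠ 0)
    (h : ∀ u ∈ wordFiltration L m, θ u = 0 → u = 0) :
    ∀ u ∈ wordFiltration L (m + 1), θ' u = 0 → u = 0 := by
  intro u hu hu0
  have := S.graded
  -- A linear left inverse of `θ` on the shorter words, which exists over a field and need not be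
  -- multiplicative.
  obtain ⟨Λ, hΛ⟩ : ∃ Λ : D →ₗ[ℂ] SuperEnveloping L, ∀ v ∈ wordFiltration L m, Λ (θ v) = v := by
    have hk : LinearMap.ker (θ.toLinearMap ∘ₗ (wordFiltration L m).subtype) = ⊥ := by
      rw [LinearMap.ker_eq_bot']
      exact fun v hv => Subtype.ext (h v v.2 hv)
    obtain ⟨g, hg⟩ := LinearMap.exists_leftInverse_of_injective _ hk
    refine ⟨(wordFiltration L m).subtype ∘ₗ g, fun v hv => ?_⟩
    exact congrArg Subtype.val (LinearMap.congr_fun hg ⟨v, hv⟩)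
  -- `Ψ` projects the second factor to `L`, removes $\sigma^a$ and multiplies the two factors back
  -- together in the enveloping algebra.
  let Ψ : D ⊗[ℂ] E →ₗ[ℂ] SuperEnveloping L := ∑ a : ZMod 2,
    TensorProduct.lift ((LinearMap.mul ℂ (SuperEnveloping L)).compl₁₂
      (Λ ∘ₗ LinearMap.mulRight ℂ (signPow S.σ a)) (ι L ∘ₗ S.retract ∘ₗ S.proj a))
  have hΨ : ∀ {v : SuperEnveloping L} {a : ZMod 2} {e : E}, v ∈ wordFiltration L m →
      e ∈ S.grading a → Ψ ((θ v * signPow S.σ a) ⊗ₜ[ℂ] e) = v * ι L (S.retract e) := by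
    intro v a e hv he
    simp only [Ψ, LinearMap.sum_apply, TensorProduct.lift.tmul, LinearMap.compl₁₂_apply,
      LinearMap.comp_apply, LinearMap.mulRight_apply, LinearMap.mul_apply', S.proj_of_mem he]
    rw [Finset.sum_eq_single a]
    · rw [if_pos rfl, mul_assoc, signPow_mul_self S.σ_sq, mul_one, hΛ v hv]
    · intro b _ hb
      rw [if_neg (Ne.symm hb), map_zero, map_zero, mul_zero]
    · simp
  -- The summand $\theta(u)\otimes1$ must disappear, since `Λ` is not controlled on the image of
  -- words of length `m`.
  have hΨ0 : ∀ d : D, Ψ (d ⊗ₜ[ℂ] 1) = 0 := by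
    intro d
    have h1 : (1 : E) ∈ S.grading 0 := SetLike.one_mem_graded _
    simp only [Ψ, LinearMap.sum_apply, TensorProduct.lift.tmul, LinearMap.compl₁₂_apply,
      LinearMap.comp_apply, LinearMap.mul_apply', S.proj_of_mem h1]
    refine Finset.sum_eq_zero fun a _ => ?_
    split_ifs
    · rw [S.retract_one, map_zero, mul_zero]
    · rw [map_zero, map_zero, mul_zero]
  obtain ⟨p, hp, t, ht, h1, h2⟩ := S.exists_leading m u hu
  have hΨp : Ψ p.2 = p.1 := by
    clear h1 h2
    induction hp using Submodule.span_induction with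
    | zero => exact map_zero _
    | add x y _ _ hx hy => rw [Prod.snd_add, map_add, hx, hy, Prod.fst_add]
    | smul c x _ hx => rw [Prod.smul_snd, map_smul, hx, Prod.smul_fst]
    | mem x hx =>
      obtain ⟨v, hv, a, x, hx, rfl⟩ := hx
      rw [hΨ hv (S.j_mem hx), S.retract_j]
  have hΨt : Ψ t ∈ wordFiltration L m := by
    clear h1
    induction ht using Submodule.span_induction with
    | zero => rw [map_zero]; exact zero_mem _
    | add x y _ _ hx hy => rw [map_add]; exact add_mem hx hy
    | smul c x _ hx => rw [map_smul]; exact Submodule.smul_mem _ _ hx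
    | mem x hx =>
      obtain ⟨v, hv, a, e, he, rfl⟩ := hx
      rw [hΨ (wordFiltration_mono (Nat.sub_le m 1) hv) he]
      exact mul_ι_mem_of_pred hv _
  have h3 : p.1 + Ψ t = 0 := by
    have := congrArg Ψ h1
    rw [hu0, map_zero, map_add, map_add, hΨ0, hΨp, zero_add] at this
    exact this.symm
  -- Applying `Ψ` to $\theta'(u)=0$ shows that $mu$ is a combination of shorter words.
  -- Characteristic zero then allows division by `m`.
  have h4 : (m : ℂ) • u ∈ wordFiltration L m := by
    have e : (m : ℂ) • u = -(p.1 - (m : ℂ) • u) - Ψ t := by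
      rw [eq_neg_of_add_eq_zero_left h3]; abel
    rw [e]
    exact sub_mem (neg_mem h2) hΨt
  have hm' : (m : ℂ) ≠ 0 := Nat.cast_ne_zero.2 hm
  have h5 : u ∈ wordFiltration L m := by
    have := Submodule.smul_mem (wordFiltration L m) (m : ℂ)⁻¹ h4
    rwa [smul_smul, inv_mul_cancel₀ hm', one_smul] at this
  exact h u h5 (S.eq_zero_of_map_eq_zero hu0)

end CoproductData

end SuperEnveloping

/-! ### Highest coefficients of filtered representations. -/

namespace QueerYangian

section Leading

variable {N : ℕ} {D : Type*} [Ring D] [Algebra ℂ D] {ρ : QueerYangian N →ₐ[ℂ] D[X]}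

theorem coeff_eq_zero_of_mem_filtration (hρ : ∀ x : Gen N, (ρ (gen x)).natDegree ≤ x.s) {d : ℤ}
    {y : QueerYangian N} (hy : y ∈ filtration N d) {n : ℕ} (hn : d < n) : (ρ y).coeff n = 0 := by
  unfold filtration wordSpan at hy
  induction hy using Submodule.span_induction with
  | zero => rw [map_zero, Polynomial.coeff_zero]
  | add x y _ _ hx hy => rw [map_add, Polynomial.coeff_add, hx, hy, add_zero]
  | smul c x _ hx => rw [map_smul, Polynomial.coeff_smul, hx, smul_zero]
  | mem x hx =>
    obtain ⟨w, hw, rfl⟩ := hx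
    have key : ∀ w : List (Gen N),
        ((ρ (w.map gen).prod).natDegree : ℤ) ≤ (w.map fun x => (x.s : ℤ)).sum := by
      intro w
      induction w with
      | nil =>
        rw [List.map_nil, List.prod_nil, map_one, Polynomial.natDegree_one]
        simp
      | cons x w ih =>
        rw [List.map_cons, List.prod_cons, map_mul, List.map_cons, List.sum_cons]
        have h1 := Polynomial.natDegree_mul_le (p := ρ (gen x)) (q := ρ (w.map gen).prod)
        have h2 := hρ x
        omega
    refine Polynomial.coeff_eq_zero_of_natDegree_lt ?_
    have := key w
    omega

theorem map_eq_zero_of_mem_filtration (hρ : ∀ x : Gen N, (ρ (gen x)).natDegree ≤ x.s) {d : ℤ}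
    {y : QueerYangian N} (hy : y ∈ filtration N d) (hd : d < 0) : ρ y = 0 := by
  ext n
  exact coeff_eq_zero_of_mem_filtration hρ hy (by omega)

/-- The class of `y ∈ F d` goes to the coefficient at `X ^ d` of the image of `y`. -/
noncomputable def leadPiece (hρ : ∀ x : Gen N, (ρ (gen x)).natDegree ≤ x.s) (d : ℤ) :
    GrPiece (filtration N) d →ₗ[ℂ] D :=
  Submodule.liftQ _
    ((Polynomial.lcoeff D d.toNat).restrictScalars ℂ ∘ₗ ρ.toLinearMap ∘ₗ (filtration N d).subtype)
    (by
      intro y hy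
      exact coeff_eq_zero_of_mem_filtration hρ (d := d - 1) hy (by omega))

theorem leadPiece_mk (hρ : ∀ x : Gen N, (ρ (gen x)).natDegree ≤ x.s) {d : ℤ} (y : filtration N d) :
    leadPiece hρ d (GrPiece.mk _ d y) = (ρ y).coeff d.toNat := rfl

/-- The homomorphism of the graded algebra which takes the class of `y ∈ F d` to the coefficient at
`X ^ d` of the image of `y` under a filtered homomorphism to polynomials. -/
noncomputable def lead (hρ : ∀ x : Gen N, (ρ (gen x)).natDegree ≤ x.s) : Gr N →ₐ[ℂ] D :=
  DirectSum.toAlgebra ℂ (GrPiece (filtration N)) (leadPiece hρ)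
    (by
      change (ρ 1).coeff 0 = 1
      rw [map_one, Polynomial.coeff_one_zero])
    (by
      intro d e x y
      obtain ⟨x, rfl⟩ := GrPiece.mk_surjective d x
      obtain ⟨y, rfl⟩ := GrPiece.mk_surjective e y
      change (ρ ((x : QueerYangian N) * y)).coeff (d + e).toNat
        = (ρ x).coeff d.toNat * (ρ y).coeff e.toNat
      rw [map_mul]
      -- In negative degrees `toNat` gives the wrong index 0, but there the image vanishes and both
      -- sides are 0.
      rcases lt_or_ge d 0 with hd | hd
      · rw [map_eq_zero_of_mem_filtration hρ x.2 hd, zero_mul, Polynomial.coeff_zero,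
          Polynomial.coeff_zero, zero_mul]
      rcases lt_or_ge e 0 with he | he
      · rw [map_eq_zero_of_mem_filtration hρ y.2 he, mul_zero, Polynomial.coeff_zero,
          Polynomial.coeff_zero, mul_zero]
      rw [Int.toNat_add hd he]
      refine Polynomial.coeff_mul_add_eq_of_natDegree_le ?_ ?_ <;>
        refine Polynomial.natDegree_le_iff_coeff_eq_zero.2 fun n hn => ?_
      · exact coeff_eq_zero_of_mem_filtration hρ x.2 (by omega)
      · exact coeff_eq_zero_of_mem_filtration hρ y.2 (by omega))

theorem lead_symbol (hρ : ∀ x : Gen N, (ρ (gen x)).natDegree ≤ x.s) {d : ℤ} (y : filtration N d) :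
    lead hρ (AssocGraded.symbol (filtration N) d y) = (ρ y).coeff d.toNat := by
  rw [AssocGraded.symbol, LinearMap.comp_apply, DirectSum.lof_eq_of, lead]
  rw [DirectSum.toAlgebra_apply]
  refine Eq.trans ?_ (leadPiece_mk hρ y)
  exact DirectSum.toAddMonoid_of (fun i => (leadPiece hρ i).toAddMonoidHom) d _

end Leading

end QueerYangian

/-! ### Representations of the Yangian by polynomials. -/

open QueerYangian in
theorem IsYangianSeries.map {N : ℕ} {R R' : Type*} [Ring R] [Algebra ℂ R] [Ring R'] [Algebra ℂ R']
    {t : QIndex N → QIndex N → PowerSeries R} (ht : IsYangianSeries t) (f : R →ₐ[ℂ] R') :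
    IsYangianSeries fun i j => PowerSeries.mapAlgHom f (t i j) where
  coeff_zero i j := by
    rw [PowerSeries.mapAlgHom_apply, PowerSeries.coeff_map, ht.coeff_zero]
    split_ifs
    · exact map_one _
    · exact map_zero _
  symm i j m := by
    rw [PowerSeries.mapAlgHom_apply, PowerSeries.mapAlgHom_apply, PowerSeries.coeff_map,
      PowerSeries.coeff_map, ht.symm]
    exact map_smul f _ _
  quadratic := by
    intro i j k l
    have hw : PowerSeries.mapAlgHom (PowerSeries.mapAlgHom f) (varW R) = varW R' := by
      rw [PowerSeries.mapAlgHom_apply, varW, PowerSeries.map_X, varW]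
    have hy : PowerSeries.mapAlgHom (PowerSeries.mapAlgHom f) (varY R) = varY R' := by
      rw [PowerSeries.mapAlgHom_apply, varY, PowerSeries.map_C, varY]
      congr 1
      exact PowerSeries.map_X _
    have h1 : ∀ g, firstVar R' (PowerSeries.mapAlgHom f g)
        = PowerSeries.mapAlgHom (PowerSeries.mapAlgHom f) (firstVar R g) := fun g => by
      ext n : 1
      rw [firstVar_apply, firstVar_apply, PowerSeries.mapAlgHom_apply, PowerSeries.mapAlgHom_apply,
        PowerSeries.coeff_map, PowerSeries.coeff_map, PowerSeries.coeff_map, PowerSeries.coeff_map]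
      exact (PowerSeries.map_C _ _).symm
    have h2 : ∀ g, secondVar R' (PowerSeries.mapAlgHom f g)
        = PowerSeries.mapAlgHom (PowerSeries.mapAlgHom f) (secondVar R g) := fun g => by
      rw [secondVar_apply, secondVar_apply, PowerSeries.mapAlgHom_apply (PowerSeries.mapAlgHom f),
        PowerSeries.map_C]
      rfl
    have h := congrArg (PowerSeries.mapAlgHom (PowerSeries.mapAlgHom f)) (ht.quadratic i j k l)
    simp only [map_smul, map_sub, map_add, map_mul, map_pow, hw, hy, ← h1, ← h2] at h
    exact h

theorem supercommute_mul {R : Type*} [Ring R] [Algebra ℂ R] {σ a b : R} {α β : ZMod 2}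
    (ha : σ * a = superSign α • (a * σ)) (hb : σ * b = superSign β • (b * σ)) :
    σ * (a * b) = superSign (α + β) • (a * b * σ) := by
  rw [← mul_assoc, ha, smul_mul_assoc, mul_assoc, hb, mul_smul_comm, smul_smul, superSign_add,
    mul_assoc]

theorem signPow_commute {D : Type*} [Monoid D] (σ : D) (a : ZMod 2) : Commute σ (signPow σ a) :=
  (Commute.refl σ).pow_right _

open QueerYangian twistedCurrent

/-- A representation of the Yangian by polynomials, where the generator `T_{ij}^{(s+1)}` acts by
a polynomial of degree at most `s`, with an operator `σ` which gives the parity. -/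
structure PolynomialModel (N : ℕ) (D : Type*) [Ring D] [Algebra ℂ D] where
  σ : D
  σ_sq : σ * σ = 1
  t : QIndex N → QIndex N → PowerSeries D[X]
  isYangianSeries : IsYangianSeries t
  parity : ∀ i j n, Polynomial.C σ * PowerSeries.coeff n (t i j)
    = superSign (i.bar + j.bar) • (PowerSeries.coeff n (t i j) * Polynomial.C σ)
  degree : ∀ i j n, (PowerSeries.coeff (n + 1) (t i j)).natDegree ≤ n

namespace PolynomialModel

variable {N : ℕ} {D : Type*} [Ring D] [Algebra ℂ D] (M : PolynomialModel N D)

theorem natDegree_hom (M : PolynomialModel N D) (x : Gen N) :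
    (M.isYangianSeries.hom (gen x)).natDegree ≤ x.s := by
  rw [M.isYangianSeries.hom_gen]
  exact M.degree _ _ _

/-- The homomorphism given by the highest coefficients. -/
noncomputable def top (M : PolynomialModel N D) : SuperEnveloping (twistedCurrent N) →ₐ[ℂ] D :=
  (lead M.natDegree_hom).comp (toGr N)

theorem top_elemF (i j : QIndex N) (s : ℕ) : M.top (SuperEnveloping.ι _ (elemF j i s))
    = -(superSign j.bar • (PowerSeries.coeff (s + 1) (M.t i j)).coeff s) := by
  rw [top, AlgHom.comp_apply, toGr_elemF, map_neg, map_smul, elemG, lead_symbol,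
    M.isYangianSeries.hom_gen, Int.toNat_natCast]

theorem σ_mul_top {a : ZMod 2} {x : twistedCurrent N}
    (hx : x ∈ LieSuperalgebra.parity (L := twistedCurrent N) a) :
    M.σ * M.top (SuperEnveloping.ι _ x) = superSign a • (M.top (SuperEnveloping.ι _ x) * M.σ) := by
  have hx' := mem_span_elemF hx
  clear hx
  induction hx' using Submodule.span_induction with
  | zero => rw [map_zero, map_zero, mul_zero, zero_mul, smul_zero]
  | add x y _ _ hx hy => rw [map_add, map_add, mul_add, hx, hy, add_mul, smul_add]
  | smul c x _ hx => rw [map_smul, map_smul, mul_smul_comm, hx, smul_mul_assoc, smul_comm]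
  | mem x hx =>
    obtain ⟨j, i, s, rfl, rfl⟩ := hx
    have h := congrArg (Polynomial.coeff · s) (M.parity i j (s + 1))
    simp only [Polynomial.coeff_C_mul, Polynomial.coeff_smul, Polynomial.coeff_mul_C] at h
    rw [top_elemF, mul_neg, neg_mul, mul_smul_comm, h, smul_mul_assoc, smul_neg, smul_comm,
      add_comm]

/-- The model by scalars. -/
noncomputable def scalar (N : ℕ) : PolynomialModel N ℂ where
  σ := 1
  σ_sq := mul_one 1
  -- Zero elements satisfy the matrix unit relations, and the resulting series is
  -- $T_{ij}(u)=\delta_{ij}$.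
  t := siteSeries (fun _ _ => 0) 0
  isYangianSeries := isYangianSeries_siteSeries (fun _ _ _ _ => by rw [mul_zero, ite_self])
    fun r => Commute.zero_left r
  parity i j n := by
    cases n with
    | zero =>
      rw [coeff_zero_siteSeries]
      split_ifs with h
      · rw [h, CharTwo.add_self_eq_zero, superSign_zero, one_smul, mul_comm]
      · rw [mul_zero, zero_mul, smul_zero]
    | succ n =>
      rw [coeff_succ_siteSeries, mul_zero, mul_zero, add_zero, smul_zero, neg_zero, mul_zero,
        zero_mul, smul_zero]
  degree i j n := by
    rw [coeff_succ_siteSeries, mul_zero, mul_zero, add_zero, smul_zero, neg_zero,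
      Polynomial.natDegree_zero]
    exact Nat.zero_le n

end PolynomialModel

/-! ### The site algebra -/

/-- The algebra `gl_{N|N}[u] ⊕ ℂ`. -/
abbrev SiteAlgebra (N : ℕ) : Type := CurrentMatrix N × ℂ

namespace SiteAlgebra

open CurrentMatrix

variable {N : ℕ}

/-- The parity operator. -/
noncomputable def sign (N : ℕ) : SiteAlgebra N :=
  (Matrix.diagonal fun i => Polynomial.C (superSign i.bar), 1)

theorem sign_mul_sign : sign N * sign N = 1 := by
  rw [sign, Prod.mk_mul_mk, Matrix.diagonal_mul_diagonal, mul_one]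
  simp only [← map_mul, superSign_mul_self, map_one, Matrix.diagonal_one]
  rfl

theorem sign_mul {a : ZMod 2} {m : CurrentMatrix N} (hm : IsHomog a m) :
    sign N * (m, 0) = superSign a • ((m, 0) * sign N) := by
  rw [sign, Prod.mk_mul_mk, Prod.mk_mul_mk, Prod.smul_mk, mul_zero, zero_mul, smul_zero]
  congr 1
  ext1 i j
  rw [Matrix.diagonal_mul, Matrix.smul_apply, Matrix.mul_diagonal]
  by_cases h : i.bar + j.bar = a
  · rw [← h, superSign_add, mul_comm (m i j), ← Polynomial.smul_eq_C_mul,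
      ← Polynomial.smul_eq_C_mul, smul_smul, mul_assoc, superSign_mul_self, mul_one]
  · rw [hm i j h, mul_zero, zero_mul, smul_zero]

/-- The homogeneous component of degree `a`. -/
def grading (a : ZMod 2) : Submodule ℂ (SiteAlgebra N) where
  carrier := {e | IsHomog a e.1 ∧ (a ≠ 0 → e.2 = 0)}
  zero_mem' := ⟨fun _ _ _ => rfl, fun _ => rfl⟩
  add_mem' {x y} hx hy := by
    refine ⟨fun i j h => ?_, fun h => ?_⟩
    · rw [Prod.fst_add, Matrix.add_apply, hx.1 i j h, hy.1 i j h, add_zero]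
    · rw [Prod.snd_add, hx.2 h, hy.2 h, add_zero]
  smul_mem' c x hx := by
    refine ⟨hx.1.smul c, fun h => ?_⟩
    rw [Prod.smul_snd, hx.2 h, smul_zero]

instance : SetLike.GradedMonoid (grading (N := N)) where
  one_mem := by
    refine ⟨fun i j h => ?_, fun h => absurd rfl h⟩
    refine Matrix.one_apply_ne ?_
    rintro rfl
    exact h (CharTwo.add_self_eq_zero _)
  mul_mem a b x y hx hy := by
    refine ⟨hx.1.mul hy.1, fun h => ?_⟩
    rw [Prod.snd_mul]
    by_cases ha : a = 0
    · rw [hy.2 fun hb => h (by rw [ha, hb, add_zero]), mul_zero]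
    · rw [hx.2 ha, zero_mul]

/-- The projection onto the homogeneous component of degree `a`. -/
noncomputable def proj (a : ZMod 2) : SiteAlgebra N →ₗ[ℂ] SiteAlgebra N :=
  (component a).prodMap (if a = 0 then LinearMap.id else 0)

theorem proj_of_mem {a : ZMod 2} {e : SiteAlgebra N} (he : e ∈ grading a) (b : ZMod 2) :
    proj b e = if a = b then e else 0 := by
  refine Prod.ext ?_ ?_
  · change component b e.1 = _
    rw [he.1.component_eq]
    by_cases h : b = a
    · rw [if_pos h, if_pos h.symm]
    · rw [if_neg h, if_neg (Ne.symm h)]; rfl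
  · change (if b = 0 then LinearMap.id else 0 : ℂ →ₗ[ℂ] ℂ) e.2 = _
    by_cases h : a = b
    · subst h
      rw [if_pos rfl]
      split_ifs with h0
      · rfl
      · rw [he.2 h0]; rfl
    · rw [if_neg h]
      split_ifs with h0
      · exact he.2 fun ha => h (ha.trans h0.symm)
      · rfl

theorem eta_eta (m : CurrentMatrix N) : eta (eta m) = m := by
  ext1 i j; rw [eta_apply, eta_apply, neg_neg, neg_neg]

theorem substNeg_substNeg (m : CurrentMatrix N) : substNeg (substNeg m) = m := by
  ext1 i j
  rw [substNeg_apply, substNeg_apply, Polynomial.comp_assoc]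
  simp

theorem add_eta_substNeg_mem (m : CurrentMatrix N) : m + eta (substNeg m) ∈ twistedCurrent N := by
  change eta _ = substNeg _
  rw [map_add, map_add, eta_eta, show substNeg (eta (substNeg m)) = eta (substNeg (substNeg m)) from
    rfl, substNeg_substNeg, add_comm]

/-- The projection of `gl_{N|N}[u]` onto the subspace of the matrices with `η(X(u)) = X(-u)`. -/
noncomputable def symmetrize : CurrentMatrix N →ₗ[ℂ] twistedCurrent N :=
  (1 / 2 : ℂ) • LinearMap.codRestrict (twistedCurrent N)
    (LinearMap.id + eta.toLinearMap ∘ₗ substNeg.toLinearMap) add_eta_substNeg_mem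

theorem symmetrize_coe (x : twistedCurrent N) : symmetrize (x : CurrentMatrix N) = x := by
  refine Subtype.ext ?_
  change (1 / 2 : ℂ) • ((x : CurrentMatrix N) + eta (substNeg (x : CurrentMatrix N))) = _
  have hx : eta (x : CurrentMatrix N) = substNeg x := x.2
  rw [← hx]
  rw [eta_eta, ← two_smul ℂ, smul_smul]
  norm_num

/-- The projection onto `𝔤` which vanishes on the unit. -/
noncomputable def retract : SiteAlgebra N →ₗ[ℂ] twistedCurrent N :=
  symmetrize ∘ₗ (LinearMap.fst ℂ _ _ - LinearMap.toSpanSingleton ℂ _ 1 ∘ₗ LinearMap.snd ℂ _ _)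

theorem retract_apply (m : CurrentMatrix N) (c : ℂ) : retract (m, c) = symmetrize (m - c • 1) := rfl

end SiteAlgebra

/-! ### Adding one site to a model. -/

/-- Modulo polynomials of degree less than `n`, only the outer terms contribute to the coefficient
of index `n + 1` of a product of filtered series. -/
theorem coeff_coeff_succ_mul {A : Type*} [Ring A] {f g : PowerSeries A[X]}
    (hf : ∀ n, (PowerSeries.coeff (n + 1) f).natDegree ≤ n)
    (hg : ∀ n, (PowerSeries.coeff (n + 1) g).natDegree ≤ n) {n k : ℕ} (hk : n ≤ k) :
    (PowerSeries.coeff (n + 1) (f * g)).coeff k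
      = (PowerSeries.coeff 0 f * PowerSeries.coeff (n + 1) g).coeff k
        + (PowerSeries.coeff (n + 1) f * PowerSeries.coeff 0 g).coeff k := by
  rw [PowerSeries.coeff_mul, Finset.Nat.sum_antidiagonal_succ, Polynomial.coeff_add]
  congr 1
  cases n with
  | zero => rw [Finset.Nat.antidiagonal_zero, Finset.sum_singleton]
  | succ n =>
    rw [Finset.Nat.sum_antidiagonal_succ', Polynomial.coeff_add, Polynomial.finsetSum_coeff,
      add_eq_left]
    refine Finset.sum_eq_zero fun p hp => Polynomial.coeff_eq_zero_of_natDegree_lt ?_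
    have h1 := Polynomial.natDegree_mul_le_of_le (hf p.1) (hg p.2)
    have h2 := Finset.HasAntidiagonal.mem_antidiagonal.1 hp
    exact h1.trans_lt (by omega)

/-- In highest degree the comultiplication becomes primitive. Taking `k = n` gives the highest
coefficient, and `k > n` gives the degree bound for the product. -/
theorem coeff_coeff_succ_superMatMul {N : ℕ} {A : Type*} [Ring A] [Algebra ℂ A]
    {x y : QIndex N → QIndex N → PowerSeries A[X]}
    (hx0 : ∀ i j, PowerSeries.coeff 0 (x i j) = if i = j then 1 else 0)
    (hy0 : ∀ i j, PowerSeries.coeff 0 (y i j) = if i = j then 1 else 0)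
    (hx : ∀ i j n, (PowerSeries.coeff (n + 1) (x i j)).natDegree ≤ n)
    (hy : ∀ i j n, (PowerSeries.coeff (n + 1) (y i j)).natDegree ≤ n)
    (i j : QIndex N) {n k : ℕ} (hk : n ≤ k) :
    (PowerSeries.coeff (n + 1) (superMatMul x y i j)).coeff k
      = (PowerSeries.coeff (n + 1) (x i j)).coeff k
        + (PowerSeries.coeff (n + 1) (y i j)).coeff k := by
  have hs : ∀ (c : ℂ) (f : PowerSeries A[X]), PowerSeries.coeff (n + 1) (c • f)
    = c • PowerSeries.coeff (n + 1) f := fun _ _ => rfl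
  have hm : ∀ m, (PowerSeries.coeff (n + 1)
      (superSign ((i.bar + m.bar) * (m.bar + j.bar)) • (x i m * y m j))).coeff k
      = (if i = m then (PowerSeries.coeff (n + 1) (y i j)).coeff k else 0)
        + if m = j then (PowerSeries.coeff (n + 1) (x i j)).coeff k else 0 := by
    intro m
    rw [hs, Polynomial.coeff_smul, coeff_coeff_succ_mul (hx i m) (hy m j) hk, hx0, hy0, smul_add]
    congr 1
    · split_ifs with h
      · rw [← h, CharTwo.add_self_eq_zero, zero_mul, superSign_zero, one_smul, one_mul]
      · rw [zero_mul, Polynomial.coeff_zero, smul_zero]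
    · split_ifs with h
      · rw [← h, CharTwo.add_self_eq_zero, mul_zero, superSign_zero, one_smul, mul_one]
      · rw [mul_zero, Polynomial.coeff_zero, smul_zero]
  rw [superMatMul, map_sum, Polynomial.finsetSum_coeff, Finset.sum_congr rfl fun m _ => hm m,
    Finset.sum_add_distrib, Finset.sum_ite_eq, Finset.sum_ite_eq', if_pos (Finset.mem_univ _),
    if_pos (Finset.mem_univ _), add_comm]

open QueerYangian twistedCurrent CurrentMatrix

/-- A ring which contains commuting images of `D` and of the site algebra, where the scalar
matrices are central. -/
structure SiteProduct (N : ℕ) (D B : Type*) [Ring D] [Algebra ℂ D] [Ring B] [Algebra ℂ B] where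
  left : D →ₐ[ℂ] B
  right : SiteAlgebra N →ₐ[ℂ] B
  commute : ∀ d e, Commute (right e) (left d)
  central : ∀ (p : ℂ[X]) (b : B), Commute (right (algebraMap ℂ[X] (CurrentMatrix N) p, 0)) b

namespace SiteProduct

variable {N : ℕ} {D B : Type*} [Ring D] [Algebra ℂ D] [Ring B] [Algebra ℂ B]
  (P : SiteProduct N D B)

/-- The tensor product. -/
noncomputable def tensor (N : ℕ) (D : Type*) [Ring D] [Algebra ℂ D] :
    SiteProduct N D (D ⊗[ℂ] SiteAlgebra N) where
  left := Algebra.TensorProduct.includeLeft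
  right := Algebra.TensorProduct.includeRight
  commute d e := by
    change _ * _ = _ * _
    rw [Algebra.TensorProduct.includeLeft_apply, Algebra.TensorProduct.includeRight_apply,
      Algebra.TensorProduct.tmul_mul_tmul, Algebra.TensorProduct.tmul_mul_tmul, one_mul, one_mul,
      mul_one, mul_one]
  central p b := by
    induction b using TensorProduct.induction_on with
    | zero => exact Commute.zero_right _
    | add x y hx hy => exact hx.add_right hy
    | tmul d e =>
      change _ * _ = _ * _
      rw [Algebra.TensorProduct.includeRight_apply, Algebra.TensorProduct.tmul_mul_tmul,
        Algebra.TensorProduct.tmul_mul_tmul, one_mul, mul_one]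
      congr 1
      exact Prod.ext (Algebra.commutes p e.1) (mul_comm _ _)

/-- The product of an element of `D` and an element of the site algebra. -/
noncomputable def tmul (d : D) (e : SiteAlgebra N) : B := P.left d * P.right e

theorem tmul_mul (d d' : D) (e e' : SiteAlgebra N) :
    P.tmul d e * P.tmul d' e' = P.tmul (d * d') (e * e') := by
  rw [tmul, tmul, tmul, map_mul, map_mul, mul_assoc, ← mul_assoc (P.right e), (P.commute d' e).eq,
    mul_assoc, mul_assoc]

/-- The multiplication by a scalar matrix. -/
noncomputable def scalar (p : ℂ[X]) : B := P.right (algebraMap ℂ[X] (CurrentMatrix N) p, 0)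

theorem scalar_pow_mul (p : ℂ[X]) (s : D) (i j : QIndex N) (n : ℕ) :
    P.scalar p ^ n * P.tmul s (Matrix.single i j 1, 0) = P.tmul s (Matrix.single i j (p ^ n), 0) := by
  induction n with
  | zero => rw [pow_zero, one_mul, pow_zero]
  | succ n ih =>
    rw [pow_succ', mul_assoc, ih, scalar, tmul, tmul, ← mul_assoc, (P.central p _).eq, mul_assoc,
      ← map_mul, Prod.mk_mul_mk, mul_zero, ← Algebra.smul_def, Matrix.smul_single, smul_eq_mul,
      pow_succ']

theorem scalar_neg (p : ℂ[X]) : P.scalar (-p) = -P.scalar p := by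
  rw [scalar, scalar, ← map_neg, map_neg, Prod.neg_mk, neg_zero]

/-- The matrix units, multiplied by the powers of `σ`. -/
noncomputable def unit (σ : D) (i j : QIndex N) : B[X] :=
  Polynomial.C (P.tmul (signPow σ (i.bar + j.bar)) (Matrix.single i j 1, 0))

/-- The powers of `σ` make these elements supercommute with the entries of the model without
spoiling the matrix unit relations, so an ordinary tensor product can replace the super one. -/
theorem unit_mul {σ : D} (hσ : σ * σ = 1) (i j k l : QIndex N) :
    P.unit σ i j * P.unit σ k l = if j = k then P.unit σ i l else 0 := by
  rw [unit, unit, ← map_mul, tmul_mul, Prod.mk_mul_mk, mul_zero]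
  split_ifs with h
  · subst h
    rw [Matrix.single_mul_single_same, mul_one, signPow_mul hσ, unit, add_assoc, ← add_assoc j.bar,
      CharTwo.add_self_eq_zero, zero_add]
  · rw [Matrix.single_mul_single_of_ne _ _ _ _ h, tmul]
    exact (congrArg Polynomial.C ((congrArg _ (map_zero P.right)).trans (mul_zero _))).trans
      (map_zero _)

/-- The entries of the evaluation representation of the Yangian on one site. -/
noncomputable def entry (σ : D) : QIndex N → QIndex N → PowerSeries B[X] :=
  -- The evaluation point is the current variable times the degree marker, so that $u^{-(n+1)}$
  -- comes with $X^n$.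
  siteSeries (P.unit σ) (Polynomial.C (P.scalar Polynomial.X) * Polynomial.X)

theorem isYangianSeries_entry {σ : D} (hσ : σ * σ = 1) : IsYangianSeries (P.entry σ) := by
  refine isYangianSeries_siteSeries (P.unit_mul hσ) fun r => ?_
  refine Commute.mul_left ?_ (Polynomial.commute_X r)
  ext n
  rw [Polynomial.coeff_C_mul, Polynomial.coeff_mul_C]
  exact P.central _ _

/-- Here $F_{ji}^{(n)}$ and the sign $-(-1)^{\bar\jmath}$ of the theorem appear: they are read off
from the evaluation representation. -/
theorem coeff_succ_entry (σ : D) (i j : QIndex N) (n : ℕ) :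
    PowerSeries.coeff (n + 1) (P.entry σ i j) = -(superSign j.bar •
      (Polynomial.C (P.tmul (signPow σ (i.bar + j.bar)) ((elemF j i n : CurrentMatrix N), 0))
        * Polynomial.X ^ n)) := by
  have hp : ∀ (p : ℂ[X]) (k l : QIndex N),
      (Polynomial.C (P.scalar p) * Polynomial.X) ^ n * P.unit σ k l
      = Polynomial.C (P.tmul (signPow σ (k.bar + l.bar)) (Matrix.single k l (p ^ n), 0))
        * Polynomial.X ^ n := fun p k l => by
    rw [(Polynomial.commute_X _).symm.mul_pow, ← map_pow, mul_assoc,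
      ((Polynomial.commute_X (P.unit σ k l)).pow_left n).eq, ← mul_assoc, unit, ← map_mul,
      scalar_pow_mul]
  rw [entry, coeff_succ_siteSeries, hp, ← neg_mul, ← map_neg, ← scalar_neg, hp, ← add_mul,
    ← map_add, QIndex.neg_bar_add_neg_bar, tmul, tmul, ← mul_add, ← map_add, Prod.mk_add_mk, add_zero,
    add_comm j.bar]
  rfl

theorem natDegree_entry (σ : D) (i j : QIndex N) (n : ℕ) :
    (PowerSeries.coeff (n + 1) (P.entry σ i j)).natDegree ≤ n := by
  rw [coeff_succ_entry, Polynomial.natDegree_neg]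
  exact (Polynomial.natDegree_smul_le _ _).trans (Polynomial.natDegree_C_mul_X_pow_le _ _)

theorem commute_map_left (e : SiteAlgebra N) (p : D[X]) :
    Commute (Polynomial.C (P.right e)) (Polynomial.mapAlgHom P.left p) := by
  ext n
  rw [Polynomial.coeff_C_mul, Polynomial.coeff_mul_C, Polynomial.coe_mapAlgHom,
    Polynomial.coeff_map]
  exact P.commute _ _

theorem C_tmul (d : D) (e : SiteAlgebra N) : Polynomial.C (P.tmul d e)
    = Polynomial.mapAlgHom P.left (Polynomial.C d) * Polynomial.C (P.right e) := by
  rw [Polynomial.coe_mapAlgHom, Polynomial.map_C, tmul, map_mul]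
  rfl

theorem C_tmul_mul_map_left {d : D} {p : D[X]} {c : ℂ}
    (h : Polynomial.C d * p = c • (p * Polynomial.C d)) (e : SiteAlgebra N) :
    Polynomial.C (P.tmul d e) * Polynomial.mapAlgHom P.left p
      = c • (Polynomial.mapAlgHom P.left p * Polynomial.C (P.tmul d e)) := by
  rw [C_tmul, mul_assoc, (P.commute_map_left e p).eq, ← mul_assoc, ← map_mul, h, map_smul, map_mul,
    smul_mul_assoc, mul_assoc]

end SiteProduct

namespace PolynomialModel

variable {N : ℕ} {D B : Type*} [Ring D] [Algebra ℂ D] [Ring B] [Algebra ℂ B]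
  (M : PolynomialModel N D) (P : SiteProduct N D B)

theorem signPow_parity (a : ZMod 2) (i j : QIndex N) (n : ℕ) :
    Polynomial.C (signPow M.σ a) * PowerSeries.coeff n (M.t i j)
      = superSign (a * (i.bar + j.bar)) •
        (PowerSeries.coeff n (M.t i j) * Polynomial.C (signPow M.σ a)) := by
  have h := signPow_mul_of_supercommute (M.parity i j n) a
  rwa [show signPow (Polynomial.C M.σ) a = Polynomial.C (signPow M.σ a) from
    (map_pow Polynomial.C _ _).symm] at h

/-- The entries of the model, as elements of the product. -/
noncomputable def leftEntry (i j : QIndex N) : PowerSeries B[X] :=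
  PowerSeries.mapAlgHom (Polynomial.mapAlgHom P.left) (M.t i j)

theorem coeff_leftEntry (i j : QIndex N) (n : ℕ) : PowerSeries.coeff n (M.leftEntry P i j)
    = Polynomial.mapAlgHom P.left (PowerSeries.coeff n (M.t i j)) := by
  rw [leftEntry, PowerSeries.mapAlgHom_apply, PowerSeries.coeff_map]
  rfl

theorem isYangianSeries_leftEntry : IsYangianSeries (M.leftEntry P) :=
  M.isYangianSeries.map (Polynomial.mapAlgHom P.left)

theorem natDegree_leftEntry (i j : QIndex N) (n : ℕ) :
    (PowerSeries.coeff (n + 1) (M.leftEntry P i j)).natDegree ≤ n := by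
  rw [coeff_leftEntry]
  exact (Polynomial.natDegree_map_le).trans (M.degree i j n)

/-- The site matrices commute with the image of `D`, so the sign comes entirely from the power of
`σ` in front of them. -/
theorem entry_supercommute (i j k l : QIndex N) (p q : ℕ) :
    PowerSeries.coeff p (P.entry M.σ i j) * PowerSeries.coeff q (M.leftEntry P k l)
      = superSign ((i.bar + j.bar) * (k.bar + l.bar)) •
        (PowerSeries.coeff q (M.leftEntry P k l) * PowerSeries.coeff p (P.entry M.σ i j)) := by
  cases p with
  | zero =>
    rw [(P.isYangianSeries_entry M.σ_sq).coeff_zero]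
    split_ifs with h
    · rw [h, CharTwo.add_self_eq_zero, zero_mul, superSign_zero, one_smul, one_mul, mul_one]
    · rw [zero_mul, mul_zero, smul_zero]
  | succ n =>
    rw [P.coeff_succ_entry, coeff_leftEntry, neg_mul, mul_neg, smul_mul_assoc, mul_smul_comm,
      mul_assoc, ((Polynomial.commute_X (Polynomial.mapAlgHom P.left _)).pow_left n).eq,
      ← mul_assoc, P.C_tmul_mul_map_left (M.signPow_parity _ k l q), smul_mul_assoc, smul_neg,
      smul_comm, mul_assoc]

theorem entry_parity (i j : QIndex N) (n : ℕ) :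
    Polynomial.C (P.tmul M.σ (SiteAlgebra.sign N)) * PowerSeries.coeff n (P.entry M.σ i j)
      = superSign (i.bar + j.bar) • (PowerSeries.coeff n (P.entry M.σ i j)
        * Polynomial.C (P.tmul M.σ (SiteAlgebra.sign N))) := by
  cases n with
  | zero =>
    rw [(P.isYangianSeries_entry M.σ_sq).coeff_zero]
    split_ifs with h
    · rw [h, CharTwo.add_self_eq_zero, superSign_zero, one_smul, one_mul, mul_one]
    · rw [zero_mul, mul_zero, smul_zero]
  | succ n =>
    have hs : ∀ (c : ℂ) d e, P.tmul d (c • e) = c • P.tmul d e := fun c d e => by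
      rw [SiteProduct.tmul, map_smul, mul_smul_comm, SiteProduct.tmul]
    rw [P.coeff_succ_entry, neg_mul, mul_neg, smul_mul_assoc, mul_smul_comm, mul_assoc,
      ((Polynomial.commute_X (Polynomial.C (P.tmul M.σ (SiteAlgebra.sign N)))).pow_left n).eq,
      ← mul_assoc, ← mul_assoc, ← map_mul, ← map_mul, P.tmul_mul, P.tmul_mul,
      SiteAlgebra.sign_mul (elemF_isHomog j i n), (signPow_commute M.σ _).eq, hs,
      ← Polynomial.smul_C, smul_mul_assoc, smul_neg, smul_comm, add_comm j.bar]

/-- The tensor product of a model and the evaluation representation on one site. -/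
noncomputable def extend : PolynomialModel N B where
  σ := P.tmul M.σ (SiteAlgebra.sign N)
  σ_sq := by
    rw [P.tmul_mul, M.σ_sq, SiteAlgebra.sign_mul_sign, SiteProduct.tmul, map_one, map_one, one_mul]
  t := superMatMul (M.leftEntry P) (P.entry M.σ)
  isYangianSeries := (M.isYangianSeries_leftEntry P).superMatMul (P.isYangianSeries_entry M.σ_sq)
    (M.entry_supercommute P)
  parity i j n := by
    have hs : ∀ (c : ℂ) (f : PowerSeries B[X]), PowerSeries.coeff n (c • f)
      = c • PowerSeries.coeff n f := fun _ _ => rfl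
    rw [superMatMul, map_sum, Finset.mul_sum, Finset.sum_mul, Finset.smul_sum]
    refine Finset.sum_congr rfl fun m _ => ?_
    rw [hs, mul_smul_comm, smul_mul_assoc, smul_comm (superSign (i.bar + j.bar))]
    congr 1
    rw [PowerSeries.coeff_mul, Finset.mul_sum, Finset.sum_mul, Finset.smul_sum]
    refine Finset.sum_congr rfl fun p _ => ?_
    have h1 : Polynomial.C (P.tmul M.σ (SiteAlgebra.sign N))
        * PowerSeries.coeff p.1 (M.leftEntry P i m)
        = superSign (i.bar + m.bar) • (PowerSeries.coeff p.1 (M.leftEntry P i m)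
          * Polynomial.C (P.tmul M.σ (SiteAlgebra.sign N))) := by
      rw [coeff_leftEntry]
      exact P.C_tmul_mul_map_left (M.parity i m p.1) _
    -- The parity of the intermediate index `m` occurs twice and drops out.
    rw [supercommute_mul h1 (M.entry_parity P m j p.2), add_assoc, ← add_assoc m.bar,
      CharTwo.add_self_eq_zero, zero_add]
  degree i j n := by
    refine Polynomial.natDegree_le_iff_coeff_eq_zero.2 fun k hk => ?_
    rw [coeff_coeff_succ_superMatMul (M.isYangianSeries_leftEntry P).coeff_zero
      (P.isYangianSeries_entry M.σ_sq).coeff_zero (M.natDegree_leftEntry P) (P.natDegree_entry M.σ)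
      i j hk.le, Polynomial.coeff_eq_zero_of_natDegree_lt
      ((M.natDegree_leftEntry P i j n).trans_lt hk), Polynomial.coeff_eq_zero_of_natDegree_lt
      ((P.natDegree_entry M.σ i j n).trans_lt hk), add_zero]

/-- The new site adds the tautological action of $\mathfrak g$, twisted by parity, which is the
coproduct formula required by `CoproductData`. -/
theorem extend_top {a : ZMod 2} {x : twistedCurrent N}
    (hx : x ∈ LieSuperalgebra.parity (L := twistedCurrent N) a) :
    (M.extend P).top (SuperEnveloping.ι _ x) = P.left (M.top (SuperEnveloping.ι _ x))
      + P.tmul (signPow M.σ a) ((x : CurrentMatrix N), 0) := by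
  have hx' := mem_span_elemF hx
  clear hx
  simp only [SiteProduct.tmul, show ∀ x : twistedCurrent N, (((x : CurrentMatrix N), 0) :
    SiteAlgebra N) = (LinearMap.inl ℂ _ _ ∘ₗ (twistedCurrent N).subtype) x from fun _ => rfl]
  induction hx' using Submodule.span_induction with
  | zero => rw [map_zero, map_zero, map_zero, map_zero, map_zero, map_zero, mul_zero, add_zero]
  | add x y _ _ hx hy =>
    rw [map_add, map_add, map_add, map_add, map_add, map_add, hx, hy, mul_add, add_add_add_comm]
  | smul c x _ hx =>
    rw [map_smul, map_smul, map_smul, map_smul, map_smul, map_smul, hx, mul_smul_comm, smul_add]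
  | mem x hx =>
    obtain ⟨j, i, s, rfl, rfl⟩ := hx
    rw [top_elemF, top_elemF]
    change -(superSign j.bar • (PowerSeries.coeff (s + 1)
      (superMatMul (M.leftEntry P) (P.entry M.σ) i j)).coeff s) = _ + P.tmul _ (_, 0)
    rw [coeff_coeff_succ_superMatMul (M.isYangianSeries_leftEntry P).coeff_zero
      (P.isYangianSeries_entry M.σ_sq).coeff_zero (M.natDegree_leftEntry P) (P.natDegree_entry M.σ)
      i j le_rfl, coeff_leftEntry, Polynomial.coe_mapAlgHom, Polynomial.coeff_map,
      P.coeff_succ_entry, Polynomial.coeff_neg, Polynomial.coeff_smul,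
      Polynomial.coeff_C_mul_X_pow, if_pos rfl, smul_add, smul_neg, smul_smul,
      superSign_mul_self, one_smul, neg_add, neg_neg, map_neg, map_smul, add_comm j.bar]
    rfl

/-- The coproduct structure on the highest coefficients of a tensor product of models. -/
noncomputable def coproductData :
    SuperEnveloping.CoproductData (twistedCurrent N) M.top
      (M.extend (SiteProduct.tensor N D)).top where
  σ := M.σ
  σ_sq := M.σ_sq
  σ_mul := M.σ_mul_top
  grading := SiteAlgebra.grading
  graded := inferInstance
  proj := SiteAlgebra.proj
  proj_of_mem := SiteAlgebra.proj_of_mem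
  j := LinearMap.inl ℂ _ _ ∘ₗ (twistedCurrent N).subtype
  j_mem hx := ⟨hx, fun _ => rfl⟩
  retract := SiteAlgebra.retract
  retract_j x := by
    change SiteAlgebra.retract ((x : CurrentMatrix N), 0) = x
    rw [SiteAlgebra.retract_apply, zero_smul, sub_zero, SiteAlgebra.symmetrize_coe]
  -- The identity matrix lies in $\mathfrak g$ and must be retained there, while the unit must go to
  -- 0. The summand ℂ separates them: the unit is `(1, 1)`, and the identity matrix is embedded as
  -- `(1, 0)`.
  retract_one := by
    change SiteAlgebra.retract (1, 1) = 0
    rw [SiteAlgebra.retract_apply, one_smul, sub_self, map_zero]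
  counit := AlgHom.snd ℂ _ _
  counit_j _ := rfl
  map_ι hx := by
    refine (M.extend_top (SiteProduct.tensor N D) hx).trans ?_
    change _ ⊗ₜ[ℂ] 1 + (_ ⊗ₜ[ℂ] 1) * (1 ⊗ₜ[ℂ] _) = _
    rw [Algebra.TensorProduct.tmul_mul_tmul, mul_one, one_mul]
    rfl

theorem scalar_top_injective :
    ∀ u ∈ SuperEnveloping.wordFiltration (twistedCurrent N) 1, (scalar N).top u = 0 → u = 0 := by
  intro u hu h
  rw [SuperEnveloping.wordFiltration, pow_zero, Submodule.mem_one] at hu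
  obtain ⟨c, rfl⟩ := hu
  rw [AlgHom.commutes] at h
  have hc : c = 0 := h
  rw [hc, map_zero]

variable (N) in
/-- The words of bounded length are separated by a model. -/
theorem exists_injective (n : ℕ) : ∃ (D : Type) (_ : Ring D) (_ : Algebra ℂ D)
    (M : PolynomialModel N D),
    ∀ u ∈ SuperEnveloping.wordFiltration (twistedCurrent N) (n + 1), M.top u = 0 → u = 0 := by
  induction n with
  | zero => exact ⟨ℂ, inferInstance, inferInstance, scalar N, scalar_top_injective⟩
  | succ n ih =>
    obtain ⟨D, _, _, M, h⟩ := ih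
    exact ⟨D ⊗[ℂ] SiteAlgebra N, inferInstance, inferInstance, M.extend (SiteProduct.tensor N D),
      M.coproductData.injective_succ (Nat.succ_ne_zero n) h⟩

end PolynomialModel

/-- `top` factors through `toGr`, and each element has bounded length, so some model detects it. -/
theorem QueerYangian.toGr_injective (N : ℕ) : Function.Injective (toGr N) := by
  rw [injective_iff_map_eq_zero]
  intro u hu
  obtain ⟨n, hn⟩ := SuperEnveloping.exists_mem_wordFiltration u
  obtain ⟨D, _, _, M, h⟩ := PolynomialModel.exists_injective N n
  refine h u hn ?_
  rw [PolynomialModel.top, AlgHom.comp_apply, hu, map_zero]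

theorem theorem2p3 (N : ℕ) :
    IsSuperGrading (SuperEnveloping.parity (twistedCurrent N)) ∧
    IsSuperGrading (QueerYangian.grParity N) ∧
    ∃ Φ : SuperEnveloping (twistedCurrent N) ≃ₐ[ℂ] QueerYangian.Gr N,
      (∀ (i j : QIndex N) (s : ℕ),
        Φ (SuperEnveloping.ι (twistedCurrent N) (twistedCurrent.elemF j i s))
          = -(superSign j.bar • QueerYangian.elemG i j s)) ∧
      ∀ a : ZMod 2,
        (SuperEnveloping.parity (twistedCurrent N) a).map Φ.toLinearMap
          = QueerYangian.grParity N a := by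
  have h1 := SuperEnveloping.isSuperGrading_parity (twistedCurrent N)
  let Φ := AlgEquiv.ofBijective (toGr N) ⟨toGr_injective N, toGr_surjective⟩
  have h2 : ∀ a, (SuperEnveloping.parity (twistedCurrent N) a).map Φ.toLinearMap
      = grParity N a := map_parity_toGr
  refine ⟨h1, ?_, Φ, toGr_elemF, h2⟩
  -- The gradation of the graded algebra is the image of that of the enveloping algebra.
  have h3 := h1.map Φ
  simp only [h2] at h3
  exact h3
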